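/- **Setting.** All logarithms are binary, and $\log y=1$ for $y<2$. Let $w\ge 1$ and let $S$ be a nonempty set of $n$ binary strings of length $w$ (identified with integers in $[0,2^w)$, so lexicographic order is numerical order), available as a sorted array $S[0],\dots,S[n-1]$. For a string $x$ of length $w$ let $x^-=\max\{y\in S\mid y<x\}$, $x^+=\min\{y\in S\mid y\ge x\}$ and $d(x,S)=\min\{x^+-x,\;x-x^-\}$ (if only one of $x^\pm$ exists, $d(x,S)$ is the distance from that one). The machine is a RAM with $w$-bit words and unit-cost instructions (arithmetic, bitwise and shift operations, comparisons, most significant bit, access to $S[i]$, access to $n-1$ and $w$); moreover, an $r$-bit static function on $m$ keys (strings of length at most $w$) can be evaluated in constant time and is stored in $rm+cm+o(m)$ bits, for some constant $c$, its values outside of its domain being arbitrary $r$-bit values. **Compacted trie.** For a node $\alpha$ of the compacted trie of $S$, the extent $e_\alpha$ is the longest common prefix of the leaves below $\alpha$; the name $n_\alpha$ is the shortest prefix of $e_\alpha$ having the same leaves below it; the skip interval is $[|n_\alpha|\,..\,|e_\alpha|]$ ($[1\,..\,|e_\alpha|]$ for the root); the handle $h_\alpha$ is the prefix of $e_\alpha$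 whose length is the number in the skip interval divisible by the largest power of two (the empty string if the interval is empty). The exit node of a string $p$ is the node $\alpha$ such that $n_\alpha\preceq p$ and either $e_\alpha=p$ or $e_\alpha\not\preceq p$, where $\preceq$ is the prefix order. **Index.** It consists of the following static functions. (1) $h_\alpha\mapsto|n_\alpha|$ for internal nodes $\alpha$. (2) A range locator, which given a name $p$ returns the least index $\mathrm{left}(p)$ and the largest index $\mathrm{right}(p)$ in $S$ of a string prefixed by $p$. Its markers are, for each name $p$, the least string of length $w$ prefixed by $p$ and the least string of length $w$ greater than all strings prefixed by $p$ (if any); they are divided in increasing order into consecutive buckets of $\lfloor\log_2 n\rfloor+1$ elements (here with the true logarithm; the last bucket may be smaller). It is made of three static functions, giving for each marker the length of the longest common prefix of its bucket, for each such common prefix the number of elements of $S$ smaller than the first marker of the bucket, and for each marker $k$ the number of elements of $S$ smaller than $k$ minus the latter number. (3) Let $P=\{y[0..w-2^{2^i})\mid y\in S,\ 2^{2^i}\le w/2\}$, and let $Q$ contain, for each node $\alpha$, the shortest $p\in P$ with $n_\alpha\preceq p\preceq e_\alpha$, if any. The index stores the map from $q\in Q$ to the length of the name of the exit node of $q$,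 and the map from $p\in P$ to the smallest $i$ such that $w-2^{2^i}\le|p|$ and $p[0..w-2^{2^i})\in Q$. **Operations.** $\mathrm{extent}(p)$ is the longest common prefix of $S[\mathrm{left}(p)]$ and $S[\mathrm{right}(p)]$. For any string $h$, $T(h)$ is computed as $\mathrm{extent}(h[0..t))$, where $t$ is the value of (1) on $h$ (the extent of the root is returned instead if left and right indices coincide). For any string $p$, $f(p)$ is the value of the first map in (3) on $p[0..w-2^{2^i})$, $i$ being the value of the second map on $p$; $\hat f(p)=f(p)$ if $t=f(p)$ satisfies $t\le|p|$ and $p\preceq\mathrm{extent}(p[0..t))$, and $\hat f(p)=\bot$ otherwise; $\hat f(\bot)=\bot$. $\mathrm{pred}(x,t)$ is $\mathrm{left}(x[0..t))-1$ if $x\preceq e$, where $e=\mathrm{extent}(x[0..t))$, or if the first bit of $x$ that differs from $e$ is $0$; otherwise it is $\mathrm{right}(x[0..t))$. $\mathrm{FBS}^-(x,a,b)$ is the following fat binary search: while $b-a>1$, let $g$ be the number strictly between $a$ and $b$ divisible by the largest power of two and $e=T(x[0..g))$; if $g\le|e|$ and $e$ is a proper prefix of $x$ set $a\leftarrow|e|$,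 else set $b\leftarrow g$; at the end, return $\mathrm{pred}(x,t)$, where $t=0$ if $a=0$ and the extent of the root is not empty, and $t=a+1$ otherwise. **Algorithm.** On input $x$, for $i=0,1,2,\dots$, while $2^{2^i}\le w/2$: let $p=x[0..w-2^{2^i})$, and let $p\pm1$ be the strings of the same length following and preceding $p$ ($\bot$ if they do not exist). If $t=\hat f(p)\ne\bot$, let $e=\mathrm{extent}(x[0..t))$, and return $\mathrm{FBS}^-(x,|e|,w)$ if $e$ is a proper prefix of $x$, $\mathrm{pred}(x,t)$ otherwise. Else, if $t=\hat f(p+1)\neq\bot$, return $\mathrm{left}((p+1)[0..t))-1$. Else, if $t=\hat f(p-1)\neq\bot$, return $\mathrm{right}((p-1)[0..t))$. If the loop ends without returning, return $\mathrm{FBS}^-(x,0,w)$. **Theorem.** For all $w\geq1$, all nonempty $S$ and all $x$, whatever the values of the static functions outside of their domains, the algorithm returns the index $j$ such that $S[j]=x^-$ (or $-1$, i.e. the word whose bits are all ones, if $x^-$ does not exist) in time $O(\log\log d(x,S))$; the index requires $O(n\log w)$ bits in addition to the space needed to store $S$. The constant in the time bound is absolute, and the one in the space bound depends only on the cost $cm+o(m)$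 of static functions. -/

import Mathlib

namespace ZFast

/-! ### Binary strings of length at most `w`

A full string (length `w`) is a `BitVec w`, whose most significant bit is the first character; thus
`<` and `≤` on `BitVec w` (comparison of unsigned values) are the lexicographic order. A string of
length `len ≤ w` is kept left-aligned in a word, followed by zeros. -/

/-- A binary string of length `len ≤ w`, left-aligned in a word and padded with zeros. -/
structure Str (w : ℕ) where
  bits : BitVec w
  len : ℕ
deriving DecidableEq

section Tries

variable {w : ℕ}

/-- The prefix `x[0..l)` of the full string `x` (for `l ≤ w`). -/
def pre (x : BitVec w) (l : ℕ) : Str w := ⟨(x >>> (w - l)) <<< (w - l), l⟩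

/-- The prefix `p[0..l)` of a string `p` (for `l ≤ p.len`). -/
def Str.take (p : Str w) (l : ℕ) : Str w := pre p.bits l

/-- The prefix order `p ⪯ q`. -/
def Str.IsPrefix (p q : Str w) : Prop := p.len ≤ q.len ∧ q.take p.len = p

instance (p q : Str w) : Decidable (p.IsPrefix q) :=
  inferInstanceAs (Decidable (_ ∧ _))

/-- The set of all prefixes of elements of `S`. -/
def prefixes (S : Finset (BitVec w)) : Finset (Str w) :=
  S.biUnion fun s => (Finset.range (w + 1)).image (pre s)

/-- The elements of `S` that have `p` as a prefix. -/
def below (S : Finset (BitVec w)) (p : Str w) : Finset (BitVec w) :=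
  S.filter fun s => p.IsPrefix (pre s w)

/-- The length of the longest common prefix of the full strings in `A` (for `A` nonempty). -/
def lcpLen (A : Finset (BitVec w)) : ℕ :=
  ((Finset.range (w + 1)).filter fun l => ∀ s ∈ A, ∀ t ∈ A, pre s l = pre t l).sup id

/-- The nodes of the compacted trie of `S`, each one identified with its extent: they are the
strings `e` that are the longest common prefix of the elements of `S` prefixed by `e`. -/
def nodes (S : Finset (BitVec w)) : Finset (Str w) :=
  (prefixes S).filter fun e => lcpLen (below S e) = e.len

/-- The internal nodes: those with at least two leaves below them. -/
def internalNodes (S : Finset (BitVec w)) : Finset (Str w) :=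
  (nodes S).filter fun e => 2 ≤ (below S e).card

/-- The length of the name of the node with extent `e`; the name is the shortest prefix of `e` with
the same leaves below it, i.e., the empty string for the root, and otherwise the extent of the
parent followed by one more character. -/
noncomputable def nameLen (S : Finset (BitVec w)) (e : Str w) : ℕ :=
  sInf {j | below S (e.take j) = below S e}

/-- The name of the node with extent `e`. -/
noncomputable def name (S : Finset (BitVec w)) (e : Str w) : Str w := e.take (nameLen S e)

/-- `e` is the extent of the exit node of the string `p`: the name is a prefix of `p`, and the
extent either is `p` or is not a prefix of `p`. -/
def IsExit (S : Finset (BitVec w)) (p e : Str w) : Prop :=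
  e ∈ nodes S ∧ (name S e).IsPrefix p ∧ (e = p ∨ ¬ e.IsPrefix p)

/-- The length of the name of the exit node of `p` (the exit node is unique). -/
noncomputable def exitNameLen (S : Finset (BitVec w)) (p : Str w) : ℕ :=
  sInf {t | ∃ e, IsExit S p e ∧ t = nameLen S e}

/-- The 2-fattest number of the interval `(a..b]`: its unique element divisible by the largest
power of two (and `0` if the interval is empty). -/
noncomputable def fattest (a b : ℕ) : ℕ :=
  ((Finset.Ioc a b).filter fun f =>
    ∀ g ∈ Finset.Ioc a b, padicValNat 2 g ≤ padicValNat 2 f).sup id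

/-- The handle of a node: the prefix of the extent `e` whose length is the 2-fattest number of the
skip interval, which is `[1..|e|]` for the root, and `[|name|..|e|]` for the other nodes. -/
noncomputable def handle (S : Finset (BitVec w)) (e : Str w) : Str w :=
  e.take (fattest (nameLen S e - 1) e.len)

/-- The number of elements of `A` smaller than `k`. -/
def rankIn (A : Finset (BitVec w)) (k : BitVec w) : ℕ := (A.filter fun s => s < k).card

end Tries

/-! ### The index -/

/-- The static functions that form the index. -/
inductive Tab
  /-- handle of an internal node `↦` length of its name -/
  | handle
  /-- first part of the range locator: marker `↦` length of the common prefix of its bucket -/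
  | bucketLen
  /-- second part of the range locator: common prefix of a bucket `↦` rank of its first marker -/
  | bucketBase
  /-- third part of the range locator: marker `↦` rank relative to the base of its bucket -/
  | bucketOffset
  /-- `q ∈ Q ↦` length of the name of the exit node of `q` -/
  | exitName
  /-- `p ∈ P ↦` smallest `i` such that `p[0..w-2^(2^i))` is in `Q` -/
  | level

/-- A static function with values of `width` bits, defined on the finite set `dom` of keys. -/
structure StaticFun (w : ℕ) where
  dom : Finset (Str w)
  val : Str w → ℕ
  width : ℕ

/-- All values can be stored using `width` bits. -/
def StaticFun.Fits {w : ℕ} (F : StaticFun w) : Prop := ∀ k ∈ F.dom, F.val k < 2 ^ F.width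

/-- The number of bits of the data structure storing an `r`-bit function on `m` keys, which is
`r * m + c * m + o(m)`; the last summand is `e m`. -/
noncomputable def StaticFun.bits {w : ℕ} (c : ℝ) (e : ℕ → ℝ) (F : StaticFun w) : ℝ :=
  F.width * F.dom.card + c * F.dom.card + e F.dom.card

section Index

variable {w : ℕ}

/-- The markers of the range locator: for every node name `p`, the least full string prefixed by
`p`, and the least full string larger than all full strings prefixed by `p`, if any. -/
noncomputable def markers (S : Finset (BitVec w)) : Finset (BitVec w) :=
  (nodes S).image (fun e => (name S e).bits) ∪
    ((nodes S).image fun e =>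
      (name S e).bits + ((1#w) <<< (w - (name S e).len))).filter fun k => k ≠ 0#w

/-- The bucket of the marker `k`: the markers, in increasing order, are divided into
consecutive buckets of `Nat.size S.card` elements each (the last one may be smaller). -/
noncomputable def bucket (S : Finset (BitVec w)) (k : BitVec w) : Finset (BitVec w) :=
  (markers S).filter fun k' =>
    rankIn (markers S) k' / Nat.size S.card = rankIn (markers S) k / Nat.size S.card

/-- The longest common prefix of the bucket of `k`. -/
noncomputable def bucketPrefix (S : Finset (BitVec w)) (k : BitVec w) : Str w :=
  pre k (lcpLen (bucket S k))

/-- The rank in `S` of the first marker of the bucket whose longest common prefix is `p`. -/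
noncomputable def bucketRank (S : Finset (BitVec w)) (p : Str w) : ℕ :=
  sInf {r | ∃ k ∈ markers S, bucketPrefix S k = p ∧ r = rankIn S k}

/-- The indices `i` such that prefixes of length `w - 2^(2^i)` are used: `2^(2^i) ≤ w / 2`. -/
def levels (w : ℕ) : Finset ℕ := (Finset.range w).filter fun i => 2 * 2 ^ (2 ^ i) ≤ w

/-- The set `P` of the prefixes of length `w - 2^(2^i)` of the elements of `S`. -/
def setP (S : Finset (BitVec w)) : Finset (Str w) :=
  S.biUnion fun s => (levels w).image fun i => pre s (w - 2 ^ (2 ^ i))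

/-- The set `Q`: for every node, the shortest string in `P` (if any) between the name and the extent
of the node. -/
noncomputable def setQ (S : Finset (BitVec w)) : Finset (Str w) :=
  (setP S).filter fun q => ∃ e ∈ nodes S, (name S e).IsPrefix q ∧ q.IsPrefix e ∧
    ∀ p ∈ setP S, (name S e).IsPrefix p → p.IsPrefix e → q.IsPrefix p

/-- The index for `S`. -/
noncomputable def index (S : Finset (BitVec w)) : Tab → StaticFun w
  | .handle =>
    { dom := (internalNodes S).image (handle S)
      val := fun h => sInf {t | ∃ e ∈ internalNodes S, handle S e = h ∧ t = nameLen S e}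
      width := Nat.size w }
  | .bucketLen =>
    { dom := (markers S).image fun k => pre k w
      val := fun p => lcpLen (bucket S p.bits)
      width := Nat.size w }
  | .bucketBase =>
    { dom := (markers S).image (bucketPrefix S)
      val := bucketRank S
      width := Nat.size S.card }
  | .bucketOffset =>
    { dom := (markers S).image fun k => pre k w
      val := fun p => rankIn S p.bits - bucketRank S (bucketPrefix S p.bits)
      width := Nat.size (Nat.size S.card) }
  | .exitName =>
    { dom := setQ S
      val := exitNameLen S
      width := Nat.size w }
  | .level =>
    { dom := setP S
      val := fun p => sInf {i | i ∈ levels w ∧ w - 2 ^ (2 ^ i) ≤ p.len ∧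
        p.take (w - 2 ^ (2 ^ i)) ∈ setQ S}
      width := Nat.size (levels w).card }

/-- The size of the index in bits. -/
noncomputable def indexBits (c : ℝ) (e : ℕ → ℝ) (S : Finset (BitVec w)) : ℝ :=
  (index S .handle).bits c e + (index S .bucketLen).bits c e + (index S .bucketBase).bits c e +
    (index S .bucketOffset).bits c e + (index S .exitName).bits c e + (index S .level).bits c e

end Index

/-! ### The machine

Programs for a RAM with words of `w` bits. A program is written for an abstract type `V` of words
(it does not depend on `w` or on `S`), so that it can operate on words only through the instructions
of the machine; each instruction takes one unit of time. -/

/-- Binary word operations (modulo `2 ^ w`). -/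
inductive Op
  | add | sub | mul | and | or | xor | shl | shr

/-- Word comparisons (unsigned). -/
inductive Cmp
  | eq | lt | le

/-- Programs operating on words of type `V` and returning a result of type `α`. -/
inductive Code (V : Type) : Type → Type 1
  /-- return `a` -/
  | ret {α : Type} (a : α) : Code V α
  /-- sequential composition -/
  | seq {α β : Type} (c : Code V α) (k : α → Code V β) : Code V β
  /-- load a literal -/
  | lit (k : ℕ) : Code V V
  /-- the number of bits of a word -/
  | width : Code V V
  /-- the index of the last element of the array -/
  | last : Code V V
  /-- a binary operation -/
  | op (o : Op) (a b : V) : Code V V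
  /-- bitwise complement -/
  | not (a : V) : Code V V
  /-- the index of the most significant bit that is set -/
  | msb (a : V) : Code V V
  /-- a comparison -/
  | test (o : Cmp) (a b : V) : Code V Bool
  /-- read the `i`-th element of the array (fails if it does not exist) -/
  | read (i : V) : Code V V
  /-- evaluate a static function of the index on the string `p.1[0..p.2)` -/
  | look (f : Tab) (p : V × V) : Code V V
  /-- iterate `body` from the state `s` while it yields a new state (`Sum.inl`), until it yields
  a result (`Sum.inr`) -/
  | loop {σ α : Type} (body : σ → Code V (σ ⊕ α)) (s : σ) : Code V α

instance (V : Type) : Monad (Code V) where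
  pure := Code.ret
  bind := Code.seq

/-- What a program can access: the array, and the static functions of the index, each one given
by its answers on all strings. -/
structure Env (w : ℕ) where
  array : List (BitVec w)
  answer : Tab → Str w → ℕ

/-- The result of a binary operation. -/
def Op.eval {w : ℕ} : Op → BitVec w → BitVec w → BitVec w
  | .add, a, b => a + b
  | .sub, a, b => a - b
  | .mul, a, b => a * b
  | .and, a, b => a &&& b
  | .or, a, b => a ||| b
  | .xor, a, b => a ^^^ b
  | .shl, a, b => a <<< b.toNat
  | .shr, a, b => a >>> b.toNat

/-- The result of a comparison. -/
def Cmp.eval {w : ℕ} : Cmp → BitVec w → BitVec w → Bool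
  | .eq, a, b => decide (a = b)
  | .lt, a, b => decide (a < b)
  | .le, a, b => decide (a ≤ b)

/-- Spend one unit of the remaining time `t`, obtaining `r`. -/
def tick {α : Type} (r : Option α) : ℕ → Option (α × ℕ)
  | 0 => none
  | t + 1 => r.map fun a => (a, t)

/-- Execution of a loop, spending one unit of time, in addition to the time spent by the body, at
each iteration (so that a fuel equal to the available time is never exhausted earlier). -/
def iter {σ α : Type} (body : σ → ℕ → Option ((σ ⊕ α) × ℕ)) : ℕ → σ → ℕ → Option (α × ℕ)
  | 0, _, _ => none
  | _ + 1, _, 0 => none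
  | fuel + 1, s, t + 1 =>
    match body s t with
    | none => none
    | some (.inl s', t') => iter body fuel s' t'
    | some (.inr a, t') => some (a, t')

/-- Execution of a program when `t` units of time are available: the result and the time left,
or `none` if the program needs more time, or fails. -/
def run {w : ℕ} (E : Env w) {α : Type} : Code (BitVec w) α → ℕ → Option (α × ℕ)
  | .ret a, t => some (a, t)
  | .seq c k, t => (run E c t).bind fun r => run E (k r.1) r.2
  | .lit k, t => tick (some (BitVec.ofNat w k)) t
  | .width, t => tick (some (BitVec.ofNat w w)) t
  | .last, t => tick (some (BitVec.ofNat w (E.array.length - 1))) t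
  | .op o a b, t => tick (some (o.eval a b)) t
  | .not a, t => tick (some (~~~a)) t
  | .msb a, t => tick (some (BitVec.ofNat w (Nat.log 2 a.toNat))) t
  | .test o a b, t => tick (some (o.eval a b)) t
  | .read i, t => tick E.array[i.toNat]? t
  | .look f p, t => tick (some (BitVec.ofNat w (E.answer f ⟨p.1, p.2.toNat⟩))) t
  | .loop body s, t => iter (fun s' => run E (body s')) t s t

/-- The program `c` returns `a` within `t` units of time. -/
def ReturnsWithin {w : ℕ} (E : Env w) {α : Type} (c : Code (BitVec w) α) (a : α) (t : ℕ) : Prop :=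
  ∃ rest, run E c t = some (a, rest)

/-! ### The algorithm

Strings of length at most `w` are pairs of words: a left-aligned string and its length. -/

section Algorithm

variable {V : Type}

open Code

/-- The string `x[0..l)`. -/
def cut (x l : V) : Code V (V × V) := do
  let d ← op .sub (← width) l
  let y ← op .shl (← op .shr x d) d
  return (y, l)

/-- Whether `p ⪯ q`. -/
def isPrefix (p q : V × V) : Code V Bool := do
  if ← test .le p.2 q.2 then
    let r ← cut q.1 p.2
    test .eq r.1 p.1
  else
    return false

/-- Whether `p ≺ q`. -/
def isProperPrefix (p q : V × V) : Code V Bool := do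
  if ← test .lt p.2 q.2 then
    isPrefix p q
  else
    return false

/-- The longest common prefix of two full strings. -/
def lcp (x y : V) : Code V (V × V) := do
  if ← test .eq x y then
    return (x, ← width)
  else
    let m ← msb (← op .xor x y)
    let l ← op .sub (← op .sub (← width) (← lit 1)) m
    cut x l

/-- The rank of a marker in `S`. -/
def markerRank (k : V) : Code V V := do
  let l ← look .bucketLen (k, ← width)
  let base ← look .bucketBase (← cut k l)
  let offset ← look .bucketOffset (k, ← width)
  op .add base offset

/-- An index, forced to be in the range of the array. -/
def clamp (i : V) : Code V V := do
  let m ← last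
  if ← test .le i m then
    return i
  else
    return m

/-- Range locator: the smallest index of an element of `S` prefixed by the node name `p`. -/
def left (p : V × V) : Code V V := do
  clamp (← markerRank p.1)

/-- Range locator: the largest index of an element of `S` prefixed by the node name `p`. -/
def right (p : V × V) : Code V V := do
  let k ← op .add p.1 (← op .shl (← lit 1) (← op .sub (← width) p.2))
  if ← test .eq k (← lit 0) then
    last
  else
    clamp (← op .sub (← markerRank k) (← lit 1))

/-- The extent of the node of name `p`. -/
def extent (p : V × V) : Code V (V × V) := do
  lcp (← read (← left p)) (← read (← right p))

/-- The extent of the root. -/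
def rootExtent : Code V (V × V) := do
  lcp (← read (← lit 0)) (← read (← last))

/-- The function `T` of the z-fast trie. -/
def zfast (h : V × V) : Code V (V × V) := do
  let p ← cut h.1 (← look .handle h)
  let i ← left p
  let j ← right p
  if ← test .eq i j then
    rootExtent
  else
    lcp (← read i) (← read j)

/-- The 2-fattest number in the open interval `(a..b)`. -/
def fattestBetween (a b : V) : Code V V := do
  let r ← op .sub b (← lit 1)
  let m ← msb (← op .xor a r)
  op .and (← op .shl (← not (← lit 0)) m) r

/-- Fat binary search: the length of the name of the exit node of `x`. -/
def fatBinarySearch (x a b : V) : Code V V := do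
  let a' ← loop (fun s : V × V => do
    let a := s.1
    let b := s.2
    if ← test .lt (← lit 1) (← op .sub b a) then
      let f ← fattestBetween a b
      let e ← zfast (← cut x f)
      if (← test .le f e.2) && (← isProperPrefix e (x, ← width)) then
        return Sum.inl (e.2, b)
      else
        return Sum.inl (a, f)
    else
      return Sum.inr a) (a, b)
  let zero ← lit 0
  let root ← rootExtent
  if (← test .eq a' zero) && !(← test .eq root.2 zero) then
    return zero
  else
    op .add a' (← lit 1)

/-- The index of the predecessor of `x`, given the length `t` of the name of its exit node. -/
def pred (x t : V) : Code V V := do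
  let p ← cut x t
  let e ← extent p
  if ← isPrefix (x, ← width) e then
    op .sub (← left p) (← lit 1)
  else
    let m ← msb (← op .xor x e.1)
    let bit ← op .and (← op .shr x m) (← lit 1)
    if ← test .eq bit (← lit 0) then
      op .sub (← left p) (← lit 1)
    else
      right p

/-- Predecessor search by means of a fat binary search. -/
def fbsPred (x a b : V) : Code V V := do
  pred x (← fatBinarySearch x a b)

/-- `2^(2^i)` -/
def tower (i : V) : Code V V := do
  let one ← lit 1
  op .shl one (← op .shl one i)

/-- The function `f`, on the strings in `P`. -/
def exitName (p : V × V) : Code V V := do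
  let i ← look .level p
  let q ← cut p.1 (← op .sub (← width) (← tower i))
  look .exitName q

/-- The patched function `f̂`; `none` stands for `⊥`. -/
def exitNamePatched (p : V × V) : Code V (Option V) := do
  let t ← exitName p
  if ← test .le t p.2 then
    if ← isPrefix p (← extent (← cut p.1 t)) then
      return some t
    else
      return none
  else
    return none

/-- `p + 1`, the string of the same length that follows `p` (`none` if there is none). -/
def nextStr (p : V × V) : Code V (Option (V × V)) := do
  let k ← op .add p.1 (← op .shl (← lit 1) (← op .sub (← width) p.2))
  if ← test .eq k (← lit 0) then
    return none
  else
    return some (k, p.2)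

/-- `p - 1`, the string of the same length that precedes `p` (`none` if there is none). -/
def prevStr (p : V × V) : Code V (Option (V × V)) := do
  if ← test .eq p.1 (← lit 0) then
    return none
  else
    let k ← op .sub p.1 (← op .shl (← lit 1) (← op .sub (← width) p.2))
    return some (k, p.2)

/-- `f̂` extended to `⊥`, on which it is undefined, too. -/
def probe : Option (V × V) → Code V (Option V)
  | none => return none
  | some p => exitNamePatched p

/-- The short-distance predecessor algorithm: the index of the predecessor of `x`. The guard
`2^(2^i) ≤ w / 2` of the loop is evaluated as `2^i < ⌊log w⌋`. -/
def shortDistancePred (x : V) : Code V V := do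
  loop (fun i : V => do
    if ← test .lt (← op .shl (← lit 1) i) (← msb (← width)) then
      let p ← cut x (← op .sub (← width) (← tower i))
      match ← exitNamePatched p with
      | some t =>
        let e ← extent (← cut x t)
        if ← isProperPrefix e (x, ← width) then
          return Sum.inr (← fbsPred x e.2 (← width))
        else
          return Sum.inr (← pred x t)
      | none =>
        let p' ← nextStr p
        match p', ← probe p' with
        | some q, some t =>
          return Sum.inr (← op .sub (← left (← cut q.1 t)) (← lit 1))
        | _, _ =>
          let p'' ← prevStr p
          match p'', ← probe p'' with
          | some q, some t =>
            return Sum.inr (← right (← cut q.1 t))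
          | _, _ =>
            return Sum.inl (← op .add i (← lit 1))
    else
      return Sum.inr (← fbsPred x (← lit 0) (← width))) (← lit 0)

end Algorithm

/-! ### Predecessors and distance -/

section Distance

variable {w : ℕ}

/-- `y` is the predecessor `x⁻` of `x` in `S`. -/
def IsPred (S : Finset (BitVec w)) (x y : BitVec w) : Prop := IsGreatest {z | z ∈ S ∧ z < x} y

/-- `y` is the successor `x⁺` of `x` in `S`. -/
def IsSucc (S : Finset (BitVec w)) (x y : BitVec w) : Prop := IsLeast {z | z ∈ S ∧ x ≤ z} y

/-- The short distance `d(x, S) = min {x⁺ - x, x - x⁻}` (if only one of `x⁺` and `x⁻` exists, the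
distance from that one). -/
noncomputable def shortDist (S : Finset (BitVec w)) (x : BitVec w) : ℕ :=
  sInf {k | (∃ y, IsPred S x y ∧ k = x.toNat - y.toNat) ∨
    (∃ y, IsSucc S x y ∧ k = y.toNat - x.toNat)}

/-- The elements of `S` in increasing order. -/
def sortedArray (S : Finset (BitVec w)) : List (BitVec w) := S.sort (fun a b => a ≤ b)

/-- `r` is the index of the predecessor of `x` in the sorted array of the elements of `S`, or `-1`
(the word whose bits are all ones) if `x` has no predecessor. -/
def IsPredIndex (S : Finset (BitVec w)) (x r : BitVec w) : Prop :=
  (∃ y, IsPred S x y ∧ (sortedArray S)[r.toNat]? = some y) ∨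
    ((¬ ∃ y, IsPred S x y) ∧ r = -1#w)

end Distance

/-- Binary logarithm, set to `1` for arguments smaller than `2`. -/
noncomputable def lg (y : ℝ) : ℝ := if y < 2 then 1 else Real.logb 2 y

/-- `E` gives access to the sorted array of the elements of `S`, and to the index for `S`; the
answers of an `r`-bit static function outside of its domain are arbitrary `r`-bit values. -/
def Env.IsFor {w : ℕ} (E : Env w) (S : Finset (BitVec w)) : Prop :=
  E.array = sortedArray S ∧
    ∀ f : Tab, (∀ k ∈ (index S f).dom, E.answer f k = (index S f).val k) ∧
      ∀ k, E.answer f k < 2 ^ (index S f).width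

end ZFast

/-!
# Predecessor search in time `O(log log d)` with a z-fast trie

For full strings `x` and `y` let `common x y` be the length of their longest common prefix. It is an
ultrametric compatible with the lexicographic order, and characters being binary, two strings that
leave a third one at the same position agree beyond it (`lt_common_of_eq`). The compacted trie of
`S` is described in these terms only: `Skip S s a l` says that `[a..l]` goes from the length of the
name to the length of the extent of a node on the path to the leaf `s`, that is, that no element of
`S` leaves `s` at a position in `[a..l)`, while some leave it at `l` and at `a - 1`, unless these are
the ends of the path. The ranges of the nodes on a path partition `[0..w]`.

*Queries.* The ranks of the two markers of a name give the least and the largest leaf below its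
node, whose longest common prefix is the extent (`Skip.common_first_last`). Once the exit node of
`x` is known, the bit at which `x` leaves its extent tells whether the predecessor precedes all the
leaves below the node or is the largest of them (`Skip.rankIn_eq_of_lt`, `Skip.rankIn_eq_of_gt`).

*Junk answers.* Out of their domains the static functions can return anything, but indices are
clamped to the array, so that every string returned by `T` or `extent` is the longest common prefix
of two elements of `S`, hence the extent of a node. Therefore, the test made by the fat binary search
can succeed only on a true ancestor, and it does succeed if there is an ancestor of length at least
`g` to be found, since then `x[0..g)` is a handle (`spec_zfast_pre`). Similarly, the patched function
accepts only prefixes of elements of `S` (`spec_exitNamePatched`), on which it is correct because the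
shortest element of `P` in a skip interval is in `Q` (`Skip.level_val`).

*Time.* The candidate `g` in `(a..b)` is the multiple of `2 ^ m` determined by the most significant
bit `m` at which `a` and `b - 1` differ. This bit decreases at each iteration and, after the first
iteration, it is bounded by `log (b - a)` (`IsSplit.potential`), so that a search in an interval of
length `2 ^ (2 ^ i)` takes `O(2 ^ i)` steps. If the iteration `i` of the algorithm fails, then no
element of `S` agrees with `x`, or with one of its neighbours, up to the last `2 ^ (2 ^ i)` bits;
thus `d` is at least `2 ^ (2 ^ (2 ^ i))` (`IsFar.two_pow_le_shortDist`), and `2 ^ i ≤ log log d`.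

*Space.* There are at most `2 n` nodes and `4 n` markers. Distinct buckets have distinct longest
common prefixes, and there are at least as many markers as elements of `S` between two markers, so
the relative ranks in a bucket of `O(log n)` markers take `O(log log n) = O(log w)` bits
(`rankIn_sub_bucketRank_lt`). The number of levels is `O(log log w)`, and even its square, which
bounds the bits used per element of `S` by the map to levels, is `O(log w)` (`card_levels_sq_le`).
-/

namespace ZFast

/-! ### Common prefixes of full strings -/

section Strings

variable {w : ℕ}

/-- The length of the longest common prefix of two full strings. -/
def common (x y : BitVec w) : ℕ := w - Nat.size (x ^^^ y).toNat

theorem pre_bits_toNat (x : BitVec w) (l : ℕ) :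
    (pre x l).bits.toNat = x.toNat / 2 ^ (w - l) * 2 ^ (w - l) := by
  simp only [pre, BitVec.toNat_shiftLeft, BitVec.toNat_ushiftRight, Nat.shiftLeft_eq,
    Nat.shiftRight_eq_div_pow]
  exact Nat.mod_eq_of_lt ((Nat.div_mul_le_self _ _).trans_lt x.isLt)

@[simp] theorem pre_len (x : BitVec w) (l : ℕ) : (pre x l).len = l := rfl

theorem pre_eq_pre_iff_div (x y : BitVec w) (l : ℕ) :
    pre x l = pre y l ↔ x.toNat / 2 ^ (w - l) = y.toNat / 2 ^ (w - l) := by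
  have h : pre x l = pre y l ↔ (pre x l).bits.toNat = (pre y l).bits.toNat := by
    rw [BitVec.toNat_inj]
    exact ⟨fun h => by rw [h], fun h => by
      have : pre x l = ⟨(pre x l).bits, l⟩ := rfl
      rw [this, h]; rfl⟩
  rw [h, pre_bits_toNat, pre_bits_toNat]
  exact Nat.mul_left_inj (by positivity)

theorem le_common_iff_div (x y : BitVec w) {l : ℕ} (hl : l ≤ w) :
    l ≤ common x y ↔ x.toNat / 2 ^ (w - l) = y.toNat / 2 ^ (w - l) := by
  have h : Nat.size (x ^^^ y).toNat ≤ w - l ↔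
      x.toNat / 2 ^ (w - l) = y.toNat / 2 ^ (w - l) := by
    rw [Nat.size_le, BitVec.toNat_xor, ← Nat.shiftRight_eq_div_pow, ← Nat.shiftRight_eq_div_pow,
      ← Nat.xor_eq_zero_iff, ← Nat.shiftRight_xor_distrib, Nat.shiftRight_eq_div_pow,
      Nat.div_eq_zero_iff]
    simp
  have hw : Nat.size (x ^^^ y).toNat ≤ w := Nat.size_le.2 (x ^^^ y).isLt
  rw [← h, common]
  omega

theorem pre_eq_pre_iff (x y : BitVec w) {l : ℕ} (hl : l ≤ w) :
    pre x l = pre y l ↔ l ≤ common x y := by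
  rw [pre_eq_pre_iff_div, le_common_iff_div x y hl]

theorem common_le (x y : BitVec w) : common x y ≤ w := Nat.sub_le _ _

theorem common_comm (x y : BitVec w) : common x y = common y x := by
  rw [common, common, BitVec.xor_comm]

@[simp] theorem common_self (x : BitVec w) : common x x = w := by simp [common]

theorem le_common_iff_eq (x y : BitVec w) : w ≤ common x y ↔ x = y := by
  rw [le_common_iff_div x y le_rfl]
  simp [BitVec.toNat_inj]

theorem common_lt_iff_ne (x y : BitVec w) : common x y < w ↔ x ≠ y := by
  rw [← not_le, le_common_iff_eq]

theorem min_common_le (x y z : BitVec w) : min (common x y) (common y z) ≤ common x z := by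
  have hl : min (common x y) (common y z) ≤ w := (min_le_left _ _).trans (common_le _ _)
  rw [le_common_iff_div x z hl, (le_common_iff_div x y hl).1 (min_le_left _ _),
    (le_common_iff_div y z hl).1 (min_le_right _ _)]

theorem le_common_trans {x y z : BitVec w} {l : ℕ} (h₁ : l ≤ common x y) (h₂ : l ≤ common y z) :
    l ≤ common x z :=
  (le_min h₁ h₂).trans (min_common_le x y z)

theorem common_eq_of_lt {x y z : BitVec w} (h : common x y < common y z) :
    common x z = common x y := by
  have h₁ := min_common_le x y z
  have h₂ := min_common_le x z y
  rw [common_comm z y] at h₂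
  rcases min_cases (common x y) (common y z) with h | h <;>
  rcases min_cases (common x z) (common y z) with h' | h' <;> omega

theorem common_anti_of_le {x y z : BitVec w} (h₁ : x ≤ y) (h₂ : y ≤ z) :
    common x z ≤ common x y := by
  have hl := common_le x z
  rw [le_common_iff_div x y hl]
  have h := (le_common_iff_div x z hl).1 le_rfl
  have a := Nat.div_le_div_right (c := 2 ^ (w - common x z)) (BitVec.le_def.1 h₁)
  have b := Nat.div_le_div_right (c := 2 ^ (w - common x z)) (BitVec.le_def.1 h₂)
  omega

theorem common_anti_of_le' {x y z : BitVec w} (h₁ : x ≤ y) (h₂ : y ≤ z) :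
    common x z ≤ common y z :=
  le_common_trans (y := x) ((common_anti_of_le h₁ h₂).trans (common_comm x y).le) le_rfl

theorem div_two_pow_succ_sub (n : ℕ) {l : ℕ} (hl : l < w) :
    n / 2 ^ (w - l) = n / 2 ^ (w - (l + 1)) / 2 := by
  rw [Nat.div_div_eq_div_mul, ← pow_succ]
  congr 2
  omega

/-- Characters are binary: two strings leaving a third one at the same position continue alike. -/
theorem lt_common_of_eq {x y z : BitVec w} {l : ℕ} (hl : l < w) (h₁ : common x y = l)
    (h₂ : common y z = l) : l < common x z := by
  have a := (le_common_iff_div x y hl.le).1 h₁.ge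
  have b := (le_common_iff_div y z hl.le).1 h₂.ge
  have a' := mt (le_common_iff_div x y (l := l + 1) hl).2 (by omega)
  have b' := mt (le_common_iff_div y z (l := l + 1) hl).2 (by omega)
  refine (le_common_iff_div x z (l := l + 1) hl).2 ?_
  rw [div_two_pow_succ_sub _ hl, div_two_pow_succ_sub _ hl] at a b
  omega

theorem pre_bits_le (x : BitVec w) (l : ℕ) : (pre x l).bits ≤ x := by
  rw [BitVec.le_def, pre_bits_toNat]
  exact Nat.div_mul_le_self _ _

theorem le_common_pre_bits (x : BitVec w) {l : ℕ} (hl : l ≤ w) :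
    l ≤ common (pre x l).bits x := by
  rw [le_common_iff_div _ _ hl, pre_bits_toNat]
  exact Nat.mul_div_cancel _ (by positivity)

theorem pre_pre_bits (x : BitVec w) {l m : ℕ} (hm : m ≤ l) (hl : l ≤ w) :
    pre (pre x l).bits m = pre x m :=
  (pre_eq_pre_iff _ _ (hm.trans hl)).2 (hm.trans (le_common_pre_bits x hl))

theorem pre_take (x : BitVec w) {l m : ℕ} (hm : m ≤ l) (hl : l ≤ w) :
    (pre x l).take m = pre x m :=
  pre_pre_bits x hm hl

theorem pre_width (x : BitVec w) : pre x w = ⟨x, w⟩ := by simp [pre]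

theorem pre_isPrefix_pre (x y : BitVec w) {l m : ℕ} (hm : m ≤ w) :
    (pre x l).IsPrefix (pre y m) ↔ l ≤ m ∧ l ≤ common x y := by
  unfold Str.IsPrefix
  simp only [pre_len]
  refine and_congr_right fun h => ?_
  rw [pre_take y h hm, pre_eq_pre_iff y x (h.trans hm), common_comm]

theorem pre_bits_le_of_le_common {x y : BitVec w} {l : ℕ} (hl : l ≤ w) (h : l ≤ common x y) :
    (pre x l).bits ≤ y := by
  rw [(pre_eq_pre_iff x y hl).2 h]
  exact pre_bits_le y l

/-- All strings between `x[0..l)`, padded with zeros, and `x` have `x[0..l)` as a prefix. -/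
theorem le_common_of_pre_bits_le {x y : BitVec w} {l : ℕ} (hl : l ≤ w) (h₁ : (pre x l).bits ≤ y)
    (h₂ : y ≤ x) : l ≤ common x y := by
  have h := common_anti_of_le' h₁ h₂
  rw [common_comm y x] at h
  exact (le_common_pre_bits x hl).trans h

/-- The least full string larger than all those prefixed by `pre x l` (`0` if there is none). -/
def nextBits (x : BitVec w) (l : ℕ) : BitVec w := (pre x l).bits + (1#w <<< (w - l))

theorem toNat_one_shiftLeft (hw : 1 ≤ w) {l : ℕ} :
    (1#w <<< (w - l)).toNat = 2 ^ (w - l) % 2 ^ w := by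
  have : 1 < 2 ^ w := Nat.one_lt_two_pow (by omega)
  simp [BitVec.toNat_shiftLeft, Nat.shiftLeft_eq, Nat.mod_eq_of_lt this]

theorem nextBits_toNat_of_ne (hw : 1 ≤ w) (x : BitVec w) {l : ℕ} (h : nextBits x l ≠ 0#w) :
    (nextBits x l).toNat = (x.toNat / 2 ^ (w - l) + 1) * 2 ^ (w - l) := by
  have key : (nextBits x l).toNat = ((x.toNat / 2 ^ (w - l) + 1) * 2 ^ (w - l)) % 2 ^ w := by
    rw [nextBits, BitVec.toNat_add, toNat_one_shiftLeft hw, pre_bits_toNat]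
    simp [add_mul]
  have hne : (nextBits x l).toNat ≠ 0 := fun h' => h (BitVec.eq_of_toNat_eq (by simpa using h'))
  have hle : (x.toNat / 2 ^ (w - l) + 1) * 2 ^ (w - l) ≤ 2 ^ w := by
    have h2 : (2 : ℕ) ^ w = 2 ^ (w - (w - l)) * 2 ^ (w - l) := by
      rw [← pow_add]; congr 1; omega
    have : x.toNat / 2 ^ (w - l) < 2 ^ (w - (w - l)) := by
      rw [Nat.div_lt_iff_lt_mul (by positivity), ← h2]; exact x.isLt
    rw [h2]
    exact Nat.mul_le_mul_right _ this
  rcases hle.lt_or_eq with h' | h'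
  · rw [key, Nat.mod_eq_of_lt h']
  · rw [h', Nat.mod_self] at key
    exact absurd key hne

theorem nextBits_eq_zero (hw : 1 ≤ w) (x : BitVec w) {l : ℕ} (h : nextBits x l = 0#w) :
    2 ^ w ≤ (x.toNat / 2 ^ (w - l) + 1) * 2 ^ (w - l) := by
  have key : (nextBits x l).toNat = ((x.toNat / 2 ^ (w - l) + 1) * 2 ^ (w - l)) % 2 ^ w := by
    rw [nextBits, BitVec.toNat_add, toNat_one_shiftLeft hw, pre_bits_toNat]
    simp [add_mul]
  by_contra! hlt
  rw [h, Nat.mod_eq_of_lt hlt] at key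
  simp at key

theorem lt_nextBits_iff (hw : 1 ≤ w) {x y : BitVec w} {l : ℕ} (h : nextBits x l ≠ 0#w) :
    y < nextBits x l ↔ y.toNat / 2 ^ (w - l) ≤ x.toNat / 2 ^ (w - l) := by
  rw [BitVec.lt_def, nextBits_toNat_of_ne hw x h, ← Nat.div_lt_iff_lt_mul (by positivity),
    Nat.lt_succ_iff]

theorem div_le_of_nextBits_eq_zero (hw : 1 ≤ w) {x : BitVec w} (y : BitVec w) {l : ℕ}
    (h : nextBits x l = 0#w) : y.toNat / 2 ^ (w - l) ≤ x.toNat / 2 ^ (w - l) := by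
  rw [← Nat.lt_succ_iff, Nat.div_lt_iff_lt_mul (by positivity)]
  exact y.isLt.trans_le (nextBits_eq_zero hw x h)

theorem div_le_iff (x y : BitVec w) {l : ℕ} (hl : l ≤ w) :
    y.toNat / 2 ^ (w - l) ≤ x.toNat / 2 ^ (w - l) ↔ y ≤ x ∨ l ≤ common x y := by
  rw [le_common_iff_div x y hl]
  constructor
  · intro h
    rcases h.lt_or_eq with h | h
    · left
      rw [BitVec.le_def]
      by_contra! h'
      exact absurd (Nat.div_le_div_right (c := 2 ^ (w - l)) h'.le) (by omega)
    · exact Or.inr h.symm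
  · rintro (h | h)
    · exact Nat.div_le_div_right (BitVec.le_def.1 h)
    · exact h.ge

end Strings

/-! ### Skip intervals of the compacted trie -/

section Trie

variable {w : ℕ} {S : Finset (BitVec w)} {s t x : BitVec w} {a b j l : ℕ}

/-- `[a..l]` is the range from the length of the name to the length of the extent of a node of the
compacted trie of `S` that is an ancestor of the leaf `s` (or `s` itself). It is described in terms
of the lengths at which the elements of `S` leave `s`. -/
structure Skip (S : Finset (BitVec w)) (s : BitVec w) (a l : ℕ) : Prop where
  mem : s ∈ S
  name_le : a ≤ l
  le_width : l ≤ w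
  branch : l < w → ∃ t ∈ S, common s t = l
  gap : ∀ t ∈ S, a ≤ common s t → l ≤ common s t
  parent : a ≠ 0 → ∃ t ∈ S, common s t + 1 = a

theorem Skip.transfer (h : Skip S s a l) (ht : t ∈ S) (hst : a ≤ common s t) : Skip S t a l := by
  have hl := h.gap t ht hst
  have hl' : l ≤ common t s := by rwa [common_comm]
  refine ⟨ht, h.name_le, h.le_width, fun hw => ?_, fun u hu hau => ?_, fun ha => ?_⟩
  · obtain ⟨u, hu, hsu⟩ := h.branch hw
    rcases hl.lt_or_eq with h1 | h1
    · exact ⟨u, hu, by rw [common_comm t u, common_eq_of_lt (y := s)] <;>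
        rw [common_comm u s] <;> omega⟩
    · exact ⟨s, h.mem, by rw [common_comm]; exact h1.symm⟩
  · exact le_common_trans hl' (h.gap u hu (le_common_trans hst hau))
  · obtain ⟨u, hu, hsu⟩ := h.parent ha
    refine ⟨u, hu, ?_⟩
    rw [← hsu, common_comm t u, common_eq_of_lt (y := s)] <;> rw [common_comm u s]
    have := h.name_le
    omega

theorem exists_skip (hs : s ∈ S) (hj : j ≤ w) : ∃ a l, Skip S s a l ∧ a ≤ j ∧ j ≤ l := by
  classical
  have hl : ∃ l, j ≤ l ∧ ∃ t ∈ S, common s t = l := ⟨w, hj, s, hs, common_self s⟩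
  let L := Nat.find hl
  obtain ⟨hjL, u, hu, huL⟩ := Nat.find_spec hl
  have hmin : ∀ t ∈ S, j ≤ common s t → L ≤ common s t :=
    fun t ht h => Nat.find_min' hl ⟨h, t, ht, rfl⟩
  have hLw : L ≤ w := huL.symm.le.trans (common_le s u)
  let A := (S.filter fun t => common s t < j).sup fun t => common s t + 1
  have hAj : A ≤ j := Finset.sup_le fun t ht => (Finset.mem_filter.1 ht).2
  refine ⟨A, L, ⟨hs, hAj.trans hjL, hLw, fun _ => ⟨u, hu, huL⟩, fun t ht h => ?_, fun hA => ?_⟩,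
    hAj, hjL⟩
  · refine hmin t ht ?_
    by_contra! hlt
    have : common s t + 1 ≤ A :=
      Finset.le_sup (f := fun t => common s t + 1) (Finset.mem_filter.2 ⟨ht, hlt⟩)
    omega
  · have hne : (S.filter fun t => common s t < j).Nonempty := by
      rw [Finset.nonempty_iff_ne_empty]
      intro h
      exact hA (by simp only [A, h]; rfl)
    obtain ⟨t, ht, h⟩ := Finset.exists_mem_eq_sup _ hne fun t => common s t + 1
    exact ⟨t, (Finset.mem_filter.1 ht).1, h.symm⟩

/-- The ranges of two distinct nodes on the same path are disjoint. -/
theorem Skip.unique {a' l' : ℕ} (h : Skip S s a l) (h' : Skip S s a' l') (h₁ : a ≤ l')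
    (h₂ : a' ≤ l) : a = a' ∧ l = l' := by
  have key : ∀ {a l a' l' : ℕ}, Skip S s a l → Skip S s a' l' → a ≤ l' → a' ≤ l →
      a ≤ a' ∧ l ≤ l' := by
    intro a l a' l' h h' h₁ h₂
    constructor
    · by_contra! hlt
      obtain ⟨t, ht, e⟩ := h.parent (by omega)
      have := h'.gap t ht (by omega)
      omega
    · by_contra! hlt
      obtain ⟨t, ht, e⟩ := h'.branch (hlt.trans_le h.le_width)
      have := h.gap t ht (by omega)
      omega
  have h3 := key h h' h₁ h₂
  have h4 := key h' h h₂ h₁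
  omega

theorem Skip.branch_exists (h : Skip S s a l) : ∃ t ∈ S, common s t = l := by
  rcases h.le_width.lt_or_eq with hl | rfl
  · exact h.branch hl
  · exact ⟨s, h.mem, common_self s⟩

/-! ### Nodes, names and handles -/

theorem mem_below (hl : l ≤ w) : t ∈ below S (pre s l) ↔ t ∈ S ∧ l ≤ common s t := by
  rw [below, Finset.mem_filter, pre_isPrefix_pre _ _ le_rfl]
  exact ⟨fun h => ⟨h.1, h.2.2⟩, fun h => ⟨h.1, hl, h.2⟩⟩

theorem le_lcpLen_iff {A : Finset (BitVec w)} (hl : l ≤ w) :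
    l ≤ lcpLen A ↔ ∀ s ∈ A, ∀ t ∈ A, l ≤ common s t := by
  unfold lcpLen
  constructor
  · intro h s hs t ht
    obtain ⟨m, hm, e⟩ := Finset.exists_mem_eq_sup
      ((Finset.range (w + 1)).filter fun l => ∀ s ∈ A, ∀ t ∈ A, pre s l = pre t l)
      ⟨0, by simp [pre_eq_pre_iff _ _ (Nat.zero_le w)]⟩ id
    rw [e] at h
    rw [Finset.mem_filter, Finset.mem_range] at hm
    exact h.trans ((pre_eq_pre_iff s t (Nat.lt_succ_iff.1 hm.1)).1 (hm.2 s hs t ht))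
  · intro h
    refine Finset.le_sup (f := id) (Finset.mem_filter.2 ⟨Finset.mem_range.2 (by omega), ?_⟩)
    exact fun s hs t ht => (pre_eq_pre_iff s t hl).2 (h s hs t ht)

theorem lcpLen_le (A : Finset (BitVec w)) : lcpLen A ≤ w :=
  Finset.sup_le fun l hl => by
    have := Finset.mem_range.1 (Finset.mem_filter.1 hl).1
    exact Nat.lt_succ_iff.1 this

theorem exists_common_eq_lcpLen {A : Finset (BitVec w)} (hA : A.Nonempty) :
    ∃ s ∈ A, ∃ t ∈ A, common s t = lcpLen A := by
  rcases (lcpLen_le A).lt_or_eq with h | h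
  · by_contra! hne
    have := mt (le_lcpLen_iff (A := A) (l := lcpLen A + 1) h).2 (by omega)
    refine this fun s hs t ht => ?_
    exact Nat.lt_of_le_of_ne ((le_lcpLen_iff h.le).1 le_rfl s hs t ht) (hne s hs t ht).symm
  · obtain ⟨s, hs⟩ := hA
    exact ⟨s, hs, s, hs, by simp [h]⟩

theorem Skip.lcpLen_below (h : Skip S s a l) : lcpLen (below S (pre s l)) = l := by
  apply le_antisymm
  · obtain ⟨t, ht, e⟩ := h.branch_exists
    rw [← e]
    refine (le_lcpLen_iff (lcpLen_le _)).1 le_rfl s ?_ t ?_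
    · simpa [mem_below (common_le s t)] using ⟨h.mem, common_le s t⟩
    · simpa [mem_below (common_le s t)] using ht
  · rw [le_lcpLen_iff h.le_width]
    intro t ht u hu
    rw [mem_below h.le_width] at ht hu
    exact le_common_trans (by rw [common_comm]; exact ht.2) hu.2

theorem Skip.mem_nodes (h : Skip S s a l) : pre s l ∈ nodes S := by
  refine Finset.mem_filter.2 ⟨?_, h.lcpLen_below⟩
  refine Finset.mem_biUnion.2 ⟨s, h.mem, Finset.mem_image.2 ⟨l, ?_, rfl⟩⟩
  exact Finset.mem_range.2 (Nat.lt_succ_of_le h.le_width)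

theorem mem_nodes_iff {e : Str w} : e ∈ nodes S ↔ ∃ s a l, Skip S s a l ∧ e = pre s l := by
  constructor
  · intro he
    obtain ⟨he, hl⟩ := Finset.mem_filter.1 he
    obtain ⟨s, hs, he⟩ := Finset.mem_biUnion.1 he
    obtain ⟨l, hlw, rfl⟩ := Finset.mem_image.1 he
    have hlw : l ≤ w := Nat.lt_succ_iff.1 (Finset.mem_range.1 hlw)
    obtain ⟨a, l', h, ha, hl'⟩ := exists_skip hs hlw
    obtain rfl : l' = l := by
      have e : below S (pre s l) = below S (pre s l') := by
        ext t
        rw [mem_below hlw, mem_below h.le_width]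
        exact and_congr_right fun ht => ⟨fun h' => h.gap t ht (ha.trans h'), hl'.trans⟩
      rw [e, h.lcpLen_below] at hl
      exact hl
    exact ⟨s, a, l', h, rfl⟩
  · rintro ⟨s, a, l, h, rfl⟩
    exact h.mem_nodes

theorem Skip.nameLen_eq (h : Skip S s a l) : nameLen S (pre s l) = a := by
  have key : ∀ j ≤ l, below S ((pre s l).take j) = below S (pre s l) ↔ a ≤ j := by
    intro j hj
    rw [pre_take s hj h.le_width]
    constructor
    · intro e
      by_contra! hlt
      obtain ⟨t, ht, e'⟩ := h.parent (by omega)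
      have h1 : t ∈ below S (pre s j) := (mem_below (hj.trans h.le_width)).2 ⟨ht, by omega⟩
      rw [e, mem_below h.le_width] at h1
      have := h.name_le
      omega
    · intro haj
      ext t
      rw [mem_below (hj.trans h.le_width), mem_below h.le_width]
      exact and_congr_right fun ht => ⟨fun h' => h.gap t ht (haj.trans h'), hj.trans⟩
  have ha : a ∈ {j | below S ((pre s l).take j) = below S (pre s l)} := (key a h.name_le).2 le_rfl
  have h1 : nameLen S (pre s l) ≤ a := Nat.sInf_le ha
  exact h1.antisymm ((key _ (h1.trans h.name_le)).1 (Nat.sInf_mem ⟨a, ha⟩))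

theorem Skip.name_eq (h : Skip S s a l) : name S (pre s l) = pre s a := by
  rw [name, h.nameLen_eq, pre_take s h.name_le h.le_width]

theorem Skip.mem_internalNodes_iff (h : Skip S s a l) : pre s l ∈ internalNodes S ↔ l < w := by
  rw [internalNodes, Finset.mem_filter, and_iff_right h.mem_nodes]
  have hs : s ∈ below S (pre s l) := (mem_below h.le_width).2 ⟨h.mem, by simp [h.le_width]⟩
  change 1 < _ ↔ _
  rw [Finset.one_lt_card]
  constructor
  · rintro ⟨t, ht, u, hu, hne⟩
    rw [mem_below h.le_width] at ht hu
    refine lt_of_le_of_lt ?_ ((common_lt_iff_ne t u).2 hne)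
    exact le_common_trans (by rw [common_comm]; exact ht.2) hu.2
  · intro hl
    obtain ⟨t, ht, e⟩ := h.branch hl
    exact ⟨s, hs, t, (mem_below h.le_width).2 ⟨ht, e.ge⟩, (common_lt_iff_ne s t).1 (e ▸ hl)⟩

/-- The name of the exit node of a prefix of an element of `S`. -/
theorem Skip.exitNameLen_eq (h : Skip S s a l) (ha : a ≤ j) (hl : j ≤ l) :
    exitNameLen S (pre s j) = a := by
  have hjw := hl.trans h.le_width
  have hset : {t | ∃ e, IsExit S (pre s j) e ∧ t = nameLen S e} = {a} := by
    ext t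
    simp only [Set.mem_ofPred_eq, Set.mem_singleton_iff]
    constructor
    · rintro ⟨e, ⟨he, hn, hx⟩, rfl⟩
      obtain ⟨s', a', l', h', rfl⟩ := mem_nodes_iff.1 he
      rw [h'.name_eq, pre_isPrefix_pre _ _ hjw] at hn
      have hT := h'.transfer h.mem hn.2
      have hs' := h'.gap s h.mem hn.2
      rw [h'.nameLen_eq]
      refine (hT.unique h (hn.1.trans hl) (ha.trans ?_)).1
      rcases hx with hx | hx
      · exact (congrArg Str.len hx).ge
      · rw [pre_isPrefix_pre _ _ hjw] at hx
        by_contra! hlt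
        exact hx ⟨hlt.le, hs'⟩
    · rintro rfl
      refine ⟨pre s l, ⟨h.mem_nodes, ?_, ?_⟩, h.nameLen_eq.symm⟩
      · rw [h.name_eq, pre_isPrefix_pre _ _ hjw]
        exact ⟨ha, by simpa using ha.trans hjw⟩
      · rcases hl.lt_or_eq with hlt | rfl
        · right
          rw [pre_isPrefix_pre _ _ hjw]
          omega
        · exact Or.inl rfl
  rw [exitNameLen, hset, csInf_singleton]

/-! ### 2-fattest numbers -/

theorem fattest_eq {f : ℕ} (hf : f ∈ Finset.Ioc a b)
    (h : ∀ g ∈ Finset.Ioc a b, padicValNat 2 f ≤ padicValNat 2 g → g = f) : fattest a b = f := by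
  have : (Finset.Ioc a b).filter (fun f =>
      ∀ g ∈ Finset.Ioc a b, padicValNat 2 g ≤ padicValNat 2 f) = {f} := by
    ext f'
    rw [Finset.mem_filter, Finset.mem_singleton]
    constructor
    · exact fun h' => h f' h'.1 (h'.2 f hf)
    · rintro rfl
      refine ⟨hf, fun g hg => ?_⟩
      by_contra! hlt
      rw [h g hg hlt.le] at hlt
      exact lt_irrefl _ hlt
  rw [fattest, this, Finset.sup_singleton, id]

/-- The multiple of `2 ^ m` in `(a..r]`, where `m` is the position of the most significant bit at
which `a` and `r` differ, is the 2-fattest number of all subintervals that contain it. -/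
theorem fattest_of_split {a r m a' b' : ℕ} (h₁ : a / 2 ^ (m + 1) = r / 2 ^ (m + 1))
    (h₂ : a / 2 ^ m < r / 2 ^ m) (ha : a ≤ a') (hb : b' ≤ r)
    (hf : r / 2 ^ m * 2 ^ m ∈ Finset.Ioc a' b') : fattest a' b' = r / 2 ^ m * 2 ^ m := by
  rw [pow_succ, ← Nat.div_div_eq_div_mul, ← Nat.div_div_eq_div_mul] at h₁
  have hodd : r / 2 ^ m % 2 = 1 := by omega
  have hval : padicValNat 2 (r / 2 ^ m * 2 ^ m) = m := by
    rw [padicValNat.mul (by omega) (by positivity), padicValNat.prime_pow,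
      padicValNat.eq_zero_of_not_dvd (by omega), zero_add]
  refine fattest_eq hf fun g hg hle => ?_
  rw [hval] at hle
  rw [Finset.mem_Ioc] at hg
  obtain ⟨c, rfl⟩ : 2 ^ m ∣ g := (pow_dvd_pow 2 hle).trans pow_padicValNat_dvd
  have hc₁ : a / 2 ^ m < c := by
    rw [Nat.div_lt_iff_lt_mul (by positivity), mul_comm]
    omega
  have hc₂ : c ≤ r / 2 ^ m := by
    rw [Nat.le_div_iff_mul_le (by positivity), mul_comm]
    omega
  rw [mul_comm, show c = r / 2 ^ m by omega]

theorem Skip.handle_eq {f : ℕ} (h : Skip S s a l) (hf : fattest (a - 1) l = f) (hfl : f ≤ l) :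
    handle S (pre s l) = pre s f := by
  rw [handle, h.nameLen_eq, pre_len, hf, pre_take s hfl h.le_width]

theorem fattest_mem (h : a < b) : fattest a b ∈ Finset.Ioc a b := by
  have hne : ((Finset.Ioc a b).filter (fun f =>
      ∀ g ∈ Finset.Ioc a b, padicValNat 2 g ≤ padicValNat 2 f)).Nonempty := by
    obtain ⟨f, hf, hmax⟩ := Finset.exists_max_image (Finset.Ioc a b) (padicValNat 2)
      ⟨b, Finset.mem_Ioc.2 ⟨h, le_rfl⟩⟩
    exact ⟨f, Finset.mem_filter.2 ⟨hf, hmax⟩⟩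
  obtain ⟨f, hf, e⟩ := Finset.exists_mem_eq_sup _ hne id
  rw [fattest, e]
  exact (Finset.mem_filter.1 hf).1

theorem Skip.fattest_bounds (h : Skip S s a l) :
    a ≤ fattest (a - 1) l ∧ fattest (a - 1) l ≤ l := by
  rcases Nat.eq_zero_or_pos a with rfl | ha
  · refine ⟨Nat.zero_le _, ?_⟩
    rcases Nat.eq_zero_or_pos l with rfl | hl
    · simp [fattest]
    · exact (Finset.mem_Ioc.1 (fattest_mem hl)).2
  · have := Finset.mem_Ioc.1 (fattest_mem (a := a - 1) (b := l) (by have := h.name_le; omega))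
    omega

/-- A handle determines its node. -/
theorem Skip.handle_val (h : Skip S s a l) (hl : l < w) :
    sInf {t | ∃ e ∈ internalNodes S, handle S e = handle S (pre s l) ∧ t = nameLen S e} = a := by
  have hset : {t | ∃ e ∈ internalNodes S, handle S e = handle S (pre s l) ∧ t = nameLen S e}
      = {a} := by
    ext t
    simp only [Set.mem_ofPred_eq, Set.mem_singleton_iff]
    constructor
    · rintro ⟨e, he, hh, rfl⟩
      obtain ⟨s', a', l', h', rfl⟩ := mem_nodes_iff.1 (Finset.mem_filter.1 he).1
      obtain ⟨h1, h2⟩ := h.fattest_bounds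
      obtain ⟨h1', h2'⟩ := h'.fattest_bounds
      rw [h.handle_eq rfl h2, h'.handle_eq rfl h2'] at hh
      have hlen : fattest (a' - 1) l' = fattest (a - 1) l := congrArg Str.len hh
      rw [hlen] at hh h1' h2'
      rw [pre_eq_pre_iff _ _ (h2.trans h.le_width)] at hh
      rw [h'.nameLen_eq]
      exact ((h'.transfer h.mem (h1'.trans hh)).unique h (h1'.trans h2) (h1.trans h2')).1
    · rintro rfl
      exact ⟨pre s l, h.mem_internalNodes_iff.2 hl, rfl, h.nameLen_eq.symm⟩
  rw [hset, csInf_singleton]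

end Trie

/-! ### Ranks, predecessors and markers -/

section Rank

variable {w : ℕ} {S : Finset (BitVec w)} {s t x y : BitVec w} {a j l : ℕ}

/-- The order of full strings, built on the order relations that `BitVec` already has. -/
instance : LinearOrder (BitVec w) where
  le_refl := BitVec.le_refl
  le_trans _ _ _ := BitVec.le_trans
  le_antisymm _ _ := BitVec.le_antisymm
  le_total := BitVec.le_total
  lt_iff_le_not_ge x y := by rw [BitVec.lt_def, BitVec.le_def, BitVec.le_def]; omega
  toDecidableLE := inferInstance
  toDecidableEq := inferInstance
  toDecidableLT := inferInstance

theorem ofNat_sub_ofNat {m n : ℕ} (h : m ≤ n) :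
    BitVec.ofNat w n - BitVec.ofNat w m = BitVec.ofNat w (n - m) := by
  conv_lhs => rw [← Nat.sub_add_cancel h, BitVec.ofNat_add]
  exact add_sub_cancel_right _ _

theorem rankIn_lt_card {A : Finset (BitVec w)} (hs : s ∈ A) : rankIn A s < A.card := by
  refine Finset.card_lt_card (Finset.ssubset_iff_subset_ne.2 ⟨Finset.filter_subset _ _, fun h => ?_⟩)
  rw [Finset.filter_eq_self] at h
  exact lt_irrefl _ (h s hs)

theorem rankIn_mono (A : Finset (BitVec w)) (h : x ≤ y) : rankIn A x ≤ rankIn A y :=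
  Finset.card_le_card fun _ ht => by
    rw [Finset.mem_filter] at ht ⊢
    exact ⟨ht.1, ht.2.trans_le h⟩

theorem rankIn_lt_rankIn {A : Finset (BitVec w)} (hx : x ∈ A) (h : x < y) :
    rankIn A x < rankIn A y := by
  refine Finset.card_lt_card (Finset.ssubset_iff_subset_ne.2 ⟨fun t ht => ?_, fun h' => ?_⟩)
  · rw [Finset.mem_filter] at ht ⊢
    exact ⟨ht.1, ht.2.trans h⟩
  · have : x ∈ A.filter fun s => s < x := h' ▸ Finset.mem_filter.2 ⟨hx, h⟩
    exact lt_irrefl _ (Finset.mem_filter.1 this).2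

theorem rankIn_injOn {A : Finset (BitVec w)} (hx : x ∈ A) (hy : y ∈ A)
    (h : rankIn A x = rankIn A y) : x = y := by
  rcases lt_trichotomy x y with h' | h' | h'
  · exact absurd (rankIn_lt_rankIn hx h') h.not_lt
  · exact h'
  · exact absurd (rankIn_lt_rankIn hy h') h.not_gt

theorem rankIn_le_toNat (A : Finset (BitVec w)) (x : BitVec w) : rankIn A x ≤ x.toNat := by
  have h : rankIn A x = ((A.filter fun s => s < x).image BitVec.toNat).card :=
    (Finset.card_image_of_injective _ fun _ _ h => BitVec.eq_of_toNat_eq h).symm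
  rw [h]
  refine (Finset.card_le_card (t := Finset.range x.toNat) fun k hk => ?_).trans
    (Finset.card_range _).le
  obtain ⟨t, ht, rfl⟩ := Finset.mem_image.1 hk
  exact Finset.mem_range.2 (BitVec.lt_def.1 (Finset.mem_filter.1 ht).2)

theorem rankIn_lt_two_pow (A : Finset (BitVec w)) (x : BitVec w) : rankIn A x < 2 ^ w :=
  (rankIn_le_toNat A x).trans_lt x.isLt

theorem rankIn_congr {A : Finset (BitVec w)} (h : ∀ t ∈ A, t < x ↔ t < y) :
    rankIn A x = rankIn A y := by
  rw [rankIn, rankIn, Finset.filter_congr h]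

theorem rankIn_eq_succ {A : Finset (BitVec w)} (hy : y ∈ A) (h : ∀ t ∈ A, t < x ↔ t ≤ y) :
    rankIn A x = rankIn A y + 1 := by
  have : A.filter (fun t => t < x) = insert y (A.filter fun t => t < y) := by
    ext t
    rw [Finset.mem_insert, Finset.mem_filter, Finset.mem_filter]
    constructor
    · rintro ⟨ht, hx⟩
      exact ((h t ht).1 hx).eq_or_lt.imp_right fun h' => ⟨ht, h'⟩
    · rintro (rfl | ⟨ht, hx⟩)
      · exact ⟨hy, (h _ hy).2 le_rfl⟩
      · exact ⟨ht, (h t ht).2 hx.le⟩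
  rw [rankIn, this, Finset.card_insert_of_notMem, rankIn]
  simp

theorem card_eq_rankIn_succ {A : Finset (BitVec w)} (hy : y ∈ A) (h : ∀ t ∈ A, t ≤ y) :
    A.card = rankIn A y + 1 := by
  have : A = insert y (A.filter fun t => t < y) := by
    ext t
    rw [Finset.mem_insert, Finset.mem_filter]
    constructor
    · exact fun ht => (h t ht).eq_or_lt.imp_right fun h' => ⟨ht, h'⟩
    · rintro (rfl | ⟨ht, -⟩)
      exacts [hy, ht]
  rw [rankIn, ← Finset.card_insert_of_notMem (a := y), ← this]
  simp

theorem length_sortedArray (S : Finset (BitVec w)) : (sortedArray S).length = S.card :=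
  Finset.length_sort _

theorem mem_of_getElem?_sortedArray {i : ℕ} (h : (sortedArray S)[i]? = some s) : s ∈ S :=
  (Finset.mem_sort _).1 (List.mem_of_getElem? h)

theorem getElem?_sortedArray_rankIn (hs : s ∈ S) :
    (sortedArray S)[rankIn S s]? = some s := by
  have hr := rankIn_lt_card hs
  have hs' : s ∈ Finset.image (S.orderEmbOfFin rfl) Finset.univ := by
    rwa [Finset.image_orderEmbOfFin_univ]
  obtain ⟨i, -, rfl⟩ := Finset.mem_image.1 hs'
  have h : rankIn S (S.orderEmbOfFin rfl i) = i := by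
    have : S.filter (fun t => t < S.orderEmbOfFin rfl i) =
        (Finset.Iio i).image (S.orderEmbOfFin rfl) := by
      ext t
      rw [Finset.mem_filter, Finset.mem_image]
      constructor
      · rintro ⟨ht, hlt⟩
        rw [← Finset.image_orderEmbOfFin_univ S rfl, Finset.mem_image] at ht
        obtain ⟨j, -, rfl⟩ := ht
        exact ⟨j, Finset.mem_Iio.2 ((S.orderEmbOfFin rfl).lt_iff_lt.1 hlt), rfl⟩
      · rintro ⟨j, hj, rfl⟩
        exact ⟨Finset.orderEmbOfFin_mem _ _ _,
          (S.orderEmbOfFin rfl).lt_iff_lt.2 (Finset.mem_Iio.1 hj)⟩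
    rw [rankIn, this, Finset.card_image_of_injective _ (S.orderEmbOfFin rfl).injective,
      Fin.card_Iio]
  rw [h, Finset.orderEmbOfFin_apply, sortedArray]
  exact List.getElem?_eq_getElem _

theorem isPredIndex_rankIn (S : Finset (BitVec w)) (x : BitVec w) :
    IsPredIndex S x (BitVec.ofNat w (rankIn S x) - 1#w) := by
  by_cases h : ∃ y, IsPred S x y
  · left
    obtain ⟨y, hy⟩ := h
    refine ⟨y, hy, ?_⟩
    have hr : rankIn S x = rankIn S y + 1 :=
      rankIn_eq_succ hy.1.1 fun t ht => ⟨fun hlt => hy.2 ⟨ht, hlt⟩, fun hle => hle.trans_lt hy.1.2⟩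
    rw [hr, ofNat_sub_ofNat (by omega), Nat.add_sub_cancel, BitVec.toNat_ofNat,
      Nat.mod_eq_of_lt (rankIn_lt_two_pow S y)]
    exact getElem?_sortedArray_rankIn hy.1.1
  · right
    refine ⟨h, ?_⟩
    have h0 : rankIn S x = 0 := by
      rw [rankIn, Finset.card_eq_zero, ← Finset.not_nonempty_iff_eq_empty]
      intro hne
      obtain ⟨y, hy, hmax⟩ := Finset.exists_max_image _ id hne
      rw [Finset.mem_filter] at hy
      exact h ⟨y, hy, fun t ht => hmax t (Finset.mem_filter.2 ht)⟩
    rw [h0]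
    simp

/-- `s` is the least leaf below a node through `u` with a name of length `a`. -/
structure IsFirst (S : Finset (BitVec w)) (u : BitVec w) (a : ℕ) (s : BitVec w) : Prop where
  mem : s ∈ S
  le_common : a ≤ common u s
  le : ∀ t ∈ S, a ≤ common u t → s ≤ t

/-- `s` is the largest leaf below a node through `u` with a name of length `a`. -/
structure IsLast (S : Finset (BitVec w)) (u : BitVec w) (a : ℕ) (s : BitVec w) : Prop where
  mem : s ∈ S
  le_common : a ≤ common u s
  le : ∀ t ∈ S, a ≤ common u t → t ≤ s

theorem exists_isFirst {u : BitVec w} (hs : s ∈ S) (h : a ≤ common u s) :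
    ∃ t, IsFirst S u a t := by
  obtain ⟨t, ht, hmin⟩ := Finset.exists_min_image (S.filter fun t => a ≤ common u t) id
    ⟨s, Finset.mem_filter.2 ⟨hs, h⟩⟩
  rw [Finset.mem_filter] at ht
  exact ⟨t, ht.1, ht.2, fun v hv hc => hmin v (Finset.mem_filter.2 ⟨hv, hc⟩)⟩

theorem exists_isLast {u : BitVec w} (hs : s ∈ S) (h : a ≤ common u s) :
    ∃ t, IsLast S u a t := by
  obtain ⟨t, ht, hmax⟩ := Finset.exists_max_image (S.filter fun t => a ≤ common u t) id
    ⟨s, Finset.mem_filter.2 ⟨hs, h⟩⟩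
  rw [Finset.mem_filter] at ht
  exact ⟨t, ht.1, ht.2, fun v hv hc => hmax v (Finset.mem_filter.2 ⟨hv, hc⟩)⟩

/-- The extent of a node is the longest common prefix of its least and largest leaves. -/
theorem Skip.common_first_last {s₀ s₁ : BitVec w} (h : Skip S s a l) (h₀ : IsFirst S s a s₀)
    (h₁ : IsLast S s a s₁) : common s₀ s₁ = l := by
  apply le_antisymm
  · obtain ⟨t, ht, e⟩ := h.branch_exists
    have has : a ≤ common s s := by rw [common_self]; exact h.name_le.trans h.le_width
    have hat : a ≤ common s t := e ▸ h.name_le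
    rw [← e]
    have hs₀ := h₀.le s h.mem has
    have hs₁ := h₁.le s h.mem has
    have ht₀ := h₀.le t ht hat
    have ht₁ := h₁.le t ht hat
    rcases le_total s t with hst | hst
    · exact (common_anti_of_le' hs₀ hs₁).trans (common_anti_of_le hst ht₁)
    · rw [common_comm s t]
      exact (common_anti_of_le' ht₀ ht₁).trans (common_anti_of_le hst hs₁)
  · exact le_common_trans (by rw [common_comm]; exact h.gap _ h₀.mem h₀.le_common)
      (h.gap _ h₁.mem h₁.le_common)

theorem Skip.pre_eq (h : Skip S s a l) (ht : t ∈ S) (hst : a ≤ common s t) : pre t l = pre s l :=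
  (pre_eq_pre_iff t s h.le_width).2 (by rw [common_comm]; exact h.gap t ht hst)

theorem IsFirst.rankIn_pre_bits {u : BitVec w} (ha : a ≤ w) (h : IsFirst S u a s) :
    rankIn S (pre u a).bits = rankIn S s := by
  refine rankIn_congr fun t ht => ⟨fun hlt => ?_, fun hlt => ?_⟩
  · exact hlt.trans_le (pre_bits_le_of_le_common ha h.le_common)
  · by_contra! hle
    have hc := h.le_common
    rw [(pre_eq_pre_iff u s ha).2 hc] at hle
    have h1 := le_common_of_pre_bits_le ha hle hlt.le
    exact hlt.not_ge (h.le t ht (le_common_trans hc h1))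

theorem IsLast.rankIn_nextBits {u : BitVec w} (hw : 1 ≤ w) (ha : a ≤ w) (h : IsLast S u a s)
    (hne : nextBits u a ≠ 0#w) : rankIn S (nextBits u a) = rankIn S s + 1 := by
  refine rankIn_eq_succ h.mem fun t ht => ?_
  rw [lt_nextBits_iff hw hne, (le_common_iff_div u s ha).1 h.le_common, div_le_iff _ _ ha]
  constructor
  · rintro (h' | h')
    exacts [h', h.le t ht (le_common_trans h.le_common h')]
  · exact Or.inl

theorem IsLast.card_eq {u : BitVec w} (hw : 1 ≤ w) (ha : a ≤ w) (h : IsLast S u a s)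
    (h0 : nextBits u a = 0#w) : S.card = rankIn S s + 1 := by
  refine card_eq_rankIn_succ h.mem fun t ht => ?_
  rcases (div_le_iff u t ha).1 (div_le_of_nextBits_eq_zero hw t h0) with h' | h'
  · by_contra! hlt
    have h2 := common_anti_of_le' hlt.le h'
    rw [common_comm s u, common_comm t u] at h2
    exact hlt.not_ge (h.le t ht (h.le_common.trans h2))
  · exact h.le t ht h'

/-- If `x` leaves to the left the path to `s` within the skip interval of a node, its rank is that
of the least leaf below the node. -/
theorem Skip.rankIn_eq_of_lt {s₀ : BitVec w} (h : Skip S s a l) (h₀ : IsFirst S s a s₀)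
    (ha : a ≤ common x s) (hl : common x s < l) (hlt : x < s) :
    rankIn S x = rankIn S s₀ := by
  have hx : ∀ t ∈ S, a ≤ common s t → x < t := by
    intro t ht hst
    by_contra! hle
    have h1 := common_anti_of_le' hle hlt.le
    have h2 := h.gap t ht hst
    rw [common_comm] at h2
    omega
  have hx₀ := hx s₀ h₀.mem h₀.le_common
  refine rankIn_congr fun t ht => ⟨fun h' => h'.trans hx₀, fun h' => ?_⟩
  by_contra! hle
  have h1 := common_anti_of_le hle h'.le
  have h2 : a ≤ common x s₀ := le_common_trans ha h₀.le_common
  have h3 : a ≤ common s t := le_common_trans (by rw [common_comm]; exact ha) (h2.trans h1)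
  exact h'.not_ge (h₀.le t ht h3)

/-- If `x` leaves to the right the path to `s` within the skip interval of a node, its predecessor
is the largest leaf below the node. -/
theorem Skip.rankIn_eq_of_gt {s₁ : BitVec w} (h : Skip S s a l) (h₁ : IsLast S s a s₁)
    (ha : a ≤ common x s) (hl : common x s < l) (hlt : s < x) :
    rankIn S x = rankIn S s₁ + 1 := by
  have hx : ∀ t ∈ S, a ≤ common s t → t < x := by
    intro t ht hst
    by_contra! hle
    have h1 := common_anti_of_le hlt.le hle
    have h2 := h.gap t ht hst
    rw [common_comm s x] at h1
    omega
  have hx₁ := hx s₁ h₁.mem h₁.le_common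
  refine rankIn_eq_succ h₁.mem fun t ht => ⟨fun h' => ?_, fun h' => h'.trans_lt hx₁⟩
  by_contra! hle
  have h1 := common_anti_of_le' hle.le h'.le
  have h2 : a ≤ common s₁ x := by
    rw [common_comm]; exact le_common_trans ha h₁.le_common
  rw [common_comm t x] at h1
  have h3 : a ≤ common s t := le_common_trans (by rw [common_comm]; exact ha) (h2.trans h1)
  exact hle.not_ge (h₁.le t ht h3)

/-- If no element of `S` is prefixed by `x[0..j)`, but some are prefixed by the following string,
the rank of `x` is that of the least of them. -/
theorem Skip.rankIn_eq_of_next {s₀ : BitVec w} (h : Skip S s a l) (h₀ : IsFirst S s a s₀)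
    (ha : a ≤ j) (hl : j ≤ l) (hx : ∀ t ∈ S, common x t < j)
    (hs : s.toNat / 2 ^ (w - j) = x.toNat / 2 ^ (w - j) + 1) : rankIn S x = rankIn S s₀ := by
  have hjw := hl.trans h.le_width
  have h₀' := (le_common_iff_div s s₀ hjw).1 (hl.trans (h.gap s₀ h₀.mem h₀.le_common))
  refine rankIn_congr fun t ht => ⟨fun h' => ?_, fun h' => ?_⟩
  · rw [BitVec.lt_def] at h' ⊢
    by_contra! hle
    have := Nat.div_le_div_right (c := 2 ^ (w - j)) (hle.trans h'.le)
    omega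
  · rw [BitVec.lt_def] at h' ⊢
    by_contra! hle
    have h1 := Nat.div_le_div_right (c := 2 ^ (w - j)) hle
    have h2 := Nat.div_le_div_right (c := 2 ^ (w - j)) h'.le
    have h3 := mt (le_common_iff_div x t hjw).2 (hx t ht).not_ge
    have h4 : j ≤ common s t := (le_common_iff_div s t hjw).2 (by omega)
    have := BitVec.le_def.1 (h₀.le t ht (ha.trans h4))
    omega

/-- If no element of `S` is prefixed by `x[0..j)`, but some are prefixed by the preceding string,
the largest of them is the predecessor of `x`. -/
theorem Skip.rankIn_eq_of_prev {s₁ : BitVec w} (h : Skip S s a l) (h₁ : IsLast S s a s₁)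
    (ha : a ≤ j) (hl : j ≤ l) (hx : ∀ t ∈ S, common x t < j)
    (hs : s.toNat / 2 ^ (w - j) + 1 = x.toNat / 2 ^ (w - j)) :
    rankIn S x = rankIn S s₁ + 1 := by
  have hjw := hl.trans h.le_width
  have h₁' := (le_common_iff_div s s₁ hjw).1 (hl.trans (h.gap s₁ h₁.mem h₁.le_common))
  refine rankIn_eq_succ h₁.mem fun t ht => ⟨fun h' => ?_, fun h' => ?_⟩
  · rw [BitVec.lt_def] at h'
    rw [BitVec.le_def]
    by_contra! hle
    have h1 := Nat.div_le_div_right (c := 2 ^ (w - j)) hle.le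
    have h2 := Nat.div_le_div_right (c := 2 ^ (w - j)) h'.le
    have h3 := mt (le_common_iff_div x t hjw).2 (hx t ht).not_ge
    have h4 : j ≤ common s t := (le_common_iff_div s t hjw).2 (by omega)
    have := BitVec.le_def.1 (h₁.le t ht (ha.trans h4))
    omega
  · rw [BitVec.le_def] at h'
    rw [BitVec.lt_def]
    by_contra! hle
    have := Nat.div_le_div_right (c := 2 ^ (w - j)) (hle.trans h')
    omega

theorem Skip.pre_bits_mem_markers (h : Skip S s a l) : (pre s a).bits ∈ markers S := by
  rw [markers, Finset.mem_union, ← h.name_eq]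
  exact Or.inl (Finset.mem_image_of_mem (fun e => (name S e).bits) h.mem_nodes)

theorem Skip.nextBits_mem_markers (h : Skip S s a l) (hne : nextBits s a ≠ 0#w) :
    nextBits s a ∈ markers S := by
  rw [markers, Finset.mem_union]
  refine Or.inr (Finset.mem_filter.2 ⟨Finset.mem_image.2 ⟨pre s l, h.mem_nodes, ?_⟩, hne⟩)
  rw [h.name_eq]
  rfl

theorem bucketRank_le {k : BitVec w} (hk : k ∈ markers S) :
    bucketRank S (bucketPrefix S k) ≤ rankIn S k :=
  Nat.sInf_le ⟨k, hk, rfl, rfl⟩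

end Rank

/-! ### Reasoning about programs -/

section Logic

variable {w : ℕ} {E : Env w} {α β σ : Type} {P : α → Prop} {n m : ℕ}

/-- The program `c` terminates in at most `n` steps with a result that satisfies `P`. -/
def Spec (E : Env w) (c : Code (BitVec w) α) (P : α → Prop) (n : ℕ) : Prop :=
  ∃ a, P a ∧ ∃ k ≤ n, ∀ t, run E c (k + t) = some (a, t)

/-- The loop with the given body, started in the state `s`, terminates in at most `n` steps with a
result that satisfies `P`. -/
def LoopSpec (E : Env w) (body : σ → Code (BitVec w) (σ ⊕ α)) (s : σ) (P : α → Prop) (n : ℕ) :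
    Prop :=
  ∃ a, P a ∧ ∃ k ≤ n, ∀ fuel t, k ≤ fuel →
    iter (fun s' => run E (body s')) fuel s (k + t) = some (a, t)

theorem Spec.returnsWithin {c : Code (BitVec w) α} (h : Spec E c P n) :
    ∃ a, ReturnsWithin E c a n ∧ P a := by
  obtain ⟨a, ha, k, hk, h⟩ := h
  refine ⟨a, ⟨n - k, ?_⟩, ha⟩
  rw [← h, Nat.add_sub_cancel' hk]

theorem Spec.mono {Q : α → Prop} {c : Code (BitVec w) α} (h : Spec E c P n)
    (hPQ : ∀ a, P a → Q a) (hnm : n ≤ m) : Spec E c Q m := by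
  obtain ⟨a, ha, k, hk, h⟩ := h
  exact ⟨a, hPQ a ha, k, hk.trans hnm, h⟩

theorem Spec.bind {Q : β → Prop} {c : Code (BitVec w) β} {f : β → Code (BitVec w) α}
    (hc : Spec E c Q m) (hf : ∀ b, Q b → Spec E (f b) P n) : Spec E (c >>= f) P (n + m) := by
  obtain ⟨b, hb, k, hk, hc⟩ := hc
  obtain ⟨a, ha, k', hk', hf⟩ := hf b hb
  refine ⟨a, ha, k + k', by omega, fun t => ?_⟩
  change (run E c (k + k' + t)).bind (fun r => run E (f r.1) r.2) = _
  rw [add_assoc, hc, Option.bind_some, hf]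

theorem Spec.pure {a : α} (h : P a) : Spec E (pure a) P n :=
  ⟨a, h, 0, Nat.zero_le n, fun t => by rw [Nat.zero_add]; rfl⟩

theorem Spec.of_run {c : Code (BitVec w) α} {a : α} (h : ∀ t, run E c (t + 1) = some (a, t)) :
    Spec E c (· = a) 1 :=
  ⟨a, rfl, 1, le_rfl, fun t => by rw [Nat.add_comm]; exact h t⟩

theorem Spec.bind_eq {b : β} {c : Code (BitVec w) β} {f : β → Code (BitVec w) α}
    (hc : Spec E c (· = b) m) (hf : Spec E (f b) P n) : Spec E (c >>= f) P (n + m) :=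
  hc.bind fun _ h => h ▸ hf

theorem Spec.ite {c : Prop} [Decidable c] {p q : Code (BitVec w) α} (hp : c → Spec E p P n)
    (hq : ¬ c → Spec E q P n) : Spec E (if c then p else q) P n := by
  split_ifs with h
  exacts [hp h, hq h]

theorem spec_lit (k : ℕ) : Spec E (.lit k) (· = BitVec.ofNat w k) 1 := .of_run fun _ => rfl

theorem spec_width : Spec E .width (· = BitVec.ofNat w w) 1 := .of_run fun _ => rfl

theorem spec_last : Spec E .last (· = BitVec.ofNat w (E.array.length - 1)) 1 := .of_run fun _ => rfl

theorem spec_op (o : Op) (a b : BitVec w) : Spec E (.op o a b) (· = o.eval a b) 1 :=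
  .of_run fun _ => rfl

theorem spec_not (a : BitVec w) : Spec E (.not a) (· = ~~~a) 1 := .of_run fun _ => rfl

theorem spec_msb (a : BitVec w) : Spec E (.msb a) (· = BitVec.ofNat w (Nat.log 2 a.toNat)) 1 :=
  .of_run fun _ => rfl

theorem spec_test (o : Cmp) (a b : BitVec w) : Spec E (.test o a b) (· = o.eval a b) 1 :=
  .of_run fun _ => rfl

theorem spec_look (f : Tab) (p : BitVec w × BitVec w) :
    Spec E (.look f p) (· = BitVec.ofNat w (E.answer f ⟨p.1, p.2.toNat⟩)) 1 := .of_run fun _ => rfl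

theorem spec_read {i a : BitVec w} (h : E.array[i.toNat]? = some a) :
    Spec E (.read i) (· = a) 1 := .of_run fun _ => by simp [run, tick, h]

theorem Spec.loop {body : σ → Code (BitVec w) (σ ⊕ α)} {s : σ} (h : LoopSpec E body s P n) :
    Spec E (.loop body s) P n := by
  obtain ⟨a, ha, k, hk, h⟩ := h
  exact ⟨a, ha, k, hk, fun t => h (k + t) t (Nat.le_add_right k t)⟩

theorem LoopSpec.mono {Q : α → Prop} {body : σ → Code (BitVec w) (σ ⊕ α)} {s : σ}
    (h : LoopSpec E body s P n) (hPQ : ∀ a, P a → Q a) (hnm : n ≤ m) : LoopSpec E body s Q m := by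
  obtain ⟨a, ha, k, hk, h⟩ := h
  exact ⟨a, hPQ a ha, k, hk.trans hnm, h⟩

theorem LoopSpec.step {body : σ → Code (BitVec w) (σ ⊕ α)} {s : σ}
    (h : Spec E (body s) (Sum.elim (fun s' => LoopSpec E body s' P n) P) m) :
    LoopSpec E body s P (n + m + 1) := by
  obtain ⟨r, hr, k, hk, h⟩ := h
  rcases r with s' | a
  · obtain ⟨a, ha, k', hk', h'⟩ := hr
    refine ⟨a, ha, k + k' + 1, by omega, fun fuel t hf => ?_⟩
    obtain ⟨fuel, rfl⟩ : ∃ f, fuel = f + 1 := ⟨fuel - 1, by omega⟩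
    rw [show k + k' + 1 + t = k + (k' + t) + 1 by omega, iter, h]
    exact h' fuel t (by omega)
  · refine ⟨a, hr, k + 1, by omega, fun fuel t hf => ?_⟩
    obtain ⟨fuel, rfl⟩ : ∃ f, fuel = f + 1 := ⟨fuel - 1, by omega⟩
    rw [show k + 1 + t = k + t + 1 by omega, iter, h]

end Logic

/-! ### Operations on strings -/

section Strings

variable {w : ℕ} {E : Env w} {α : Type} {P : α → Prop} {n : ℕ}

/-- The representation of a string as a pair of words. -/
def Str.enc (p : Str w) : BitVec w × BitVec w := (p.bits, BitVec.ofNat w p.len)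

theorem toNat_ofNat_of_le {k : ℕ} (h : k ≤ w) : (BitVec.ofNat w k).toNat = k := by
  rw [BitVec.toNat_ofNat, Nat.mod_eq_of_lt (h.trans_lt Nat.lt_two_pow_self)]

theorem spec_cut_total (x l : BitVec w) : Spec E (cut x l) (fun _ => True) 4 := by
  unfold cut
  refine spec_width.bind_eq ?_
  refine (spec_op _ _ _).bind_eq ?_
  refine (spec_op _ _ _).bind_eq ?_
  refine (spec_op _ _ _).bind_eq ?_
  exact .pure trivial

theorem spec_cut (x : BitVec w) {l : ℕ} (hl : l ≤ w) :
    Spec E (cut x (BitVec.ofNat w l)) (· = (pre x l).enc) 4 := by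
  unfold cut
  refine spec_width.bind_eq ?_
  refine (spec_op _ _ _).bind_eq ?_
  refine (spec_op _ _ _).bind_eq ?_
  refine (spec_op _ _ _).bind_eq ?_
  refine .pure ?_
  simp only [Op.eval, ofNat_sub_ofNat hl, toNat_ofNat_of_le (Nat.sub_le w l)]
  rfl

end Strings

section Strings

variable {w : ℕ} {E : Env w}

theorem size_eq_log_succ {n : ℕ} (hn : n ≠ 0) : Nat.size n = Nat.log 2 n + 1 := by
  apply le_antisymm
  · exact Nat.size_le.2 (Nat.lt_pow_succ_log_self one_lt_two n)
  · rw [Nat.add_one_le_iff, Nat.lt_size]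
    exact Nat.pow_log_le_self 2 hn

theorem enc_full (x : BitVec w) : (x, BitVec.ofNat w w) = (pre x w).enc := by
  rw [pre_width]
  rfl

theorem ofNat_le_ofNat {k m : ℕ} (hk : k ≤ w) (hm : m ≤ w) :
    BitVec.ofNat w k ≤ BitVec.ofNat w m ↔ k ≤ m := by
  rw [BitVec.le_def, toNat_ofNat_of_le hk, toNat_ofNat_of_le hm]

theorem ofNat_lt_ofNat {k m : ℕ} (hk : k ≤ w) (hm : m ≤ w) :
    BitVec.ofNat w k < BitVec.ofNat w m ↔ k < m := by
  rw [BitVec.lt_def, toNat_ofNat_of_le hk, toNat_ofNat_of_le hm]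

theorem ofNat_eq_ofNat {k m : ℕ} (hk : k < 2 ^ w) (hm : m < 2 ^ w) :
    BitVec.ofNat w k = BitVec.ofNat w m ↔ k = m := by
  rw [← BitVec.toNat_inj, BitVec.toNat_ofNat, BitVec.toNat_ofNat, Nat.mod_eq_of_lt hk,
    Nat.mod_eq_of_lt hm]

theorem spec_sub {k m : ℕ} (h : m ≤ k) :
    Spec E (.op .sub (BitVec.ofNat w k) (BitVec.ofNat w m)) (· = BitVec.ofNat w (k - m)) 1 :=
  (spec_op _ _ _).mono (fun _ hr => hr.trans (ofNat_sub_ofNat h)) le_rfl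

theorem spec_test_lt {k m : ℕ} (hk : k < 2 ^ w) (hm : m < 2 ^ w) :
    Spec E (.test .lt (BitVec.ofNat w k) (BitVec.ofNat w m)) (· = decide (k < m)) 1 :=
  (spec_test _ _ _).mono (fun _ hr => by
    rw [hr, Cmp.eval, decide_eq_decide, BitVec.lt_def, BitVec.toNat_ofNat, BitVec.toNat_ofNat,
      Nat.mod_eq_of_lt hk, Nat.mod_eq_of_lt hm]) le_rfl

theorem lt_two_pow_of_le {k : ℕ} (hk : k ≤ w) : k < 2 ^ w := hk.trans_lt Nat.lt_two_pow_self

theorem spec_isPrefix (x y : BitVec w) {l m : ℕ} (hl : l ≤ w) (hm : m ≤ w) :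
    Spec E (isPrefix (pre x l).enc (pre y m).enc)
      (· = decide (l ≤ m ∧ l ≤ common x y)) 6 := by
  unfold isPrefix
  refine (spec_test _ _ _).bind_eq ?_
  simp only [Cmp.eval, Str.enc, pre_len, ofNat_le_ofNat hl hm, decide_eq_true_eq]
  refine .ite (fun h => ?_) (fun h => .pure (by simp [h]))
  refine (spec_cut _ hl).bind_eq ?_
  refine (spec_test _ _ _).mono (fun b hb => ?_) le_rfl
  have h' : (pre y l).bits = (pre x l).bits ↔ l ≤ common x y := by
    rw [← pre_eq_pre_iff x y hl]
    exact ⟨fun h => congrArg (fun b => Str.mk b l) h.symm, fun h => by rw [h]⟩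
  rw [hb]
  simp only [Cmp.eval, Str.enc, pre_pre_bits y h hm, h', h, true_and]

theorem spec_isProperPrefix (x y : BitVec w) {l m : ℕ} (hl : l ≤ w) (hm : m ≤ w) :
    Spec E (isProperPrefix (pre x l).enc (pre y m).enc)
      (· = decide (l < m ∧ l ≤ common x y)) 7 := by
  unfold isProperPrefix
  refine (spec_test _ _ _).bind_eq ?_
  simp only [Cmp.eval, Str.enc, pre_len, ofNat_lt_ofNat hl hm, decide_eq_true_eq]
  refine .ite (fun h => ?_) (fun h => .pure (by simp [h]))
  refine (spec_isPrefix x y hl hm).mono (fun b hb => ?_) le_rfl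
  rw [hb]
  simp [h, h.le]

theorem log_xor_eq {x y : BitVec w} (h : x ≠ y) :
    Nat.log 2 (x ^^^ y).toNat = w - 1 - common x y ∧ common x y < w := by
  have hne : (x ^^^ y).toNat ≠ 0 := fun h' =>
    h ((le_common_iff_eq x y).1 (by rw [common, h', Nat.size_zero, Nat.sub_zero]))
  have hw : Nat.size (x ^^^ y).toNat ≤ w := Nat.size_le.2 (x ^^^ y).isLt
  rw [common]
  rw [size_eq_log_succ hne] at hw ⊢
  omega

theorem spec_lcp (x y : BitVec w) : Spec E (lcp x y) (· = (pre x (common x y)).enc) 11 := by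
  unfold lcp
  refine (spec_test _ _ _).bind_eq ?_
  simp only [Cmp.eval, decide_eq_true_eq]
  refine .ite (fun h => ?_) (fun h => ?_)
  · refine spec_width.bind_eq (.pure ?_)
    rw [h, common_self, enc_full]
  · obtain ⟨h₁, h₂⟩ := log_xor_eq h
    refine (spec_op _ _ _).bind_eq ?_
    refine (spec_msb _).bind_eq ?_
    refine spec_width.bind_eq ?_
    refine (spec_lit 1).bind_eq ?_
    refine (spec_op _ _ _).bind_eq ?_
    refine (spec_op _ _ _).bind_eq ?_
    simp only [Op.eval]
    rw [h₁, ofNat_sub_ofNat (by omega), ofNat_sub_ofNat (by omega),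
      show w - 1 - (w - 1 - common x y) = common x y by omega]
    exact spec_cut x h₂.le

end Strings

/-! ### The range locator and the function `T` -/

section Locator

variable {w : ℕ} {S : Finset (BitVec w)} {E : Env w} {s x : BitVec w} {a l : ℕ}

theorem Env.IsFor.look {f : Tab} {p : Str w} (hE : E.IsFor S) (hp : p ∈ (index S f).dom)
    (hl : p.len ≤ w) :
    Spec E (.look f p.enc) (· = BitVec.ofNat w ((index S f).val p)) 1 := by
  refine (spec_look f p.enc).mono (fun r hr => ?_) le_rfl
  rw [hr, Str.enc, toNat_ofNat_of_le hl, (hE.2 f).1 p hp]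

theorem spec_markerRank_total (k : BitVec w) : Spec E (markerRank k) (fun _ => True) 10 := by
  unfold markerRank
  refine spec_width.bind_eq ?_
  refine (spec_look _ _).bind_eq ?_
  refine (spec_cut_total _ _).bind fun _ _ => ?_
  refine (spec_look _ _).bind_eq ?_
  refine spec_width.bind_eq ?_
  refine (spec_look _ _).bind_eq ?_
  exact (spec_op _ _ _).mono (fun _ _ => trivial) le_rfl

theorem spec_markerRank (hE : E.IsFor S) {k : BitVec w} (hk : k ∈ markers S) :
    Spec E (markerRank k) (· = BitVec.ofNat w (rankIn S k)) 10 := by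
  have hlen : lcpLen (bucket S k) ≤ w := lcpLen_le _
  have hbits : (pre k w).bits = k := by rw [pre_width]
  unfold markerRank
  refine spec_width.bind_eq ?_
  rw [enc_full]
  refine (hE.look (f := .bucketLen) (Finset.mem_image_of_mem _ hk) le_rfl).bind_eq ?_
  simp only [index, hbits]
  refine (spec_cut k hlen).bind_eq ?_
  refine (hE.look (f := .bucketBase) (Finset.mem_image_of_mem _ hk) hlen).bind_eq ?_
  refine spec_width.bind_eq ?_
  rw [enc_full]
  refine (hE.look (f := .bucketOffset) (Finset.mem_image_of_mem _ hk) le_rfl).bind_eq ?_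
  refine (spec_op _ _ _).mono (fun r hr => ?_) le_rfl
  rw [hr]
  simp only [index, hbits, Op.eval]
  rw [← BitVec.ofNat_add]
  congr 1
  exact Nat.add_sub_cancel' (bucketRank_le hk)

/-- `i` is the index of an element of the array. -/
def IsIndex (E : Env w) (S : Finset (BitVec w)) (i : BitVec w) : Prop :=
  ∃ s ∈ S, E.array[i.toNat]? = some s

theorem card_sub_one_lt (hS : S.Nonempty) : S.card - 1 < 2 ^ w := by
  have h1 : S.card ≤ 2 ^ w := by
    have := Finset.card_le_univ S
    rwa [Fintype.card_congr (BitVec.equivFin (m := w)).toEquiv, Fintype.card_fin] at this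
  have := hS.card_pos
  omega

theorem Env.IsFor.length_array (hE : E.IsFor S) : E.array.length = S.card := by
  rw [hE.1, length_sortedArray]

theorem Env.IsFor.isIndex (hE : E.IsFor S) {i : BitVec w} (h : i.toNat < S.card) :
    IsIndex E S i := by
  have h' : i.toNat < E.array.length := by rwa [hE.length_array]
  obtain ⟨v, hv⟩ : ∃ v, E.array[i.toNat]? = some v := ⟨_, List.getElem?_eq_getElem h'⟩
  exact ⟨v, mem_of_getElem?_sortedArray (by rwa [← hE.1]), hv⟩

theorem Env.IsFor.array_rankIn (hE : E.IsFor S) (hs : s ∈ S) :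
    E.array[(BitVec.ofNat w (rankIn S s)).toNat]? = some s := by
  rw [BitVec.toNat_ofNat, Nat.mod_eq_of_lt (rankIn_lt_two_pow S s), hE.1]
  exact getElem?_sortedArray_rankIn hs

theorem Env.IsFor.isIndex_last (hE : E.IsFor S) (hS : S.Nonempty) :
    IsIndex E S (BitVec.ofNat w (E.array.length - 1)) := by
  have := hS.card_pos
  refine hE.isIndex ?_
  rw [hE.length_array, BitVec.toNat_ofNat, Nat.mod_eq_of_lt (card_sub_one_lt hS)]
  omega

theorem spec_clamp_total (hE : E.IsFor S) (hS : S.Nonempty) (i : BitVec w) :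
    Spec E (clamp i) (IsIndex E S) 2 := by
  unfold clamp
  refine spec_last.bind_eq ?_
  refine (spec_test _ _ _).bind_eq ?_
  simp only [Cmp.eval, decide_eq_true_eq]
  refine .ite (fun h => .pure (hE.isIndex ?_)) (fun h => .pure (hE.isIndex_last hS))
  have := hS.card_pos
  rw [hE.length_array, BitVec.le_def, BitVec.toNat_ofNat, Nat.mod_eq_of_lt (card_sub_one_lt hS)] at h
  omega

theorem spec_clamp (hE : E.IsFor S) (hs : s ∈ S) :
    Spec E (clamp (BitVec.ofNat w (rankIn S s))) (· = BitVec.ofNat w (rankIn S s)) 2 := by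
  unfold clamp
  refine spec_last.bind_eq ?_
  refine (spec_test _ _ _).bind_eq ?_
  simp only [Cmp.eval, decide_eq_true_eq]
  refine .ite (fun _ => .pure rfl) (fun h => absurd ?_ h)
  have := rankIn_lt_card hs
  rw [hE.length_array, BitVec.le_def, BitVec.toNat_ofNat, BitVec.toNat_ofNat,
    Nat.mod_eq_of_lt (card_sub_one_lt ⟨s, hs⟩), Nat.mod_eq_of_lt (rankIn_lt_two_pow S s)]
  omega

theorem spec_left_total (hE : E.IsFor S) (hS : S.Nonempty) (p : BitVec w × BitVec w) :
    Spec E (left p) (IsIndex E S) 12 := by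
  unfold left
  exact (spec_markerRank_total _).bind fun _ _ => spec_clamp_total hE hS _

theorem spec_left (hE : E.IsFor S) (h : Skip S s a l) {s₀ : BitVec w} (h₀ : IsFirst S s a s₀) :
    Spec E (left (pre s a).enc) (· = BitVec.ofNat w (rankIn S s₀)) 12 := by
  unfold left
  refine (spec_markerRank hE h.pre_bits_mem_markers).bind_eq ?_
  rw [h₀.rankIn_pre_bits (h.name_le.trans h.le_width)]
  exact spec_clamp hE h₀.mem

theorem spec_right_total (hE : E.IsFor S) (hS : S.Nonempty) (p : BitVec w × BitVec w) :
    Spec E (right p) (IsIndex E S) 21 := by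
  unfold right
  refine (spec_lit 1).bind_eq ?_
  refine spec_width.bind_eq ?_
  refine (spec_op _ _ _).bind_eq ?_
  refine (spec_op _ _ _).bind_eq ?_
  refine (spec_op _ _ _).bind_eq ?_
  refine (spec_lit 0).bind_eq ?_
  refine (spec_test _ _ _).bind_eq ?_
  refine .ite (fun _ => ?_) (fun _ => ?_)
  · exact spec_last.mono (fun r hr => hr ▸ hE.isIndex_last hS) (by norm_num)
  · refine (spec_markerRank_total _).bind fun _ _ => ?_
    refine (spec_lit 1).bind_eq ?_
    refine (spec_op _ _ _).bind_eq ?_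
    exact spec_clamp_total hE hS _

theorem spec_right (hE : E.IsFor S) (hw : 1 ≤ w) (h : Skip S s a l) {s₁ : BitVec w}
    (h₁ : IsLast S s a s₁) :
    Spec E (right (pre s a).enc) (· = BitVec.ofNat w (rankIn S s₁)) 21 := by
  have ha := h.name_le.trans h.le_width
  unfold right
  refine (spec_lit 1).bind_eq ?_
  refine spec_width.bind_eq ?_
  refine (spec_op _ _ _).bind_eq ?_
  refine (spec_op _ _ _).bind_eq ?_
  refine (spec_op _ _ _).bind_eq ?_
  refine (spec_lit 0).bind_eq ?_
  refine (spec_test _ _ _).bind_eq ?_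
  simp only [Op.eval, Cmp.eval, Str.enc, pre_len, decide_eq_true_eq, ofNat_sub_ofNat ha,
    toNat_ofNat_of_le (Nat.sub_le w a)]
  refine .ite (fun h0 => ?_) (fun h0 => ?_)
  · refine spec_last.mono (fun r hr => ?_) (by norm_num)
    rw [hr, hE.length_array, h₁.card_eq hw ha h0, Nat.add_sub_cancel]
  · refine (spec_markerRank hE (h.nextBits_mem_markers h0)).bind_eq ?_
    refine (spec_lit 1).bind_eq ?_
    refine (spec_op _ _ _).bind_eq ?_
    rw [h₁.rankIn_nextBits hw ha h0, Op.eval, ofNat_sub_ofNat (by omega), Nat.add_sub_cancel]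
    exact spec_clamp hE h₁.mem

/-- `e` represents the extent of a node of the trie. -/
def IsExtent (S : Finset (BitVec w)) (e : BitVec w × BitVec w) : Prop :=
  ∃ s ∈ S, ∃ t ∈ S, e = (pre s (common s t)).enc

theorem Skip.isFirst_isLast (h : Skip S s a l) :
    ∃ s₀ s₁, IsFirst S s a s₀ ∧ IsLast S s a s₁ ∧ pre s₀ (common s₀ s₁) = pre s l := by
  have has : a ≤ common s s := by rw [common_self]; exact h.name_le.trans h.le_width
  obtain ⟨s₀, h₀⟩ := exists_isFirst h.mem has
  obtain ⟨s₁, h₁⟩ := exists_isLast h.mem has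
  refine ⟨s₀, s₁, h₀, h₁, ?_⟩
  rw [h.common_first_last h₀ h₁, h.pre_eq h₀.mem h₀.le_common]

theorem spec_extent_total (hE : E.IsFor S) (hS : S.Nonempty) (p : BitVec w × BitVec w) :
    Spec E (extent p) (IsExtent S) 46 := by
  unfold extent
  refine (spec_left_total hE hS p).bind fun i ⟨s, hs, hi⟩ => ?_
  refine (spec_read hi).bind_eq ?_
  refine (spec_right_total hE hS p).bind fun j ⟨t, ht, hj⟩ => ?_
  refine (spec_read hj).bind_eq ?_
  exact (spec_lcp s t).mono (fun e he => ⟨s, hs, t, ht, he⟩) le_rfl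

theorem spec_extent (hE : E.IsFor S) (hw : 1 ≤ w) (h : Skip S s a l) :
    Spec E (extent (pre s a).enc) (· = (pre s l).enc) 46 := by
  obtain ⟨s₀, s₁, h₀, h₁, he⟩ := h.isFirst_isLast
  unfold extent
  refine (spec_left hE h h₀).bind_eq ?_
  refine (spec_read (hE.array_rankIn h₀.mem)).bind_eq ?_
  refine (spec_right hE hw h h₁).bind_eq ?_
  refine (spec_read (hE.array_rankIn h₁.mem)).bind_eq ?_
  rw [← he]
  exact spec_lcp s₀ s₁

theorem spec_rootExtent (hE : E.IsFor S) (h : Skip S s 0 l) :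
    Spec E rootExtent (· = (pre s l).enc) 15 := by
  obtain ⟨s₀, s₁, h₀, h₁, he⟩ := h.isFirst_isLast
  have r₀ : rankIn S s₀ = 0 := by
    rw [rankIn, Finset.card_eq_zero, Finset.filter_eq_empty_iff]
    exact fun t ht => not_lt.2 (h₀.le t ht (Nat.zero_le _))
  have r₁ := card_eq_rankIn_succ h₁.mem fun t ht => h₁.le t ht (Nat.zero_le _)
  have a₀ := hE.array_rankIn h₀.mem
  have a₁ := hE.array_rankIn h₁.mem
  unfold rootExtent
  refine (spec_lit 0).bind_eq ?_
  rw [← r₀]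
  refine (spec_read a₀).bind_eq ?_
  refine spec_last.bind_eq ?_
  rw [hE.length_array, r₁, Nat.add_sub_cancel]
  refine (spec_read a₁).bind_eq ?_
  rw [← he]
  exact spec_lcp s₀ s₁

theorem exists_root (hS : S.Nonempty) : ∃ s l, Skip S s 0 l := by
  obtain ⟨s, hs⟩ := hS
  obtain ⟨a, l, h, ha, -⟩ := exists_skip hs (Nat.zero_le w)
  obtain rfl := Nat.le_zero.1 ha
  exact ⟨s, l, h⟩

theorem Skip.isExtent (h : Skip S s a l) : IsExtent S (pre s l).enc := by
  obtain ⟨t, ht, rfl⟩ := h.branch_exists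
  exact ⟨s, h.mem, t, ht, rfl⟩

theorem spec_zfast_total (hE : E.IsFor S) (hS : S.Nonempty)
    (p : BitVec w × BitVec w) : Spec E (zfast p) (IsExtent S) 54 := by
  unfold zfast
  refine (spec_look _ _).bind_eq ?_
  refine (spec_cut_total _ _).bind fun q _ => ?_
  refine (spec_left_total hE hS q).bind fun i ⟨s, hs, hi⟩ => ?_
  refine (spec_right_total hE hS q).bind fun j ⟨t, ht, hj⟩ => ?_
  refine (spec_test _ _ _).bind_eq ?_
  refine .ite (fun _ => ?_) (fun _ => ?_)
  · obtain ⟨s, l, h⟩ := exists_root hS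
    exact (spec_rootExtent hE h).mono (fun e he => he ▸ h.isExtent) le_rfl
  · refine (spec_read hi).bind_eq ?_
    refine (spec_read hj).bind_eq ?_
    exact (spec_lcp s t).mono (fun e he => ⟨s, hs, t, ht, he⟩) (by norm_num)

/-- On the handle of an internal node, `T` returns the extent of the node. -/
theorem spec_zfast (hE : E.IsFor S) (hw : 1 ≤ w) (h : Skip S s a l) (hl : l < w) {f : ℕ}
    (hf : handle S (pre s l) = pre s f) (haf : a ≤ f) (hfw : f ≤ w) :
    Spec E (zfast (pre s f).enc) (· = (pre s l).enc) 54 := by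
  obtain ⟨s₀, s₁, h₀, h₁, he⟩ := h.isFirst_isLast
  have hdom : pre s f ∈ (index S .handle).dom :=
    Finset.mem_image.2 ⟨pre s l, h.mem_internalNodes_iff.2 hl, hf⟩
  unfold zfast
  refine (hE.look hdom hfw).bind_eq ?_
  have hval : (index S .handle).val (pre s f) = a := by
    rw [← hf]
    exact h.handle_val hl
  rw [hval]
  refine (spec_cut _ (haf.trans hfw)).bind_eq ?_
  rw [show pre (pre s f).enc.1 a = pre s a from pre_pre_bits s haf hfw]
  refine (spec_left hE h h₀).bind_eq ?_
  refine (spec_right hE hw h h₁).bind_eq ?_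
  refine (spec_test _ _ _).bind_eq ?_
  simp only [Cmp.eval, decide_eq_true_eq]
  refine .ite (fun heq => ?_) (fun _ => ?_)
  · rw [ofNat_eq_ofNat (rankIn_lt_two_pow _ _) (rankIn_lt_two_pow _ _)] at heq
    have h01 := rankIn_injOn h₀.mem h₁.mem heq
    have hc := h.common_first_last h₀ h₁
    rw [h01, common_self] at hc
    omega
  · refine (spec_read (hE.array_rankIn h₀.mem)).bind_eq ?_
    refine (spec_read (hE.array_rankIn h₁.mem)).bind_eq ?_
    rw [← he]
    exact (spec_lcp s₀ s₁).mono (fun _ h => h) (by norm_num)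

end Locator

/-! ### The predecessor, given the name of the exit node -/

section Pred

variable {w : ℕ} {S : Finset (BitVec w)} {E : Env w} {s x : BitVec w} {a b l : ℕ}

/-- `[a..l]` is the skip interval of the exit node of `x`, which is an ancestor of `s`. -/
structure IsExitSkip (S : Finset (BitVec w)) (x s : BitVec w) (a l : ℕ) : Prop where
  skip : Skip S s a l
  le_common : a ≤ common x s
  common_lt : common x s < l ∨ l = w

/-- The order of two strings is decided by their first differing bit. -/
theorem bit_eq_zero_iff_lt {y : BitVec w} (h : common x y < w) :
    x.toNat / 2 ^ (w - 1 - common x y) % 2 = 0 ↔ x < y := by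
  have h₁ := (le_common_iff_div x y h.le).1 le_rfl
  have h₂ := mt (le_common_iff_div x y (l := common x y + 1) h).2 (by omega)
  rw [div_two_pow_succ_sub _ h, div_two_pow_succ_sub _ h] at h₁
  rw [show w - 1 - common x y = w - (common x y + 1) by omega, BitVec.lt_def]
  constructor
  · intro h0
    by_contra! hle
    have := Nat.div_le_div_right (c := 2 ^ (w - (common x y + 1))) hle
    omega
  · intro hlt
    have := Nat.div_le_div_right (c := 2 ^ (w - (common x y + 1))) hlt.le
    omega

theorem spec_pred (hE : E.IsFor S) (hw : 1 ≤ w) (h : IsExitSkip S x s a l) :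
    Spec E (pred x (BitVec.ofNat w a)) (IsPredIndex S x) 85 := by
  obtain ⟨h, hax, hxl⟩ := h
  have haw := h.name_le.trans h.le_width
  obtain ⟨s₀, s₁, h₀, h₁, -⟩ := h.isFirst_isLast
  have hleft : rankIn S x = rankIn S s₀ →
      Spec E (left (pre s a).enc >>= fun i => Code.lit 1 >>= fun o => Code.op .sub i o)
        (IsPredIndex S x) 14 := by
    intro hr
    refine (spec_left hE h h₀).bind_eq ?_
    refine (spec_lit 1).bind_eq ?_
    refine (spec_op _ _ _).mono (fun r hr' => ?_) le_rfl
    rw [hr', ← hr]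
    exact isPredIndex_rankIn S x
  unfold pred
  refine (spec_cut x haw).bind_eq ?_
  rw [(pre_eq_pre_iff x s haw).2 hax]
  refine (spec_extent hE hw h).bind_eq ?_
  refine spec_width.bind_eq ?_
  rw [enc_full]
  refine (spec_isPrefix x s le_rfl h.le_width).bind_eq ?_
  refine .ite (fun hx => ?_) (fun hx => ?_)
  · rw [decide_eq_true_eq, le_common_iff_eq] at hx
    obtain ⟨hwl, rfl⟩ := hx
    obtain rfl := (le_common_iff_eq _ _).1 (hwl.trans (h.gap _ h₀.mem h₀.le_common))
    exact (hleft rfl).mono (fun _ h => h) (by norm_num)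
  · rw [decide_eq_true_eq] at hx
    have hlt : common x s < l := by
      have := common_le x s
      omega
    have hlw := hlt.trans_le h.le_width
    have hc : common x (pre s l).bits = common x s := by
      refine common_eq_of_lt (hlt.trans_le ?_)
      rw [common_comm]
      exact le_common_pre_bits s h.le_width
    have hlog := (log_xor_eq (x := x) (y := (pre s l).bits)
      ((common_lt_iff_ne _ _).1 (hc ▸ hlw))).1
    refine (spec_op _ _ _).bind_eq ?_
    refine (spec_msb _).bind_eq ?_
    refine (spec_op _ _ _).bind_eq ?_
    refine (spec_lit 1).bind_eq ?_
    refine (spec_op _ _ _).bind_eq ?_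
    refine (spec_lit 0).bind_eq ?_
    refine (spec_test _ _ _).bind_eq ?_
    have hbit : (x >>> (w - 1 - common x s)) &&& BitVec.ofNat w 1 = BitVec.ofNat w 0 ↔ x < s := by
      rw [← bit_eq_zero_iff_lt hlw, ← BitVec.toNat_inj, BitVec.toNat_and, toNat_ofNat_of_le hw,
        toNat_ofNat_of_le (Nat.zero_le w), BitVec.toNat_ushiftRight, Nat.and_one_is_mod,
        Nat.shiftRight_eq_div_pow]
    simp only [Cmp.eval, Op.eval, Str.enc, hlog, hc, decide_eq_true_eq,
      toNat_ofNat_of_le (show w - 1 - common x s ≤ w by omega), hbit]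
    refine .ite (fun hxs => ?_) (fun hxs => ?_)
    · exact (hleft (h.rankIn_eq_of_lt h₀ hax hlt hxs)).mono (fun _ h => h) (by norm_num)
    · have hne : x ≠ s := (common_lt_iff_ne x s).1 hlw
      have hr := h.rankIn_eq_of_gt h₁ hax hlt (lt_of_le_of_ne (not_lt.1 hxs) hne.symm)
      refine (spec_right hE hw h h₁).mono (fun r hr' => ?_) le_rfl
      have := isPredIndex_rankIn S x
      rwa [hr, ofNat_sub_ofNat (by omega), Nat.add_sub_cancel, ← hr'] at this

/-! ### Fat binary search -/

/-- `l` is the length of the extent of an internal node, and the extent is a prefix of `x`. -/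
def IsAncestorLen (S : Finset (BitVec w)) (x : BitVec w) (l : ℕ) : Prop :=
  l < w ∧ ∃ s ∈ S, ∃ t ∈ S, common s t = l ∧ l ≤ common x s

theorem exists_isExitSkip_zero (hS : S.Nonempty) (h0 : ∀ l, ¬ IsAncestorLen S x l) :
    ∃ s l, IsExitSkip S x s 0 l := by
  obtain ⟨s, l, h⟩ := exists_root hS
  refine ⟨s, l, h, Nat.zero_le _, ?_⟩
  by_contra! hne
  have hl := lt_of_le_of_ne h.le_width hne.2
  obtain ⟨t, ht, e⟩ := h.branch hl
  exact h0 l ⟨hl, s, h.mem, t, ht, e, hne.1⟩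

/-- The exit node is a child of the deepest internal node whose extent is a prefix of `x`. -/
theorem IsAncestorLen.exists_isExitSkip (ha : IsAncestorLen S x a)
    (hmax : ∀ l, IsAncestorLen S x l → l ≤ a) : ∃ s l, IsExitSkip S x s (a + 1) l := by
  obtain ⟨haw, s, hs, t, ht, hst, hxs⟩ := ha
  obtain ⟨u, hu, v, hv, huv, hxu⟩ : ∃ u ∈ S, ∃ v ∈ S, common u v = a ∧ a < common x u := by
    rcases hxs.lt_or_eq with h | h
    · exact ⟨s, hs, t, ht, hst, h⟩
    · exact ⟨t, ht, s, hs, by rw [common_comm, hst], lt_common_of_eq haw h.symm hst⟩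
  obtain ⟨a', l, h, h₁, h₂⟩ := exists_skip hu haw
  have ha' : a' = a + 1 := by
    by_contra hne
    have := h.gap v hv (by omega)
    omega
  subst ha'
  refine ⟨u, l, h, hxu, ?_⟩
  by_contra! hne
  have hl := lt_of_le_of_ne h.le_width hne.2
  obtain ⟨z, hz, e⟩ := h.branch hl
  have := hmax l ⟨hl, u, hu, z, hz, e, hne.1⟩
  omega

/-- `g` is the multiple of `2 ^ m` in `(a..b)`, where `m` is the position of the most significant
bit at which `a` and `b - 1` differ. -/
structure IsSplit (a b g m : ℕ) : Prop where
  eq : g = (b - 1) / 2 ^ m * 2 ^ m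
  above : a / 2 ^ (m + 1) = (b - 1) / 2 ^ (m + 1)
  lt : a / 2 ^ m < (b - 1) / 2 ^ m

theorem IsSplit.left_lt {g m : ℕ} (h : IsSplit a b g m) : a < g := by
  rw [h.eq, ← Nat.div_lt_iff_lt_mul (by positivity)]
  exact h.lt

theorem IsSplit.lt_right {g m : ℕ} (h : IsSplit a b g m) (hab : a < b) : g < b := by
  have := Nat.div_mul_le_self (b - 1) (2 ^ m)
  rw [← h.eq] at this
  omega

theorem allOnes_shiftLeft_and (r : BitVec w) (m : ℕ) :
    (~~~BitVec.ofNat w 0 <<< m) &&& r = (r >>> m) <<< m := by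
  ext i hi
  by_cases h : i < m
  · simp [h]
  · simp [h, hi, Nat.add_sub_cancel' (not_lt.1 h), BitVec.getLsbD_eq_getElem]

theorem spec_fattestBetween (hab : a + 1 < b) (hb : b ≤ w) :
    Spec E (fattestBetween (BitVec.ofNat w a) (BitVec.ofNat w b))
      (fun r => ∃ g m, IsSplit a b g m ∧ r = BitVec.ofNat w g) 8 := by
  have htA : (BitVec.ofNat w a).toNat = a := toNat_ofNat_of_le (by omega)
  have htR : (BitVec.ofNat w (b - 1)).toNat = b - 1 := toNat_ofNat_of_le (by omega)
  set A := BitVec.ofNat w a with hA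
  set R := BitVec.ofNat w (b - 1) with hR
  have hne : A ≠ R := fun h => by rw [h] at htA; omega
  obtain ⟨hlog, hlt⟩ := log_xor_eq hne
  unfold fattestBetween
  refine (spec_lit 1).bind_eq ?_
  refine (spec_op _ _ _).bind_eq ?_
  refine (spec_op _ _ _).bind_eq ?_
  refine (spec_msb _).bind_eq ?_
  refine (spec_lit 0).bind_eq ?_
  refine (spec_not _).bind_eq ?_
  refine (spec_op _ _ _).bind_eq ?_
  refine (spec_op _ _ _).mono (fun r hr => ?_) le_rfl
  simp only [Op.eval] at hr
  rw [ofNat_sub_ofNat (by omega), ← hR, hlog,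
    toNat_ofNat_of_le (show w - 1 - common A R ≤ w by omega), allOnes_shiftLeft_and] at hr
  have h₁ := (le_common_iff_div A R hlt.le).1 le_rfl
  have h₂ := mt (le_common_iff_div A R (l := common A R + 1) hlt).2 (by omega)
  rw [htA, htR, show w - common A R = w - 1 - common A R + 1 by omega] at h₁
  rw [htA, htR, show w - (common A R + 1) = w - 1 - common A R by omega] at h₂
  refine ⟨_, _, ⟨rfl, h₁, lt_of_le_of_ne (Nat.div_le_div_right (by omega)) h₂⟩, ?_⟩
  rw [hr]
  refine BitVec.eq_of_toNat_eq ?_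
  rw [toNat_ofNat_of_le ((Nat.div_mul_le_self _ _).trans (by omega)), BitVec.toNat_shiftLeft,
    BitVec.toNat_ushiftRight, Nat.shiftLeft_eq, Nat.shiftRight_eq_div_pow, htR]
  exact Nat.mod_eq_of_lt ((Nat.div_mul_le_self _ _).trans_lt (htR ▸ R.isLt))

/-- The potential of the search decreases at each iteration; moreover, after the first iteration it
is bounded by the logarithm of the length of the interval. -/
theorem IsSplit.potential {g m K a' b' : ℕ} (h : IsSplit a b g m) (hab : a < b)
    (hK : a / 2 ^ (K + 1) = (b - 1) / 2 ^ (K + 1) ∨ b - a ≤ 2 ^ K)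
    (h' : a' = a ∧ b' = g ∨ g ≤ a' ∧ b' = b ∧ a' < b) : a' / 2 ^ K = (b' - 1) / 2 ^ K := by
  have hag := h.left_lt
  have hgb := h.lt_right hab
  -- `a` and `b - 1` are within a distance of `2 ^ k` from `g`, which is a multiple of `2 ^ k`
  obtain ⟨k, hkK, c, hc, h₁, h₂⟩ : ∃ k ≤ K, ∃ c, g = c * 2 ^ k ∧ g ≤ a + 2 ^ k ∧
      b - 1 < g + 2 ^ k := by
    by_cases hm : m ≤ K
    · refine ⟨m, hm, _, h.eq, ?_, ?_⟩
      · have h3 := h.above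
        have h4 := h.lt
        rw [pow_succ, ← Nat.div_div_eq_div_mul, ← Nat.div_div_eq_div_mul] at h3
        rw [h.eq, show (b - 1) / 2 ^ m = a / 2 ^ m + 1 by omega, add_mul, one_mul]
        exact Nat.add_le_add_right (Nat.div_mul_le_self _ _) _
      · rw [h.eq, ← Nat.add_one_mul]
        rw [← Nat.div_lt_iff_lt_mul (by positivity)]
        exact Nat.lt_succ_self _
    · have hd : b - a ≤ 2 ^ K := by
        refine hK.resolve_left fun he => ?_
        have hd := congrArg (· / 2 ^ (m - (K + 1))) he
        simp only [Nat.div_div_eq_div_mul, ← pow_add] at hd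
        rw [show K + 1 + (m - (K + 1)) = m by omega] at hd
        exact h.lt.ne hd
      refine ⟨K, le_rfl, (b - 1) / 2 ^ m * 2 ^ (m - K), ?_, by omega, by omega⟩
      rw [h.eq, mul_assoc, ← pow_add]
      congr 2
      omega
  have key : a' / 2 ^ k = (b' - 1) / 2 ^ k := by
    have hdiv : ∀ {q y : ℕ}, q * 2 ^ k ≤ y → y < q * 2 ^ k + 2 ^ k → y / 2 ^ k = q :=
      fun h₁ h₂ => Nat.div_eq_of_lt_le h₁ (by rw [add_mul, one_mul]; exact h₂)
    rcases h' with ⟨rfl, rfl⟩ | ⟨h3, rfl, h4⟩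
    · obtain ⟨q, rfl⟩ : ∃ q, c = q + 1 := ⟨c - 1, by
        have : c ≠ 0 := by rintro rfl; omega
        omega⟩
      rw [add_mul, one_mul] at hc
      rw [hdiv (q := q) (by omega) (by omega), hdiv (q := q) (by omega) (by omega)]
    · rw [hdiv (q := c) (by omega) (by omega), hdiv (q := c) (by omega) (by omega)]
  have := congrArg (· / 2 ^ (K - k)) key
  simp only [Nat.div_div_eq_div_mul, ← pow_add] at this
  rwa [Nat.add_sub_cancel' hkK] at this

/-- The state of the search: all internal nodes whose extents are prefixes of `x` have extents
shorter than `b`, and `a` is the length of one of them, or `0`. -/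
structure FbsInv (S : Finset (BitVec w)) (x : BitVec w) (a b : ℕ) : Prop where
  anc : a = 0 ∨ IsAncestorLen S x a
  lt : a < b
  le_width : b ≤ w
  bound : ∀ l, IsAncestorLen S x l → l < b

/-- If there is an internal node whose extent is a prefix of `x` not shorter than `g`, then
`x[0..g)` is a handle, because the skip interval containing `g` lies between `a` and `b`; thus `T`
returns such an extent. -/
theorem spec_zfast_pre (hE : E.IsFor S) (hw : 1 ≤ w) (hS : S.Nonempty) (hI : FbsInv S x a b)
    {g m : ℕ} (hg : IsSplit a b g m) :
    Spec E (zfast (pre x g).enc) (fun e => ∃ s ∈ S, ∃ t ∈ S, e = (pre s (common s t)).enc ∧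
      ((∃ l, IsAncestorLen S x l ∧ g ≤ l) →
        g ≤ common s t ∧ common s t < w ∧ common s t ≤ common x s)) 54 := by
  by_cases hl : ∃ l, IsAncestorLen S x l ∧ g ≤ l
  · obtain ⟨l, hl, hgl⟩ := hl
    have hlb := hI.bound l hl
    obtain ⟨hlw, s, hs, t, ht, hst, hxs⟩ := hl
    obtain ⟨a', l', h, ha', hl'⟩ := exists_skip hs (hgl.trans hlw.le)
    have hag := hg.left_lt
    have hle : l' ≤ l := by
      rw [← hst]
      exact h.gap t ht (by omega)
    have haa : a ≤ a' - 1 := by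
      rcases hI.anc with rfl | ⟨-, s', hs', t', ht', hst', hxs'⟩
      · exact Nat.zero_le _
      · have hss : a ≤ common s s' :=
          le_common_trans (y := x) (by rw [common_comm]; omega) hxs'
        obtain ⟨u, hu, hsu⟩ : ∃ u ∈ S, common s u = a := by
          rcases hss.lt_or_eq with h3 | h3
          · refine ⟨t', ht', ?_⟩
            rw [common_comm, common_eq_of_lt (y := s')] <;> rw [common_comm t' s', hst']
            rwa [common_comm]
          · exact ⟨s', hs', h3.symm⟩
        by_contra! hlt
        have := h.gap u hu (by omega)
        omega
    have hfat : fattest (a' - 1) l' = g := by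
      rw [hg.eq]
      refine fattest_of_split hg.above hg.lt haa (by omega) ?_
      rw [← hg.eq, Finset.mem_Ioc]
      omega
    rw [(pre_eq_pre_iff x s (hgl.trans hlw.le)).2 (hgl.trans hxs)]
    refine (spec_zfast hE hw h (by omega) (h.handle_eq hfat hl') ha' (by omega)).mono
      (fun e he => ?_) le_rfl
    obtain ⟨u, hu, hsu⟩ := h.branch_exists
    exact ⟨s, hs, u, hu, by rw [hsu]; exact he, fun _ => by omega⟩
  · refine (spec_zfast_total hE hS _).mono (fun e ⟨s, hs, t, ht, he⟩ => ?_) le_rfl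
    exact ⟨s, hs, t, ht, he, fun h => absurd h hl⟩

/-- The body of the loop of the fat binary search. -/
def fbsBody {V : Type} (x : V) (s : V × V) : Code V ((V × V) ⊕ V) := do
  let a := s.1
  let b := s.2
  if ← .test .lt (← .lit 1) (← .op .sub b a) then
    let f ← fattestBetween a b
    let e ← zfast (← cut x f)
    if (← .test .le f e.2) && (← isProperPrefix e (x, ← .width)) then
      return Sum.inl (e.2, b)
    else
      return Sum.inl (a, f)
  else
    return Sum.inr a

theorem spec_fbsBody (hE : E.IsFor S) (hw : 1 ≤ w) (hS : S.Nonempty) (hI : FbsInv S x a b)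
    (hab : a + 1 < b) :
    Spec E (fbsBody x (BitVec.ofNat w a, BitVec.ofNat w b))
      (fun r => ∃ g m a' b', IsSplit a b g m ∧ FbsInv S x a' b' ∧
        (a' = a ∧ b' = g ∨ g ≤ a' ∧ b' = b ∧ a' < b) ∧
        r = Sum.inl (BitVec.ofNat w a', BitVec.ofNat w b')) 78 := by
  have hbw := hI.le_width
  unfold fbsBody
  refine (spec_lit 1).bind_eq ?_
  refine (spec_sub hI.lt.le).bind_eq ?_
  refine (spec_test_lt (lt_two_pow_of_le hw) (lt_two_pow_of_le (by omega))).bind_eq ?_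
  simp only [decide_eq_true_eq]
  refine .ite (fun _ => ?_) (fun h => absurd (by omega) h)
  refine (spec_fattestBetween hab hbw).bind fun f ⟨g, m, hg, hf⟩ => ?_
  subst hf
  have hag := hg.left_lt
  have hgb := hg.lt_right hI.lt
  refine (spec_cut x (by omega)).bind_eq ?_
  refine (spec_zfast_pre hE hw hS hI hg).bind fun e ⟨s, hs, t, ht, he, hbig⟩ => ?_
  subst he
  have hst := common_le s t
  refine (spec_test _ _ _).bind_eq ?_
  refine spec_width.bind_eq ?_
  rw [enc_full]
  refine (spec_isProperPrefix s x hst le_rfl).bind_eq ?_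
  simp only [Cmp.eval, Str.enc, pre_len, ofNat_le_ofNat (show g ≤ w by omega) hst,
    Bool.and_eq_true, decide_eq_true_eq]
  refine .ite (fun h => ?_) (fun h => ?_)
  · refine .pure ⟨g, m, common s t, b, hg, ?_, ?_, rfl⟩
    all_goals
      have hanc : IsAncestorLen S x (common s t) :=
        ⟨h.2.1, s, hs, t, ht, rfl, by rw [common_comm x]; exact h.2.2⟩
      have hlt := hI.bound _ hanc
    · exact ⟨Or.inr hanc, hlt, hbw, hI.bound⟩
    · exact Or.inr ⟨h.1, rfl, hlt⟩
  · refine .pure ⟨g, m, a, g, hg, ⟨hI.anc, hag, by omega, fun l hl => ?_⟩, Or.inl ⟨rfl, rfl⟩, rfl⟩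
    by_contra! hle
    obtain ⟨h₁, h₂, h₃⟩ := hbig ⟨l, hl, hle⟩
    exact h ⟨h₁, h₂, by rw [common_comm s x]; exact h₃⟩

theorem spec_fbsBody_end (hw : 1 ≤ w) (hI : FbsInv S x a b) (hab : ¬ a + 1 < b) :
    Spec E (fbsBody x (BitVec.ofNat w a, BitVec.ofNat w b)) (· = Sum.inr (BitVec.ofNat w a)) 3 := by
  have hbw := hI.le_width
  unfold fbsBody
  refine (spec_lit 1).bind_eq ?_
  refine (spec_sub hI.lt.le).bind_eq ?_
  refine (spec_test_lt (lt_two_pow_of_le hw) (lt_two_pow_of_le (by omega))).bind_eq ?_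
  simp only [decide_eq_true_eq]
  exact .ite (fun h => absurd (by omega) hab) (fun _ => .pure rfl)

/-- The outcome of the loop of the fat binary search: the length of the longest extent of an
internal node that is a prefix of `x` (`0` if there is none). -/
def IsDeepest (S : Finset (BitVec w)) (x r : BitVec w) : Prop :=
  ∃ a < w, r = BitVec.ofNat w a ∧ (a = 0 ∨ IsAncestorLen S x a) ∧
    ∀ l, IsAncestorLen S x l → l ≤ a

theorem FbsInv.isDeepest (hI : FbsInv S x a b) (hab : ¬ a + 1 < b) :
    IsDeepest S x (BitVec.ofNat w a) := by
  have := hI.lt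
  have := hI.le_width
  exact ⟨a, by omega, rfl, hI.anc, fun l hl => by have := hI.bound l hl; omega⟩

/-- If `a` and `b - 1` agree but for the lowest `k` bits, there are at most `k + 1` iterations, each
of which takes at most `79` steps. -/
theorem loopSpec_fbsBody_of_potential (hE : E.IsFor S) (hw : 1 ≤ w) (hS : S.Nonempty) (k : ℕ) :
    ∀ {a b : ℕ}, FbsInv S x a b → a / 2 ^ k = (b - 1) / 2 ^ k →
      LoopSpec E (fbsBody x) (BitVec.ofNat w a, BitVec.ofNat w b) (IsDeepest S x)
        ((k + 1) * 79) := by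
  induction k with
  | zero =>
    intro a b hI hk
    rw [pow_zero, Nat.div_one, Nat.div_one] at hk
    have hab : ¬ a + 1 < b := by omega
    refine (LoopSpec.step (n := 0) ((spec_fbsBody_end hw hI hab).mono ?_ le_rfl)).mono
      (fun _ h => h) (by norm_num)
    rintro _ rfl
    exact hI.isDeepest hab
  | succ k ih =>
    intro a b hI hk
    by_cases hab : a + 1 < b
    · refine (LoopSpec.step (n := (k + 1) * 79)
        ((spec_fbsBody hE hw hS hI hab).mono ?_ le_rfl)).mono (fun _ h => h) (by omega)
      rintro _ ⟨g, m, a', b', hg, hI', h', rfl⟩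
      exact ih hI' (hg.potential hI.lt (Or.inl hk) h')
    · refine (LoopSpec.step (n := 0) ((spec_fbsBody_end hw hI hab).mono ?_ le_rfl)).mono
        (fun _ h => h) (by omega)
      rintro _ rfl
      exact hI.isDeepest hab

/-- The first iteration brings the potential down to `K`, whatever it was at the beginning. -/
theorem loopSpec_fbsBody (hE : E.IsFor S) (hw : 1 ≤ w) (hS : S.Nonempty) {K : ℕ}
    (hI : FbsInv S x a b) (hK : b - a ≤ 2 ^ K) :
    LoopSpec E (fbsBody x) (BitVec.ofNat w a, BitVec.ofNat w b) (IsDeepest S x)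
      ((K + 2) * 79) := by
  by_cases hab : a + 1 < b
  · refine (LoopSpec.step (n := (K + 1) * 79)
      ((spec_fbsBody hE hw hS hI hab).mono ?_ le_rfl)).mono (fun _ h => h) (by omega)
    rintro _ ⟨g, m, a', b', hg, hI', h', rfl⟩
    exact loopSpec_fbsBody_of_potential hE hw hS K hI' (hg.potential hI.lt (Or.inr hK) h')
  · refine (LoopSpec.step (n := 0) ((spec_fbsBody_end hw hI hab).mono ?_ le_rfl)).mono
      (fun _ h => h) (by omega)
    rintro _ rfl
    exact hI.isDeepest hab

theorem spec_fatBinarySearch (hE : E.IsFor S) (hw : 1 ≤ w) (hS : S.Nonempty) {K : ℕ}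
    (hI : FbsInv S x a b) (hK : b - a ≤ 2 ^ K) :
    Spec E (fatBinarySearch x (BitVec.ofNat w a) (BitVec.ofNat w b))
      (fun r => ∃ s a' l, IsExitSkip S x s a' l ∧ r = BitVec.ofNat w a')
      (20 + (K + 2) * 79) := by
  unfold fatBinarySearch
  refine Spec.bind (Spec.loop (loopSpec_fbsBody hE hw hS hI hK)) ?_
  rintro _ ⟨d, hdw, rfl, hd, hmax⟩
  obtain ⟨s₀, r, hr⟩ := exists_root hS
  refine (spec_lit 0).bind_eq ?_
  refine (spec_rootExtent hE hr).bind_eq ?_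
  refine (spec_test _ _ _).bind_eq ?_
  refine (spec_test _ _ _).bind_eq ?_
  simp only [Cmp.eval, Str.enc, pre_len, ofNat_eq_ofNat (lt_two_pow_of_le hdw.le) (lt_two_pow_of_le (Nat.zero_le w)),
    ofNat_eq_ofNat (lt_two_pow_of_le hr.le_width) (lt_two_pow_of_le (Nat.zero_le w)), Bool.and_eq_true,
    Bool.not_eq_true', decide_eq_true_eq, decide_eq_false_iff_not]
  refine .ite (fun h => ?_) (fun h => ?_)
  · obtain ⟨rfl, hr0⟩ := h
    have hnone : ∀ l, ¬ IsAncestorLen S x l := by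
      intro l hl
      obtain rfl := Nat.le_zero.1 (hmax l hl)
      obtain ⟨-, s, hs, t, ht, hst, -⟩ := hl
      have := (hr.transfer hs (Nat.zero_le _)).gap t ht (Nat.zero_le _)
      omega
    obtain ⟨s, l, h⟩ := exists_isExitSkip_zero hS hnone
    exact .pure ⟨s, 0, l, h, rfl⟩
  · have hanc : IsAncestorLen S x d := by
      rcases hd with rfl | hd
      · obtain rfl : r = 0 := by
          by_contra hr0
          exact h ⟨rfl, hr0⟩
        obtain ⟨t, ht, e⟩ := hr.branch hdw
        exact ⟨hdw, s₀, hr.mem, t, ht, e, Nat.zero_le _⟩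
      · exact hd
    obtain ⟨s, l, h⟩ := hanc.exists_isExitSkip hmax
    refine (spec_lit 1).bind_eq ?_
    refine (spec_op _ _ _).mono (fun r hr => ⟨s, d + 1, l, h, ?_⟩) le_rfl
    rw [hr, Op.eval, ← BitVec.ofNat_add]

theorem spec_fbsPred (hE : E.IsFor S) (hw : 1 ≤ w) (hS : S.Nonempty) {K : ℕ}
    (hI : FbsInv S x a w) (hK : w - a ≤ 2 ^ K) :
    Spec E (fbsPred x (BitVec.ofNat w a) (BitVec.ofNat w w)) (IsPredIndex S x)
      (85 + (20 + (K + 2) * 79)) := by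
  unfold fbsPred
  refine (spec_fatBinarySearch hE hw hS hI hK).bind ?_
  rintro _ ⟨s, a', l, h, rfl⟩
  exact spec_pred hE hw h

end Pred

/-! ### The patched function -/

section Patched

variable {w : ℕ} {S : Finset (BitVec w)} {E : Env w} {s x y : BitVec w} {a i j l : ℕ}

theorem mem_levels : i ∈ levels w ↔ 2 * 2 ^ (2 ^ i) ≤ w := by
  rw [levels, Finset.mem_filter, Finset.mem_range, and_iff_right_iff_imp]
  intro h
  have h1 : i < 2 ^ i := Nat.lt_two_pow_self
  have h2 : 2 ^ i < 2 ^ (2 ^ i) := Nat.lt_two_pow_self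
  omega

theorem mem_levels_of_le {i' : ℕ} (h : i ∈ levels w) (hi : i' ≤ i) : i' ∈ levels w := by
  rw [mem_levels] at h ⊢
  have : 2 ^ (2 ^ i') ≤ 2 ^ (2 ^ i) :=
    Nat.pow_le_pow_right two_pos (Nat.pow_le_pow_right two_pos hi)
  omega

theorem mem_setP {p : Str w} :
    p ∈ setP S ↔ ∃ s ∈ S, ∃ i ∈ levels w, p = pre s (w - 2 ^ (2 ^ i)) := by
  simp only [setP, Finset.mem_biUnion, Finset.mem_image, eq_comm]

/-- The shortest element of `P` in a skip interval is in `Q`. -/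
theorem Skip.exists_mem_setQ (h : Skip S s a l) (hi : i ∈ levels w) (ha : a ≤ w - 2 ^ (2 ^ i))
    (hl : w - 2 ^ (2 ^ i) ≤ l) :
    ∃ i' ∈ levels w, a ≤ w - 2 ^ (2 ^ i') ∧ w - 2 ^ (2 ^ i') ≤ w - 2 ^ (2 ^ i) ∧
      pre s (w - 2 ^ (2 ^ i')) ∈ setQ S := by
  obtain ⟨i', hi', hmin⟩ := Finset.exists_min_image
    ((levels w).filter fun i => a ≤ w - 2 ^ (2 ^ i)) (fun i => w - 2 ^ (2 ^ i))
    ⟨i, Finset.mem_filter.2 ⟨hi, ha⟩⟩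
  rw [Finset.mem_filter] at hi'
  have hle := hmin i (Finset.mem_filter.2 ⟨hi, ha⟩)
  refine ⟨i', hi'.1, hi'.2, hle, Finset.mem_filter.2 ⟨mem_setP.2 ⟨s, h.mem, i', hi'.1, rfl⟩,
    pre s l, h.mem_nodes, ?_, ?_, ?_⟩⟩
  · rw [h.name_eq, pre_isPrefix_pre _ _ (Nat.sub_le _ _), common_self]
    exact ⟨hi'.2, hi'.2.trans (Nat.sub_le _ _)⟩
  · rw [pre_isPrefix_pre _ _ h.le_width, common_self]
    exact ⟨hle.trans hl, Nat.sub_le _ _⟩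
  · intro p hp hnp hpe
    obtain ⟨s', -, k, hk, rfl⟩ := mem_setP.1 hp
    rw [h.name_eq, pre_isPrefix_pre _ _ (Nat.sub_le _ _)] at hnp
    rw [pre_isPrefix_pre _ _ h.le_width] at hpe
    rw [pre_isPrefix_pre _ _ (Nat.sub_le _ _)]
    have := hmin k (Finset.mem_filter.2 ⟨hk, hnp.1⟩)
    exact ⟨this, this.trans (by rw [common_comm]; exact hpe.2)⟩

/-- The second map on an element of `P` yields the level of its longest prefix in `Q`, which is in
the same skip interval. -/
theorem Skip.level_val (h : Skip S s a l) (hi : i ∈ levels w) (ha : a ≤ w - 2 ^ (2 ^ i))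
    (hl : w - 2 ^ (2 ^ i) ≤ l) :
    ∃ i' ∈ levels w, (index S .level).val (pre s (w - 2 ^ (2 ^ i))) = i' ∧
      a ≤ w - 2 ^ (2 ^ i') ∧ w - 2 ^ (2 ^ i') ≤ w - 2 ^ (2 ^ i) ∧
      pre s (w - 2 ^ (2 ^ i')) ∈ setQ S := by
  obtain ⟨i₀, hi₀, ha₀, hle₀, hQ₀⟩ := h.exists_mem_setQ hi ha hl
  have hmem : i₀ ∈ {k | k ∈ levels w ∧ w - 2 ^ (2 ^ k) ≤ (pre s (w - 2 ^ (2 ^ i))).len ∧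
      (pre s (w - 2 ^ (2 ^ i))).take (w - 2 ^ (2 ^ k)) ∈ setQ S} :=
    ⟨hi₀, hle₀, by rwa [pre_take s hle₀ (Nat.sub_le _ _)]⟩
  obtain ⟨h₁, h₂, h₃⟩ := Nat.sInf_mem ⟨i₀, hmem⟩
  have h₄ := Nat.sInf_le hmem
  refine ⟨_, h₁, rfl, ?_, h₂, ?_⟩
  · have := Nat.pow_le_pow_right two_pos (Nat.pow_le_pow_right two_pos h₄)
    omega
  · rwa [pre_take (l := w - 2 ^ (2 ^ i)) s h₂ (Nat.sub_le _ _)] at h₃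

theorem one_shiftLeft_eq (hw : 1 ≤ w) (k : ℕ) : BitVec.ofNat w 1 <<< k = BitVec.ofNat w (2 ^ k) := by
  refine BitVec.eq_of_toNat_eq ?_
  rw [BitVec.toNat_shiftLeft, toNat_ofNat_of_le hw, Nat.shiftLeft_eq, one_mul, BitVec.toNat_ofNat]

theorem spec_tower (hw : 1 ≤ w) (hi : i ∈ levels w) :
    Spec E (tower (BitVec.ofNat w i)) (· = BitVec.ofNat w (2 ^ (2 ^ i))) 3 := by
  rw [mem_levels] at hi
  have h1 : i < 2 ^ i := Nat.lt_two_pow_self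
  have h2 : 2 ^ i < 2 ^ (2 ^ i) := Nat.lt_two_pow_self
  unfold tower
  refine (spec_lit 1).bind_eq ?_
  refine (spec_op _ _ _).bind_eq ?_
  refine (spec_op _ _ _).mono (fun r hr => ?_) le_rfl
  rw [hr]
  simp only [Op.eval]
  rw [toNat_ofNat_of_le (show i ≤ w by omega), one_shiftLeft_eq hw i,
    toNat_ofNat_of_le (show 2 ^ i ≤ w by omega), one_shiftLeft_eq hw]

theorem spec_exitName_total (p : BitVec w × BitVec w) :
    Spec E (exitName p) (fun _ => True) 11 := by
  unfold exitName tower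
  refine (spec_look _ _).bind_eq ?_
  refine spec_width.bind_eq ?_
  refine Spec.bind (m := 3) (Q := fun _ => True) ?_ fun _ _ => ?_
  · refine (spec_lit 1).bind_eq ?_
    refine (spec_op _ _ _).bind_eq ?_
    exact (spec_op _ _ _).mono (fun _ _ => trivial) le_rfl
  · refine (spec_op _ _ _).bind_eq ?_
    refine (spec_cut_total _ _).bind fun _ _ => ?_
    exact (spec_look _ _).mono (fun _ _ => trivial) le_rfl

theorem spec_exitName (hE : E.IsFor S) (hw : 1 ≤ w) (h : Skip S s a l) (hi : i ∈ levels w)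
    (ha : a ≤ w - 2 ^ (2 ^ i)) (hl : w - 2 ^ (2 ^ i) ≤ l) :
    Spec E (exitName (pre s (w - 2 ^ (2 ^ i))).enc) (· = BitVec.ofNat w a) 11 := by
  obtain ⟨i', hi', hval, ha', hle, hQ⟩ := h.level_val hi ha hl
  have hi'w : 2 ^ (2 ^ i') ≤ w := by
    rw [mem_levels] at hi'
    omega
  unfold exitName
  refine (hE.look (f := .level) (mem_setP.2 ⟨s, h.mem, i, hi, rfl⟩) (Nat.sub_le _ _)).bind_eq ?_
  rw [hval]
  refine spec_width.bind_eq ?_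
  refine (spec_tower hw hi').bind_eq ?_
  refine (spec_sub hi'w).bind_eq ?_
  refine (spec_cut _ (Nat.sub_le _ _)).bind_eq ?_
  rw [show pre (pre s (w - 2 ^ (2 ^ i))).enc.1 (w - 2 ^ (2 ^ i')) = pre s (w - 2 ^ (2 ^ i')) from
    pre_pre_bits s hle (Nat.sub_le _ _)]
  refine (hE.look (f := .exitName) hQ (Nat.sub_le _ _)).mono (fun r hr => ?_) le_rfl
  rw [hr]
  exact congrArg _ (h.exitNameLen_eq ha' (hle.trans hl))

/-- No element of `S` is prefixed by `x[0..j)`. -/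
def NoneBelow (S : Finset (BitVec w)) (x : BitVec w) (j : ℕ) : Prop := ∀ t ∈ S, common x t < j

/-- The patched function is defined exactly on the prefixes of elements of `S`, where it returns the
length of the name of the exit node. -/
theorem spec_exitNamePatched (hE : E.IsFor S) (hw : 1 ≤ w) (hS : S.Nonempty) (hi : i ∈ levels w)
    (x : BitVec w) (hj : j = w - 2 ^ (2 ^ i)) :
    Spec E (exitNamePatched (pre x j).enc) (fun r => (r = none ∧ NoneBelow S x j) ∨
      ∃ s a l, r = some (BitVec.ofNat w a) ∧ Skip S s a l ∧ a ≤ j ∧ j ≤ l ∧ j ≤ common x s) 68 := by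
  have hjw : j ≤ w := hj ▸ Nat.sub_le _ _
  unfold exitNamePatched
  by_cases hx : NoneBelow S x j
  · refine (spec_exitName_total _).bind fun t _ => ?_
    refine (spec_test _ _ _).bind_eq ?_
    refine .ite (fun _ => ?_) (fun _ => .pure (Or.inl ⟨rfl, hx⟩))
    refine (spec_cut_total _ _).bind fun q _ => ?_
    refine (spec_extent_total hE hS q).bind ?_
    rintro _ ⟨s, hs, t, ht, rfl⟩
    refine (spec_isPrefix x s hjw (common_le s t)).bind_eq ?_
    refine .ite (fun h => ?_) (fun _ => .pure (Or.inl ⟨rfl, hx⟩))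
    rw [decide_eq_true_eq] at h
    exact absurd (hx s hs) (not_lt.2 h.2)
  · simp only [NoneBelow, not_forall, not_lt] at hx
    obtain ⟨s, hs, hxs⟩ := hx
    obtain ⟨a, l, h, ha, hl⟩ := exists_skip hs hjw
    have hsome : (some (BitVec.ofNat w a) = none ∧ NoneBelow S x j) ∨
      ∃ s a' l, some (BitVec.ofNat w a) = some (BitVec.ofNat w a') ∧ Skip S s a' l ∧ a' ≤ j ∧
        j ≤ l ∧ j ≤ common x s := Or.inr ⟨s, a, l, rfl, h, ha, hl, hxs⟩
    rw [(pre_eq_pre_iff x s hjw).2 hxs]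
    have hname := spec_exitName hE hw h hi (hj ▸ ha) (hj ▸ hl)
    rw [← hj] at hname
    refine hname.bind_eq ?_
    refine (spec_test _ _ _).bind_eq ?_
    refine .ite (fun _ => ?_) (fun hne => absurd ?_ hne)
    · refine (spec_cut _ (ha.trans hjw)).bind_eq ?_
      rw [show pre (pre s j).enc.1 a = pre s a from pre_pre_bits s ha hjw]
      refine (spec_extent hE hw h).bind_eq ?_
      refine (spec_isPrefix s s hjw h.le_width).bind_eq ?_
      refine .ite (fun _ => .pure hsome) (fun hne => absurd ?_ hne)
      rw [decide_eq_true_eq, common_self]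
      exact ⟨hl, hjw⟩
    · simp only [Cmp.eval, Str.enc, decide_eq_true_eq, pre_len, ofNat_le_ofNat (ha.trans hjw) hjw]
      exact ha

/-! ### The neighbours of a prefix -/

theorem div_mul_cancel_two_pow (n k : ℕ) : n * 2 ^ k / 2 ^ k = n :=
  Nat.mul_div_cancel n (by positivity)

theorem pre_bits_eq_self {c : ℕ} (h : x.toNat = c * 2 ^ (w - l)) : (pre x l).bits = x := by
  refine BitVec.eq_of_toNat_eq ?_
  rw [pre_bits_toNat, h, div_mul_cancel_two_pow]

theorem nextBits_div (hw : 1 ≤ w) (h : nextBits x j ≠ 0#w) :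
    (nextBits x j).toNat / 2 ^ (w - j) = x.toNat / 2 ^ (w - j) + 1 := by
  rw [nextBits_toNat_of_ne hw x h, div_mul_cancel_two_pow]

theorem spec_nextStr (hw : 1 ≤ w) (x : BitVec w) (hj : j ≤ w) :
    Spec E (nextStr (pre x j).enc)
      (fun r => (r = none ∧ ∀ t : BitVec w, t.toNat / 2 ^ (w - j) ≤ x.toNat / 2 ^ (w - j)) ∨
        ∃ y : BitVec w, r = some (pre y j).enc ∧
          y.toNat / 2 ^ (w - j) = x.toNat / 2 ^ (w - j) + 1) 7 := by
  unfold nextStr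
  refine (spec_lit 1).bind_eq ?_
  refine spec_width.bind_eq ?_
  refine (spec_sub hj).bind_eq ?_
  refine (spec_op _ _ _).bind_eq ?_
  refine (spec_op _ _ _).bind_eq ?_
  refine (spec_lit 0).bind_eq ?_
  refine (spec_test _ _ _).bind_eq ?_
  simp only [Cmp.eval, Op.eval, Str.enc, toNat_ofNat_of_le (Nat.sub_le w j), decide_eq_true_eq]
  refine .ite (fun h0 => .pure (Or.inl ⟨rfl, fun t => div_le_of_nextBits_eq_zero hw t h0⟩))
    (fun h0 => .pure (Or.inr ⟨nextBits x j, ?_, nextBits_div hw h0⟩))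
  rw [pre_bits_eq_self (nextBits_toNat_of_ne hw x h0)]
  rfl

theorem spec_prevStr (hw : 1 ≤ w) (x : BitVec w) (hj : j ≤ w) :
    Spec E (prevStr (pre x j).enc)
      (fun r => (r = none ∧ x.toNat / 2 ^ (w - j) = 0) ∨
        ∃ y : BitVec w, r = some (pre y j).enc ∧
          y.toNat / 2 ^ (w - j) + 1 = x.toNat / 2 ^ (w - j)) 7 := by
  have hx := pre_bits_toNat x j
  unfold prevStr
  refine (spec_lit 0).bind_eq ?_
  refine (spec_test _ _ _).bind_eq ?_
  simp only [Cmp.eval, decide_eq_true_eq]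
  refine .ite (fun h0 => .pure (Or.inl ⟨rfl, ?_⟩)) (fun h0 => ?_)
  · rw [show (pre x j).bits = BitVec.ofNat w 0 from h0, toNat_ofNat_of_le (Nat.zero_le w)] at hx
    exact (Nat.mul_eq_zero.1 hx.symm).resolve_right (by positivity)
  · refine (spec_lit 1).bind_eq ?_
    refine spec_width.bind_eq ?_
    refine (spec_sub hj).bind_eq ?_
    refine (spec_op _ _ _).bind_eq ?_
    refine (spec_op _ _ _).bind_eq ?_
    simp only [Op.eval, Str.enc, toNat_ofNat_of_le (Nat.sub_le w j)]
    obtain ⟨c, hc⟩ : ∃ c, x.toNat / 2 ^ (w - j) = c + 1 := by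
      refine Nat.exists_eq_succ_of_ne_zero fun h => h0 (BitVec.eq_of_toNat_eq ?_)
      rw [toNat_ofNat_of_le (Nat.zero_le w), show (pre x j).enc.1.toNat = _ from hx, h, zero_mul]
    rw [hc, add_mul, one_mul] at hx
    have hsub : ((pre x j).bits - 1#w <<< (w - j)).toNat = c * 2 ^ (w - j) := by
      have hlt := (pre x j).bits.isLt
      have h1 : (1#w <<< (w - j)).toNat = 2 ^ (w - j) := by
        rw [toNat_one_shiftLeft hw, Nat.mod_eq_of_lt (by omega)]
      rw [BitVec.toNat_sub_of_le (by rw [BitVec.le_def]; omega)]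
      omega
    refine .pure (Or.inr ⟨(pre x j).bits - 1#w <<< (w - j), ?_, ?_⟩)
    · rw [pre_bits_eq_self hsub]
      rfl
    · rw [hsub, div_mul_cancel_two_pow, hc]

/-- Neither an element of `S` has the same prefix of length `j` as `x`, nor one of the two prefixes
following and preceding it. -/
def IsFar (S : Finset (BitVec w)) (x : BitVec w) (j : ℕ) : Prop :=
  ∀ t ∈ S, t.toNat / 2 ^ (w - j) + 2 ≤ x.toNat / 2 ^ (w - j) ∨
    x.toNat / 2 ^ (w - j) + 2 ≤ t.toNat / 2 ^ (w - j)

theorem IsFar.two_pow_le_shortDist (h : IsFar S x j) (hS : S.Nonempty) :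
    2 ^ (w - j) ≤ shortDist S x := by
  have hne : {k | (∃ y, IsPred S x y ∧ k = x.toNat - y.toNat) ∨
      (∃ y, IsSucc S x y ∧ k = y.toNat - x.toNat)}.Nonempty := by
    by_cases hlt : ∃ t ∈ S, t < x
    · obtain ⟨y, hy, hmax⟩ := Finset.exists_max_image (S.filter fun t => t < x) id
        (by simpa [Finset.filter_nonempty_iff] using hlt)
      rw [Finset.mem_filter] at hy
      exact ⟨_, Or.inl ⟨y, ⟨hy, fun t ht => hmax t (Finset.mem_filter.2 ht)⟩, rfl⟩⟩
    · push Not at hlt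
      obtain ⟨y, hy, hmin⟩ := Finset.exists_min_image S id hS
      exact ⟨_, Or.inr ⟨y, ⟨⟨hy, hlt y hy⟩, fun t ht => hmin t ht.1⟩, rfl⟩⟩
  have key : ∀ {u v : ℕ}, u / 2 ^ (w - j) + 2 ≤ v / 2 ^ (w - j) → u + 2 ^ (w - j) ≤ v := by
    intro u v huv
    have h1 := Nat.div_mul_le_self v (2 ^ (w - j))
    have h2 := Nat.lt_div_mul_add (a := u) (b := 2 ^ (w - j)) (by positivity)
    have h3 := Nat.mul_le_mul_right (2 ^ (w - j)) huv
    rw [add_mul] at h3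
    omega
  have hle {u v : ℕ} (h : u ≤ v) : u / 2 ^ (w - j) ≤ v / 2 ^ (w - j) := Nat.div_le_div_right h
  rcases Nat.sInf_mem hne with ⟨y, hy, e⟩ | ⟨y, hy, e⟩
  all_goals
    rw [shortDist, e]
  · have h1 := hle (BitVec.le_def.1 hy.1.2.le)
    rcases h y hy.1.1 with h' | h'
    · have := key h'
      omega
    · omega
  · have h1 := hle (BitVec.le_def.1 hy.1.2)
    rcases h y hy.1.1 with h' | h'
    · omega
    · have := key h'
      omega

end Patched

/-! ### Correctness and running time of the algorithm -/

section Main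

variable {w : ℕ} {S : Finset (BitVec w)} {E : Env w} {s x y : BitVec w} {a i j l n : ℕ}

open Code in
/-- The last case of the body of the loop of the algorithm: the probe of the string preceding `p`. -/
def previousProbe {V : Type} (p : V × V) (i : V) : Code V (V ⊕ V) := do
  let p'' ← prevStr p
  match p'', ← probe p'' with
  | some q, some t =>
    return Sum.inr (← right (← cut q.1 t))
  | _, _ =>
    return Sum.inl (← op .add i (← lit 1))

open Code in
/-- The body of the loop of the algorithm. -/
def shortBody {V : Type} (x i : V) : Code V (V ⊕ V) := do
  if ← test .lt (← op .shl (← lit 1) i) (← msb (← width)) then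
    let p ← cut x (← op .sub (← width) (← tower i))
    match ← exitNamePatched p with
    | some t =>
      let e ← extent (← cut x t)
      if ← isProperPrefix e (x, ← width) then
        return Sum.inr (← fbsPred x e.2 (← width))
      else
        return Sum.inr (← pred x t)
    | none =>
      let p' ← nextStr p
      match p', ← probe p' with
      | some q, some t =>
        return Sum.inr (← op .sub (← left (← cut q.1 t)) (← lit 1))
      | _, _ =>
        previousProbe p i
  else
    return Sum.inr (← fbsPred x (← lit 0) (← width))

theorem two_pow_lt_log_iff (hw : 1 ≤ w) : 2 ^ i < Nat.log 2 w ↔ i ∈ levels w := by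
  rw [mem_levels, ← pow_succ', ← Nat.le_log_iff_pow_le one_lt_two (by omega)]
  exact Nat.lt_iff_add_one_le

theorem Spec.bind_inr {α β : Type} {c : Code (BitVec w) β} {P : β → Prop} {Q : α → Prop} {m : ℕ}
    (h : Spec E c P m) (hmn : m ≤ n) :
    Spec E (c >>= fun r => (Pure.pure (Sum.inr r) : Code (BitVec w) (α ⊕ β))) (Sum.elim Q P) n :=
  Spec.mono (Spec.bind (P := Sum.elim Q P) (n := 0) h fun _ hr => Spec.pure hr) (fun _ h => h)
    (by rwa [Nat.zero_add])

theorem spec_guard {α : Type} {P : α → Prop} {k : Bool → Code (BitVec w) α} (hw : 1 ≤ w)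
    (hi : i < w) (h : Spec E (k (decide (i ∈ levels w))) P n) :
    Spec E (Code.lit 1 >>= fun o => Code.op .shl o (BitVec.ofNat w i) >>= fun u =>
      Code.width >>= fun z => Code.msb z >>= fun m => Code.test .lt u m >>= k) P (n + 5) := by
  refine (spec_lit 1).bind_eq ?_
  refine (spec_op _ _ _).bind_eq ?_
  refine spec_width.bind_eq ?_
  refine (spec_msb _).bind_eq ?_
  refine Spec.bind_eq (b := decide (i ∈ levels w)) ?_ h
  simp only [Op.eval, toNat_ofNat_of_le hi.le, one_shiftLeft_eq hw, toNat_ofNat_of_le le_rfl]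
  have h1 : 2 ^ i < 2 ^ w := Nat.pow_lt_pow_right one_lt_two hi
  refine (spec_test_lt h1 (lt_two_pow_of_le (Nat.log_le_self 2 w))).mono (fun r hr => ?_) le_rfl
  rw [hr, decide_eq_decide, two_pow_lt_log_iff hw]

theorem spec_left_sub_one (hE : E.IsFor S) (h : Skip S s a l) (haj : a ≤ j) (hjl : j ≤ l)
    (hys : j ≤ common y s) (hx : NoneBelow S x j)
    (hy : y.toNat / 2 ^ (w - j) = x.toNat / 2 ^ (w - j) + 1) :
    Spec E (do
      let r ← Code.op .sub (← left (← cut (pre y j).enc.1 (BitVec.ofNat w a))) (← Code.lit 1)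
      return (Sum.inr r : BitVec w ⊕ BitVec w)) (Sum.elim (fun _ => False) (IsPredIndex S x)) 18 := by
  have hjw := hjl.trans h.le_width
  obtain ⟨s₀, s₁, h₀, h₁, -⟩ := h.isFirst_isLast
  rw [(le_common_iff_div y s hjw).1 hys] at hy
  refine (spec_cut _ (haj.trans hjw)).bind_eq ?_
  rw [show pre (pre y j).enc.1 a = pre y a from pre_pre_bits y haj hjw,
    (pre_eq_pre_iff y s (haj.trans hjw)).2 (haj.trans hys)]
  refine (spec_left hE h h₀).bind_eq ?_
  refine (spec_lit 1).bind_eq ?_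
  refine (spec_op _ _ _).bind_eq (.pure ?_)
  rw [← h.rankIn_eq_of_next h₀ haj hjl hx hy]
  exact isPredIndex_rankIn S x

theorem spec_right_inr (hE : E.IsFor S) (hw : 1 ≤ w) (h : Skip S s a l) (haj : a ≤ j) (hjl : j ≤ l)
    (hys : j ≤ common y s) (hx : NoneBelow S x j)
    (hy : y.toNat / 2 ^ (w - j) + 1 = x.toNat / 2 ^ (w - j)) :
    Spec E (do
      let r ← right (← cut (pre y j).enc.1 (BitVec.ofNat w a))
      return (Sum.inr r : BitVec w ⊕ BitVec w)) (Sum.elim (fun _ => False) (IsPredIndex S x)) 25 := by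
  have hjw := hjl.trans h.le_width
  obtain ⟨s₀, s₁, h₀, h₁, -⟩ := h.isFirst_isLast
  rw [(le_common_iff_div y s hjw).1 hys] at hy
  refine (spec_cut _ (haj.trans hjw)).bind_eq ?_
  rw [show pre (pre y j).enc.1 a = pre y a from pre_pre_bits y haj hjw,
    (pre_eq_pre_iff y s (haj.trans hjw)).2 (haj.trans hys)]
  refine (spec_right hE hw h h₁).bind_eq (.pure ?_)
  have := isPredIndex_rankIn S x
  rwa [h.rankIn_eq_of_prev h₁ haj hjl hx hy, ofNat_sub_ofNat (by omega), Nat.add_sub_cancel] at this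

/-- The search continues from the node that contains `x[0..j)` in its skip interval. -/
theorem spec_found (hE : E.IsFor S) (hw : 1 ≤ w) (hS : S.Nonempty) {K : ℕ} (h : Skip S s a l)
    (haj : a ≤ j) (hjl : j ≤ l) (hxs : j ≤ common x s) (hK : w - j ≤ 2 ^ K) :
    Spec E (do
      let e ← extent (← cut x (BitVec.ofNat w a))
      if ← isProperPrefix e (x, ← Code.width) then
        return (Sum.inr (← fbsPred x e.2 (← Code.width)) : BitVec w ⊕ BitVec w)
      else
        return Sum.inr (← pred x (BitVec.ofNat w a)))
      (Sum.elim (fun _ => False) (IsPredIndex S x)) (105 + (K + 2) * 79 + 59) := by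
  have hjw := hjl.trans h.le_width
  refine (spec_cut x (haj.trans hjw)).bind_eq ?_
  rw [(pre_eq_pre_iff x s (haj.trans hjw)).2 (haj.trans hxs)]
  refine (spec_extent hE hw h).bind_eq ?_
  refine spec_width.bind_eq ?_
  rw [enc_full]
  refine (spec_isProperPrefix s x h.le_width le_rfl).bind_eq ?_
  simp only [decide_eq_true_eq]
  rw [common_comm s x]
  refine .ite (fun hp => ?_) (fun hp => ?_)
  · have hI : FbsInv S x l w := by
      obtain ⟨t, ht, e⟩ := h.branch hp.1
      exact ⟨Or.inr ⟨hp.1, s, h.mem, t, ht, e, hp.2⟩, hp.1, le_rfl, fun _ h => h.1⟩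
    refine spec_width.bind_eq ?_
    exact (spec_fbsPred hE hw hS hI (K := K) (by omega)).bind_inr (by omega)
  · have hx : IsExitSkip S x s a l := by
      refine ⟨h, haj.trans hxs, ?_⟩
      have := h.le_width
      omega
    exact (spec_pred hE hw hx).bind_inr (by omega)

theorem spec_shortBody (hE : E.IsFor S) (hw : 1 ≤ w) (hS : S.Nonempty) (hi : i ∈ levels w)
    (hj : j = w - 2 ^ (2 ^ i)) (hn : ¬ NoneBelow S x j → 105 + (2 ^ i + 2) * 79 ≤ n) :
    Spec E (shortBody x (BitVec.ofNat w i))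
      (Sum.elim (fun i' => i' = BitVec.ofNat w (i + 1) ∧ IsFar S x j) (IsPredIndex S x))
      (n + 260) := by
  have hjw : j ≤ w := hj ▸ Nat.sub_le _ _
  have hi' := mem_levels.1 hi
  have h1 : i < 2 ^ i := Nat.lt_two_pow_self
  have h2 : 2 ^ i < 2 ^ (2 ^ i) := Nat.lt_two_pow_self
  have hpost : ∀ r : BitVec w ⊕ BitVec w, Sum.elim (fun _ => False) (IsPredIndex S x) r →
      Sum.elim (fun i' => i' = BitVec.ofNat w (i + 1) ∧ IsFar S x j) (IsPredIndex S x) r := by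
    rintro (r | r) hr
    exacts [hr.elim, hr]
  have hdiv : ∀ {y : BitVec w}, NoneBelow S y j → ∀ t ∈ S,
      y.toNat / 2 ^ (w - j) ≠ t.toNat / 2 ^ (w - j) := fun {y} h t ht =>
    mt (le_common_iff_div y t hjw).2 (not_le.2 (h t ht))
  unfold shortBody
  refine spec_guard hw (by omega) ?_
  refine .ite (fun _ => ?_) (fun h => absurd (by simpa using hi) h)
  refine spec_width.bind_eq ?_
  refine (spec_tower hw hi).bind_eq ?_
  refine (spec_sub (by omega)).bind_eq ?_
  rw [← hj]
  refine (spec_cut x hjw).bind_eq ?_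
  refine (spec_exitNamePatched hE hw hS hi x hj).bind ?_
  rintro _ (⟨rfl, hx⟩ | ⟨s, a, l, rfl, h, haj, hjl, hxs⟩)
  swap
  · have hnn := hn fun hx => (hx s h.mem).not_ge hxs
    exact (spec_found hE hw hS (K := 2 ^ i) h haj hjl hxs (by omega)).mono hpost (by omega)
  have hx' := hdiv hx
  -- the last case, reached when no element of `S` is prefixed by the string following `x[0..j)`
  have hprev : (∀ t ∈ S, t.toNat / 2 ^ (w - j) ≠ x.toNat / 2 ^ (w - j) + 1) →
      Spec E (previousProbe (pre x j).enc (BitVec.ofNat w i))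
      (Sum.elim (fun i' => i' = BitVec.ofNat w (i + 1) ∧ IsFar S x j) (IsPredIndex S x)) 100 := by
    intro hnext
    have hinl : (∀ t ∈ S, t.toNat / 2 ^ (w - j) + 1 ≠ x.toNat / 2 ^ (w - j)) →
        Spec E (Code.lit 1 >>= fun o => Code.op .add (BitVec.ofNat w i) o >>= fun r =>
          (return Sum.inl r))
        (Sum.elim (fun i' => i' = BitVec.ofNat w (i + 1) ∧ IsFar S x j) (IsPredIndex S x)) 25 := by
      intro hpre
      refine (spec_lit 1).bind_eq ?_
      refine (spec_op _ _ _).bind_eq (.pure ⟨?_, fun t ht => ?_⟩)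
      · rw [Op.eval, ← BitVec.ofNat_add]
      · have h3 := hx' t ht
        have h4 := hnext t ht
        have h5 := hpre t ht
        omega
    unfold previousProbe
    refine (spec_prevStr hw x hjw).bind ?_
    rintro _ (⟨rfl, h0⟩ | ⟨y, rfl, hy⟩)
    · refine Spec.bind_eq (b := none) (m := 68) (.pure rfl) ?_
      exact hinl fun t _ => h0 ▸ Nat.succ_ne_zero _
    · refine (spec_exitNamePatched hE hw hS hi y hj).bind ?_
      rintro _ (⟨rfl, hny⟩ | ⟨s, a, l, rfl, h, haj, hjl, hys⟩)
      · refine hinl fun t ht => ?_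
        have := hdiv hny t ht
        omega
      · exact (spec_right_inr hE hw h haj hjl hys hx hy).mono hpost le_rfl
  refine (spec_nextStr hw x hjw).bind ?_
  rintro _ (⟨rfl, h0⟩ | ⟨y, rfl, hy⟩)
  · refine Spec.bind_eq (b := none) (m := 68) (.pure rfl) ?_
    have hp := hprev fun t _ => by have := h0 t; omega
    exact Spec.mono hp (fun _ h => h) (Nat.le_add_left _ _)
  · refine (spec_exitNamePatched hE hw hS hi y hj).bind ?_
    rintro _ (⟨rfl, hny⟩ | ⟨s, a, l, rfl, h, haj, hjl, hys⟩)
    · have hp := hprev fun t ht => by have := hdiv hny t ht; omega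
      exact Spec.mono hp (fun _ h => h) (Nat.le_add_left _ _)
    · exact (spec_left_sub_one hE h haj hjl hys hx hy).mono hpost (by omega)

theorem spec_shortBody_end (hE : E.IsFor S) (hw : 1 ≤ w) (hS : S.Nonempty) (hiw : i < w)
    (hi : i ∉ levels w) :
    Spec E (shortBody x (BitVec.ofNat w i)) (Sum.elim (fun _ => False) (IsPredIndex S x))
      (105 + (2 ^ i + 3) * 79 + 7) := by
  have hK : w ≤ 2 ^ (2 ^ i + 1) := by
    rw [mem_levels, ← pow_succ'] at hi
    omega
  unfold shortBody
  refine spec_guard hw hiw ?_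
  refine .ite (fun h => absurd (by simpa using h) hi) (fun _ => ?_)
  refine (spec_lit 0).bind_eq ?_
  refine spec_width.bind_eq ?_
  have hI : FbsInv S x 0 w := ⟨Or.inl rfl, hw, le_rfl, fun _ h => h.1⟩
  exact (spec_fbsPred hE hw hS hI (K := 2 ^ i + 1) (by omega)).bind_inr (by omega)

/-- The loop at the iteration `i`; `M` bounds the numbers `2 ^ i` such that the iteration `i` is
reached, due to the lower bound on the distance given by the failure of the previous one. -/
theorem loopSpec_shortBody (hE : E.IsFor S) (hw : 1 ≤ w) (hS : S.Nonempty) {M : ℕ}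
    (hM : ∀ i, (i = 0 ∨ 2 ^ (2 ^ (2 ^ (i - 1))) ≤ shortDist S x) → 2 ^ i ≤ M) (n : ℕ) :
    ∀ i, (i = 0 ∨ i - 1 ∈ levels w ∧ 2 ^ (2 ^ (2 ^ (i - 1))) ≤ shortDist S x) → M ≤ i + n →
      LoopSpec E (shortBody x) (BitVec.ofNat w i) (IsPredIndex S x)
        (n * 261 + (M + 3) * 79 + 366) := by
  induction n with
  | zero =>
    intro i hi hn
    have h1 : i < 2 ^ i := Nat.lt_two_pow_self
    have := hM i (hi.imp_right And.right)
    omega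
  | succ n ih =>
    intro i hi hn
    have hiM := hM i (hi.imp_right And.right)
    have hiw : i < w := by
      rcases hi with rfl | ⟨hi, -⟩
      · exact hw
      · rw [mem_levels] at hi
        have h1 : i - 1 < 2 ^ (i - 1) := Nat.lt_two_pow_self
        have h2 : 2 ^ (i - 1) < 2 ^ (2 ^ (i - 1)) := Nat.lt_two_pow_self
        omega
    by_cases hl : i ∈ levels w
    · by_cases hx : NoneBelow S x (w - 2 ^ (2 ^ i))
      · refine (LoopSpec.step (n := n * 261 + (M + 3) * 79 + 366)
          ((spec_shortBody hE hw hS hl rfl (n := 0) (absurd hx)).mono ?_ le_rfl)).mono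
          (fun _ h => h) (by omega)
        rintro (r | r) hr
        · obtain ⟨rfl, hfar⟩ := hr
          have hd := hfar.two_pow_le_shortDist hS
          have := mem_levels.1 hl
          rw [show w - (w - 2 ^ (2 ^ i)) = 2 ^ (2 ^ i) by omega] at hd
          exact ih (i + 1) (Or.inr ⟨hl, hd⟩) (by omega)
        · exact hr
      · refine (LoopSpec.step (n := 0) ((spec_shortBody hE hw hS hl rfl fun _ => le_rfl).mono
          ?_ le_rfl)).mono (fun _ h => h) (by omega)
        rintro (r | r) hr
        · refine absurd (fun t ht => ?_) hx
          by_contra! hle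
          have := (le_common_iff_div x t (Nat.sub_le _ _)).1 hle
          have := hr.2 t ht
          omega
        · exact hr
    · refine (LoopSpec.step (n := 0) ((spec_shortBody_end hE hw hS hiw hl).mono ?_ le_rfl)).mono
        (fun _ h => h) (by omega)
      rintro (r | r) hr
      exacts [hr.elim, hr]

theorem one_le_lg (y : ℝ) : 1 ≤ lg y := by
  unfold lg
  split_ifs with h
  · exact le_rfl
  · rw [Real.le_logb_iff_rpow_le one_lt_two (by linarith), Real.rpow_one]
    linarith

theorem natCast_le_lg {k : ℕ} {y : ℝ} (h : (2 : ℝ) ^ k ≤ y) : (k : ℝ) ≤ lg y := by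
  unfold lg
  split_ifs with h2
  · have : (2 : ℝ) ^ k < 2 ^ 1 := by linarith
    rw [pow_lt_pow_iff_right₀ one_lt_two] at this
    exact_mod_cast this.le
  · rw [Real.le_logb_iff_rpow_le one_lt_two (by linarith), Real.rpow_natCast]
    exact h

/-- The algorithm is correct, and its running time is `O(log log d)`. -/
theorem spec_shortDistancePred (hE : E.IsFor S) (hw : 1 ≤ w) (hS : S.Nonempty) (x : BitVec w) :
    ∃ t : ℕ, Spec E (shortDistancePred x) (IsPredIndex S x) t ∧
      (t : ℝ) ≤ 1284 * lg (lg (shortDist S x)) := by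
  set D := lg (lg (shortDist S x)) with hD
  have h1 : 1 ≤ D := one_le_lg _
  set M := ⌊2 * D⌋₊ with hMdef
  have hMle : (M : ℝ) ≤ 2 * D := Nat.floor_le (by linarith)
  have hM : ∀ i, (i = 0 ∨ 2 ^ (2 ^ (2 ^ (i - 1))) ≤ shortDist S x) → 2 ^ i ≤ M := by
    intro i hi
    refine Nat.le_floor ?_
    rcases hi with rfl | hi
    · rw [pow_zero, Nat.cast_one]
      linarith
    · obtain rfl | hi0 := Nat.eq_zero_or_pos i
      · rw [pow_zero, Nat.cast_one]
        linarith
      have h2 : ((2 : ℝ) ^ (2 ^ (2 ^ (i - 1)))) ≤ shortDist S x := by exact_mod_cast hi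
      have h3 := natCast_le_lg h2
      rw [Nat.cast_pow, Nat.cast_ofNat] at h3
      have h4 := natCast_le_lg h3
      have h5 : (2 : ℝ) ^ i = 2 * 2 ^ (i - 1) := by
        rw [← pow_succ', Nat.sub_add_cancel hi0]
      rw [Nat.cast_pow, Nat.cast_ofNat] at h4 ⊢
      rw [h5]
      linarith
  refine ⟨M * 261 + (M + 3) * 79 + 366 + 1, ?_, ?_⟩
  · unfold shortDistancePred
    refine (spec_lit 0).bind_eq (Spec.loop ?_)
    exact loopSpec_shortBody hE hw hS hM M 0 (Or.inl rfl) (by omega)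
  · push_cast
    linarith

end Main

/-! ### The size of the index -/

section Space

variable {w : ℕ} {S : Finset (BitVec w)} {k : BitVec w}

/-- Each internal node is the longest common prefix of an element of `S`, namely, the largest one
below the left child, and of its successor in `S`. -/
theorem card_nodes_le (S : Finset (BitVec w)) : (nodes S).card ≤ 2 * S.card := by
  let m : BitVec w → ℕ := fun s => (S.filter fun t => s < t).sup (common s)
  have hsub : nodes S ⊆ S.image (fun s => pre s w) ∪ S.image (fun s => pre s (m s)) := by
    intro e he
    obtain ⟨s, a, l, h, rfl⟩ := mem_nodes_iff.1 he
    rw [Finset.mem_union]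
    rcases h.le_width.lt_or_eq with hl | rfl
    swap
    · exact Or.inl (Finset.mem_image_of_mem (fun s => pre s l) h.mem)
    right
    obtain ⟨u, hu, v, hv, huv, hc, hlu⟩ :
        ∃ u ∈ S, ∃ v ∈ S, u < v ∧ common u v = l ∧ l ≤ common u s := by
      obtain ⟨t, ht, e⟩ := h.branch hl
      rcases lt_or_gt_of_ne ((common_lt_iff_ne s t).1 (e ▸ hl)) with h' | h'
      · exact ⟨s, h.mem, t, ht, h', e, by rw [common_self]; exact h.le_width⟩
      · exact ⟨t, ht, s, h.mem, h', by rw [common_comm, e], by rw [common_comm, e]⟩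
    obtain ⟨z, hz⟩ := exists_isLast (a := l + 1) hu (by rwa [common_self])
    have hzv : z < v := by
      by_contra! hle
      have h1 := common_anti_of_le huv.le hle
      have h2 := hz.le_common
      omega
    have hcz : common v z = l := by
      have h2 := hz.le_common
      rw [common_eq_of_lt (y := u)] <;> rw [common_comm v u, hc]
      omega
    have hm : m z = l := by
      apply le_antisymm
      · refine Finset.sup_le fun t ht => ?_
        rw [Finset.mem_filter] at ht
        by_contra! hlt
        exact ht.2.not_ge (hz.le t ht.1 (le_common_trans hz.le_common hlt))
      · rw [← hcz, common_comm]
        exact Finset.le_sup (f := common z) (Finset.mem_filter.2 ⟨hv, hzv⟩)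
    refine Finset.mem_image.2 ⟨z, hz.mem, ?_⟩
    rw [hm, pre_eq_pre_iff _ _ h.le_width]
    refine le_common_trans (y := u) ?_ hlu
    rw [common_comm]
    exact (Nat.le_succ l).trans hz.le_common
  calc (nodes S).card ≤ _ := Finset.card_le_card hsub
    _ ≤ _ := Finset.card_union_le _ _
    _ ≤ S.card + S.card := Nat.add_le_add Finset.card_image_le Finset.card_image_le
    _ = 2 * S.card := (two_mul _).symm

theorem card_markers_le (S : Finset (BitVec w)) : (markers S).card ≤ 4 * S.card := by
  have h := card_nodes_le S
  have h1 : (markers S).card ≤ (nodes S).card + (nodes S).card :=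
    (Finset.card_union_le _ _).trans (Nat.add_le_add Finset.card_image_le
      ((Finset.card_filter_le _ _).trans Finset.card_image_le))
  omega

theorem card_setP_le (S : Finset (BitVec w)) : (setP S).card ≤ S.card * (levels w).card :=
  Finset.card_biUnion_le_card_mul _ _ _ fun _ _ => Finset.card_image_le

theorem card_setQ_le (S : Finset (BitVec w)) : (setQ S).card ≤ 2 * S.card := by
  refine le_trans ?_ (card_nodes_le S)
  choose! e he using fun q (hq : q ∈ setQ S) => (Finset.mem_filter.1 hq).2
  refine Finset.card_le_card_of_injOn e (fun q hq => (he q hq).1) fun q hq q' hq' heq => ?_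
  obtain ⟨-, h₁, h₂, h₃⟩ := he q hq
  obtain ⟨-, h₁', h₂', h₃'⟩ := he q' hq'
  have hPq := (Finset.mem_filter.1 hq).1
  have hPq' := (Finset.mem_filter.1 hq').1
  have h := h₃ q' hPq' (heq ▸ h₁') (heq ▸ h₂')
  have h' := h₃' q hPq (heq ▸ h₁) (heq ▸ h₂)
  obtain ⟨s, -, i, -, rfl⟩ := mem_setP.1 hPq
  obtain ⟨s', -, i', -, rfl⟩ := mem_setP.1 hPq'
  rw [pre_isPrefix_pre _ _ (Nat.sub_le _ _)] at h h'
  have hlen := h.1.antisymm h'.1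
  rw [← hlen]
  exact (pre_eq_pre_iff s s' (Nat.sub_le _ _)).2 h.2

theorem mem_bucket_self (hk : k ∈ markers S) : k ∈ bucket S k :=
  Finset.mem_filter.2 ⟨hk, rfl⟩

theorem bucket_congr {k' : BitVec w} (h : rankIn (markers S) k / Nat.size S.card =
    rankIn (markers S) k' / Nat.size S.card) : bucket S k = bucket S k' := by
  rw [bucket, bucket, h]

theorem size_pos_of_nonempty (hS : S.Nonempty) : 0 < Nat.size S.card :=
  Nat.size_pos.2 hS.card_pos

/-- There are at most `5 n` bits in the second part of the range locator, as the number of buckets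
is at most one more than the ratio of the number of markers to the size of a bucket. -/
theorem size_mul_card_image_bucketPrefix_le (hS : S.Nonempty) :
    Nat.size S.card * ((markers S).image (bucketPrefix S)).card ≤ 5 * S.card := by
  set b := Nat.size S.card with hb
  have hb0 : 0 < b := size_pos_of_nonempty hS
  have hcard : ((markers S).image (bucketPrefix S)).card ≤ ((markers S).card - 1) / b + 1 := by
    choose! g hg using fun p (hp : p ∈ (markers S).image (bucketPrefix S)) => Finset.mem_image.1 hp
    rw [← Finset.card_range (((markers S).card - 1) / b + 1)]
    refine Finset.card_le_card_of_injOn (fun p => rankIn (markers S) (g p) / b)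
      (fun p hp => ?_) fun p hp p' hp' heq => ?_
    · have := rankIn_lt_card (hg p hp).1
      rw [Finset.mem_coe, Finset.mem_range, Nat.lt_succ_iff]
      exact Nat.div_le_div_right (by omega)
    · rw [← (hg p hp).2, ← (hg p' hp').2]
      have hbk := bucket_congr (S := S) heq
      rw [bucketPrefix, bucketPrefix, hbk, pre_eq_pre_iff _ _ (lcpLen_le _)]
      exact (le_lcpLen_iff (lcpLen_le _)).1 le_rfl _ (hbk ▸ mem_bucket_self (hg p hp).1) _
        (mem_bucket_self (hg p' hp').1)
  have h1 := card_markers_le S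
  have h2 : b ≤ S.card := Nat.size_le.2 Nat.lt_two_pow_self
  calc b * ((markers S).image (bucketPrefix S)).card
      ≤ b * (((markers S).card - 1) / b + 1) := Nat.mul_le_mul_left _ hcard
    _ = b * (((markers S).card - 1) / b) + b := by rw [mul_add, mul_one]
    _ ≤ (markers S).card - 1 + b := Nat.add_le_add_right (Nat.mul_div_le _ _) _
    _ ≤ 5 * S.card := by omega

/-- Distinct buckets have distinct longest common prefixes. -/
theorem not_bucketPrefix_eq_of_lt {k' : BitVec w} (hk : k ∈ markers S) (hk' : k' ∈ markers S)
    (hlt : rankIn (markers S) k / Nat.size S.card < rankIn (markers S) k' / Nat.size S.card) :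
    bucketPrefix S k ≠ bucketPrefix S k' := by
  intro heq
  have hsep : ∀ u ∈ bucket S k, ∀ v ∈ bucket S k', u < v := by
    intro u hu v hv
    by_contra! hle
    have h1 := Nat.div_le_div_right (c := Nat.size S.card) (rankIn_mono (markers S) hle)
    rw [(Finset.mem_filter.1 hu).2, (Finset.mem_filter.1 hv).2] at h1
    omega
  have hlen : lcpLen (bucket S k) = lcpLen (bucket S k') := congrArg Str.len heq
  have hkk : lcpLen (bucket S k) ≤ common k k' := by
    rw [bucketPrefix, bucketPrefix, ← hlen] at heq
    exact (pre_eq_pre_iff _ _ (lcpLen_le _)).1 heq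
  have hmin : ∀ {k : BitVec w}, k ∈ markers S → ∃ u ∈ bucket S k, ∃ v ∈ bucket S k, u ≤ v ∧
      common u v = lcpLen (bucket S k) := by
    intro k hk
    obtain ⟨u, hu, v, hv, h⟩ := exists_common_eq_lcpLen ⟨k, mem_bucket_self hk⟩
    rcases le_total u v with h' | h'
    · exact ⟨u, hu, v, hv, h', h⟩
    · exact ⟨v, hv, u, hu, h', by rw [common_comm, h]⟩
  obtain ⟨u, hu, v, hv, huv, hc⟩ := hmin hk
  obtain ⟨u', hu', v', hv', huv', hc'⟩ := hmin hk'
  have hA := (le_lcpLen_iff (lcpLen_le (bucket S k))).1 le_rfl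
  have hC := (le_lcpLen_iff (lcpLen_le (bucket S k'))).1 le_rfl
  have hcross : ∀ z ∈ bucket S k', common u z = lcpLen (bucket S k) := by
    intro z hz
    apply le_antisymm
    · rw [← hc]
      exact common_anti_of_le huv (hsep v hv z hz).le
    · refine le_common_trans (hA u hu k (mem_bucket_self hk)) (le_common_trans hkk ?_)
      rw [hlen]
      exact hC k' (mem_bucket_self hk') z hz
  have hw : lcpLen (bucket S k) < w := by
    rw [← hcross u' hu', common_lt_iff_ne]
    exact (hsep u hu u' hu').ne
  have := lt_common_of_eq hw (by rw [common_comm]; exact hcross u' hu') (hcross v' hv')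
  omega

theorem rankIn_eq_add {A : Finset (BitVec w)} {k' : BitVec w} (h : k' ≤ k) :
    rankIn A k = rankIn A k' + (A.filter fun t => k' ≤ t ∧ t < k).card := by
  rw [rankIn, rankIn, ← Finset.card_union_of_disjoint]
  · congr 1
    ext t
    simp only [Finset.mem_union, Finset.mem_filter]
    constructor
    · rintro ⟨ht, htk⟩
      rcases lt_or_ge t k' with h' | h'
      exacts [Or.inl ⟨ht, h'⟩, Or.inr ⟨ht, h', htk⟩]
    · rintro (⟨ht, h'⟩ | ⟨ht, -, h'⟩)
      exacts [⟨ht, h'.trans_le h⟩, ⟨ht, h'⟩]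
  · rw [Finset.disjoint_left]
    intro t ht ht'
    exact (Finset.mem_filter.1 ht).2.not_ge (Finset.mem_filter.1 ht').2.1

/-- Between two markers there are at least as many markers as elements of `S`: the least strings
prefixed by the names of the leaves interleave with the leaves. -/
theorem card_between_le {k' : BitVec w} (hk' : k' ∈ markers S) :
    (S.filter fun t => k' ≤ t ∧ t < k).card ≤
      ((markers S).filter fun t => k' ≤ t ∧ t < k).card := by
  have hleaf : ∀ s ∈ S, ∃ a, Skip S s a w := fun s hs => by
    obtain ⟨a, l, h, -, hl⟩ := exists_skip hs le_rfl
    obtain rfl := h.le_width.antisymm hl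
    exact ⟨a, h⟩
  choose! a ha using hleaf
  have hsep : ∀ s ∈ S, ∀ t ∈ S, s < t → s < (pre t (a t)).bits := by
    intro s hs t ht hst
    by_contra! hle
    have h1 := le_common_of_pre_bits_le (ha t ht).name_le hle hst.le
    exact hst.ne ((le_common_iff_eq t s).1 ((ha t ht).gap s hs h1)).symm
  refine Finset.card_le_card_of_injOn (fun s => max k' (pre s (a s)).bits) (fun s hs => ?_)
    fun s hs t ht heq => ?_
  · obtain ⟨hs, h₁, h₂⟩ := Finset.mem_filter.1 hs
    refine Finset.mem_filter.2 ⟨?_, le_max_left _ _, max_lt (h₁.trans_lt h₂)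
      ((pre_bits_le s _).trans_lt h₂)⟩
    rcases max_choice k' (pre s (a s)).bits with h | h <;> simp only [h]
    exacts [hk', (ha s hs).pre_bits_mem_markers]
  · obtain ⟨hs, hks, -⟩ := Finset.mem_filter.1 hs
    obtain ⟨ht, hkt, -⟩ := Finset.mem_filter.1 ht
    have key : ∀ s ∈ S, ∀ t ∈ S, k' ≤ s → s < t →
        max k' (pre s (a s)).bits < max k' (pre t (a t)).bits := fun s hs t ht hks hst =>
      (max_le hks (pre_bits_le s _)).trans_lt (lt_max_of_lt_right (hsep s hs t ht hst))
    rcases lt_trichotomy s t with h | h | h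
    · exact absurd heq (key s hs t ht hks h).ne
    · exact h
    · exact absurd heq (key t ht s hs hkt h).ne'

/-- The values of the third part of the range locator are smaller than the size of a bucket. -/
theorem rankIn_sub_bucketRank_lt (hS : S.Nonempty) (hk : k ∈ markers S) :
    rankIn S k - bucketRank S (bucketPrefix S k) < Nat.size S.card := by
  have hb0 := size_pos_of_nonempty hS
  obtain ⟨k', hk', hp, hr⟩ : ∃ k' ∈ markers S, bucketPrefix S k' = bucketPrefix S k ∧
      bucketRank S (bucketPrefix S k) = rankIn S k' :=
    Nat.sInf_mem (s := {r | ∃ k' ∈ markers S, bucketPrefix S k' = bucketPrefix S k ∧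
      r = rankIn S k'}) ⟨rankIn S k, k, hk, rfl, rfl⟩
  rw [hr]
  rcases lt_or_ge k k' with h | h
  · have := rankIn_mono S h.le
    omega
  · have hq : rankIn (markers S) k / Nat.size S.card = rankIn (markers S) k' / Nat.size S.card := by
      rcases lt_trichotomy (rankIn (markers S) k / Nat.size S.card)
        (rankIn (markers S) k' / Nat.size S.card) with h' | h' | h'
      · exact absurd hp.symm (not_bucketPrefix_eq_of_lt hk hk' h')
      · exact h'
      · exact absurd hp (not_bucketPrefix_eq_of_lt hk' hk h')
    have h1 := rankIn_eq_add (A := S) h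
    have h2 := rankIn_eq_add (A := markers S) h
    have h3 := card_between_le (k := k) hk'
    have h4 := Nat.mod_lt (rankIn (markers S) k) hb0
    have h5 := Nat.div_add_mod (rankIn (markers S) k) (Nat.size S.card)
    have h6 := Nat.div_add_mod (rankIn (markers S) k') (Nat.size S.card)
    rw [hq] at h5
    omega

/-- The values of the static functions can be stored in words of the given width. -/
theorem index_fits (hS : S.Nonempty) (f : Tab) : (index S f).Fits := by
  have hlt : ∀ {m n : ℕ}, m ≤ n → m < 2 ^ Nat.size n := fun h => h.trans_lt (Nat.lt_size_self _)
  cases f with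
  | handle =>
    intro p hp
    obtain ⟨e, he, rfl⟩ := Finset.mem_image.1 hp
    obtain ⟨s, a, l, h, rfl⟩ := mem_nodes_iff.1 (Finset.mem_filter.1 he).1
    refine hlt ?_
    exact (h.handle_val (h.mem_internalNodes_iff.1 he)).le.trans (h.name_le.trans h.le_width)
  | bucketLen => exact fun p _ => hlt (lcpLen_le _)
  | bucketBase =>
    intro p hp
    obtain ⟨k, hk, rfl⟩ := Finset.mem_image.1 hp
    exact hlt ((bucketRank_le hk).trans (Finset.card_filter_le _ _))
  | bucketOffset =>
    intro p hp
    obtain ⟨k, hk, rfl⟩ := Finset.mem_image.1 hp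
    rw [pre_width]
    exact hlt (rankIn_sub_bucketRank_lt hS hk).le
  | exitName =>
    intro q hq
    obtain ⟨s, hs, i, -, rfl⟩ := mem_setP.1 (Finset.mem_filter.1 hq).1
    obtain ⟨a, l, h, ha, hl⟩ := exists_skip hs (Nat.sub_le w (2 ^ (2 ^ i)))
    refine hlt ?_
    exact (h.exitNameLen_eq ha hl).le.trans (h.name_le.trans h.le_width)
  | level =>
    intro p hp
    obtain ⟨s, hs, i, hi, rfl⟩ := mem_setP.1 hp
    obtain ⟨a, l, h, ha, hl⟩ := exists_skip hs (Nat.sub_le w (2 ^ (2 ^ i)))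
    obtain ⟨i', hi', hval, -⟩ := h.level_val hi ha hl
    rw [hval]
    refine hlt ?_
    rw [← Finset.card_range i']
    exact Finset.card_le_card fun j hj =>
      mem_levels_of_le hi' (Finset.mem_range.1 hj).le

theorem size_le_lg (hw : 1 ≤ w) : (Nat.size w : ℝ) ≤ lg w + 1 := by
  rw [size_eq_log_succ (by omega), Nat.cast_add, Nat.cast_one]
  have : (2 : ℝ) ^ Nat.log 2 w ≤ w := by exact_mod_cast Nat.pow_log_le_self 2 (by omega)
  linarith [natCast_le_lg this]

theorem size_size_card_le (hw : 1 ≤ w) (S : Finset (BitVec w)) :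
    (Nat.size (Nat.size S.card) : ℝ) ≤ lg w + 2 := by
  have h1 : S.card ≤ 2 ^ w := by
    by_cases hS : S.Nonempty
    · have := card_sub_one_lt hS
      omega
    · rw [Finset.not_nonempty_iff_eq_empty.1 hS, Finset.card_empty]
      exact Nat.zero_le _
  have h2 : Nat.size S.card ≤ w + 1 :=
    Nat.size_le.2 (h1.trans_lt (Nat.pow_lt_pow_right one_lt_two (Nat.lt_succ_self w)))
  have h3 : Nat.size (Nat.size S.card) ≤ Nat.size w + 1 := by
    refine Nat.size_le.2 ?_
    have := Nat.lt_size_self w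
    rw [pow_succ]
    omega
  have h4 : (Nat.size (Nat.size S.card) : ℝ) ≤ Nat.size w + 1 := by exact_mod_cast h3
  linarith [size_le_lg hw]

theorem sq_le_two_pow_succ (k : ℕ) : k * k ≤ 2 ^ (k + 1) := by
  rcases lt_or_ge k 3 with h | h
  · interval_cases k <;> norm_num
  · induction k, h using Nat.le_induction with
    | base => norm_num
    | succ k hk ih =>
      rw [pow_succ]
      nlinarith

/-- The number of levels is `O(log log w)`, so even its square is `O(log w)`. -/
theorem card_levels_sq_le (w : ℕ) : ((levels w).card * (levels w).card : ℝ) ≤ 4 * lg w := by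
  rcases Nat.eq_zero_or_pos (levels w).card with h | h
  · rw [h, Nat.cast_zero, mul_zero]
    linarith [one_le_lg (w : ℝ)]
  · obtain ⟨i, hi, hk⟩ : ∃ i ∈ levels w, (levels w).card - 1 ≤ i := by
      by_contra! hlt
      have := Finset.card_le_card (t := Finset.range ((levels w).card - 1))
        fun i hi => Finset.mem_range.2 (hlt i hi)
      rw [Finset.card_range] at this
      omega
    set k := (levels w).card
    have h1 : 2 ^ (2 ^ (k - 1)) ≤ w := by
      have := mem_levels.1 hi
      have : 2 ^ (2 ^ (k - 1)) ≤ 2 ^ (2 ^ i) :=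
        Nat.pow_le_pow_right two_pos (Nat.pow_le_pow_right two_pos hk)
      omega
    have h2 : (2 : ℝ) ^ (2 ^ (k - 1)) ≤ w := by exact_mod_cast h1
    have h3 := natCast_le_lg h2
    have h4 : k * k ≤ 4 * 2 ^ (k - 1) := by
      have := sq_le_two_pow_succ k
      rwa [show k + 1 = 2 + (k - 1) by omega, pow_add] at this
    have h5 : (k * k : ℝ) ≤ 4 * ((2 ^ (k - 1) : ℕ) : ℝ) := by exact_mod_cast h4
    linarith

theorem card_dom_le (hw : 1 ≤ w) (hS : S.Nonempty) (f : Tab) :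
    ((index S f).dom.card : ℝ) ≤ 4 * (S.card * lg w) ∧
      ((index S f).width * (index S f).dom.card : ℝ) ≤ 12 * (S.card * lg w) := by
  have hL := one_le_lg (w : ℝ)
  have hn : (1 : ℝ) ≤ S.card := by exact_mod_cast hS.card_pos
  have hnL : (S.card : ℝ) ≤ S.card * lg w := le_mul_of_one_le_right (by linarith) hL
  -- for static functions with `O(n)` keys and values of `O(log w)` bits
  have key : ∀ {m r : ℕ} {A B : ℝ}, (m : ℝ) ≤ A * S.card → (r : ℝ) ≤ B * lg w → 0 ≤ A → A ≤ 4 →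
      A * B ≤ 12 → (m : ℝ) ≤ 4 * (S.card * lg w) ∧ (r * m : ℝ) ≤ 12 * (S.card * lg w) := by
    intro m r A B hm hr hA hA4 hAB
    constructor
    · nlinarith
    · calc (r * m : ℝ) ≤ (B * lg w) * (A * S.card) :=
            mul_le_mul hr hm (Nat.cast_nonneg _) ((Nat.cast_nonneg _).trans hr)
        _ = A * B * (S.card * lg w) := by ring
        _ ≤ 12 * (S.card * lg w) := by gcongr
  have hnodes : ((nodes S).card : ℝ) ≤ 2 * S.card := by exact_mod_cast card_nodes_le S
  have hmark : ((markers S).card : ℝ) ≤ 4 * S.card := by exact_mod_cast card_markers_le S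
  have hsize : (Nat.size w : ℝ) ≤ 2 * lg w := by linarith [size_le_lg hw]
  cases f with
  | handle =>
    refine key (A := 2) (le_trans ?_ hnodes) hsize (by norm_num) (by norm_num) (by norm_num)
    exact_mod_cast Finset.card_image_le.trans (Finset.card_filter_le _ _)
  | bucketLen =>
    refine key (A := 4) (le_trans ?_ hmark) hsize (by norm_num) (by norm_num) (by norm_num)
    exact_mod_cast Finset.card_image_le
  | bucketBase =>
    constructor
    · have h : (((markers S).image (bucketPrefix S)).card : ℝ) ≤ (markers S).card := by
        exact_mod_cast Finset.card_image_le
      simp only [index]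
      linarith
    · have h : (Nat.size S.card * ((markers S).image (bucketPrefix S)).card : ℝ) ≤ 5 * S.card := by
        exact_mod_cast size_mul_card_image_bucketPrefix_le hS
      simp only [index]
      linarith
  | bucketOffset =>
    refine key (A := 4) (B := 3) (le_trans ?_ hmark) ?_ (by norm_num) (by norm_num) (by norm_num)
    · exact_mod_cast Finset.card_image_le
    · simp only [index]
      linarith [size_size_card_le hw S]
  | exitName =>
    refine key (A := 2) ?_ hsize (by norm_num) (by norm_num) (by norm_num)
    exact_mod_cast card_setQ_le S
  | level =>
    have hP : ((setP S).card : ℝ) ≤ S.card * (levels w).card := by exact_mod_cast card_setP_le S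
    have hsq := card_levels_sq_le w
    have hk : ((levels w).card : ℝ) ≤ (levels w).card * (levels w).card := by
      exact_mod_cast Nat.le_mul_self _
    have hr : (Nat.size (levels w).card : ℝ) ≤ (levels w).card := by
      exact_mod_cast Nat.size_le.2 Nat.lt_two_pow_self
    simp only [index]
    constructor
    · calc ((setP S).card : ℝ) ≤ S.card * (levels w).card := hP
        _ ≤ S.card * (4 * lg w) := by gcongr; linarith
        _ = 4 * (S.card * lg w) := by ring
    · calc (Nat.size (levels w).card * (setP S).card : ℝ)
          ≤ (levels w).card * (S.card * (levels w).card) :=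
            mul_le_mul hr hP (Nat.cast_nonneg _) (Nat.cast_nonneg _)
        _ = S.card * ((levels w).card * (levels w).card) := by ring
        _ ≤ S.card * (12 * lg w) := mul_le_mul_of_nonneg_left (by linarith) (Nat.cast_nonneg _)
        _ = 12 * (S.card * lg w) := by ring

theorem exists_le_add_of_isLittleO {e : ℕ → ℝ}
    (he : e =o[Filter.atTop] (fun m => (m : ℝ))) : ∃ K : ℝ, 0 ≤ K ∧ ∀ m, e m ≤ K + m := by
  obtain ⟨N, hN⟩ := Filter.eventually_atTop.1 (he.bound one_pos)
  refine ⟨∑ m ∈ Finset.range N, |e m|, Finset.sum_nonneg fun _ _ => abs_nonneg _, fun m => ?_⟩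
  have hsum : 0 ≤ ∑ m ∈ Finset.range N, |e m| := Finset.sum_nonneg fun _ _ => abs_nonneg _
  rcases lt_or_ge m N with h | h
  · have h1 := Finset.single_le_sum (f := fun m => |e m|) (fun _ _ => abs_nonneg _)
      (Finset.mem_range.2 h)
    have h2 := le_abs_self (e m)
    have h3 : (0 : ℝ) ≤ m := Nat.cast_nonneg m
    linarith
  · have h1 := hN m h
    rw [one_mul, Real.norm_eq_abs, Real.norm_eq_abs, Nat.abs_cast] at h1
    linarith [le_abs_self (e m)]

theorem indexBits_le {c K : ℝ} {e : ℕ → ℝ} (hK : 0 ≤ K) (he : ∀ m, e m ≤ K + m) (hw : 1 ≤ w)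
    (hS : S.Nonempty) :
    indexBits c e S ≤ 6 * (16 + 4 * |c| + K) * S.card * lg w := by
  have hL := one_le_lg (w : ℝ)
  have hn : (1 : ℝ) ≤ S.card := by exact_mod_cast hS.card_pos
  have hnL : 1 ≤ S.card * lg w := one_le_mul_of_one_le_of_one_le hn hL
  have key : ∀ f, (index S f).bits c e ≤ (16 + 4 * |c| + K) * (S.card * lg w) := by
    intro f
    obtain ⟨h₁, h₂⟩ := card_dom_le hw hS f
    have h3 := he (index S f).dom.card
    have h4 : c * (index S f).dom.card ≤ |c| * (4 * (S.card * lg w)) :=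
      mul_le_mul (le_abs_self c) h₁ (Nat.cast_nonneg _) (abs_nonneg c)
    have h5 : K ≤ K * (S.card * lg w) := le_mul_of_one_le_right hK hnL
    rw [StaticFun.bits]
    linarith
  have h1 := key .handle
  have h2 := key .bucketLen
  have h3 := key .bucketBase
  have h4 := key .bucketOffset
  have h5 := key .exitName
  have h6 := key .level
  rw [indexBits]
  linarith

end Space

end ZFast

open ZFast in
theorem mainTheorem1 :
    (∃ C : ℝ, ∀ (w : ℕ) (S : Finset (BitVec w)), 1 ≤ w → S.Nonempty →
      ∀ E : Env w, E.IsFor S → ∀ x : BitVec w,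
        ∃ (r : BitVec w) (t : ℕ), ReturnsWithin E (shortDistancePred x) r t ∧
          IsPredIndex S x r ∧ (t : ℝ) ≤ C * lg (lg (shortDist S x))) ∧
    (∀ (c : ℝ) (e : ℕ → ℝ), e =o[Filter.atTop] (fun m => (m : ℝ)) →
      ∃ C : ℝ, ∀ (w : ℕ) (S : Finset (BitVec w)), 1 ≤ w → S.Nonempty →
        (∀ f : Tab, (index S f).Fits) ∧
          indexBits c e S ≤ C * S.card * lg w) := by
  refine ⟨⟨1284, fun w S hw hS E hE x => ?_⟩, fun c e he => ?_⟩
  · obtain ⟨t, hspec, ht⟩ := spec_shortDistancePred hE hw hS x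
    obtain ⟨r, hr, hpred⟩ := hspec.returnsWithin
    exact ⟨r, t, hr, hpred, ht⟩
  · obtain ⟨K, hK, hle⟩ := exists_le_add_of_isLittleO he
    exact ⟨6 * (16 + 4 * |c| + K), fun w S hw hS => ⟨index_fits hS, indexBits_le hK hle hw hS⟩⟩
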